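/- Let $S$ be a finite nonempty set with all subsets measurable, let $\lambda_S$ be the equidistribution on $S$, and let $z>0$. Particles are elements $y=(x,\sigma)$ of $\mathbb R^2\times S$, with reference measure $dy=dx\otimes\lambda_S$. A configuration is a set $Y\subset\mathbb R^2\times S$ having only finitely many particles with position in any bounded set; the configuration space $\mathcal Y$ carries the $\sigma$-algebra generated by the counting variables $Y\mapsto\#(Y\cap A)$, $A\subset\mathbb R^2\times S$ measurable. For $\Lambda\subset\mathbb R^2$ write $Y_\Lambda=Y\cap(\Lambda\times S)$. Let $|\cdot|_h$ be a norm on $\mathbb R^2$ and let $\phi_{\sigma_1\sigma_2}=\phi_{\sigma_2\sigma_1}:[0,\infty)\to[0,\infty]$ ($\sigma_1,\sigma_2\in S$) be measurable functions. Assume that each $\phi=\phi_{\sigma_1\sigma_2}$ is well behaved: there are $n\ge 0$ and $0\le r_0<\dots<r_n$ such that $\phi(r)=\infty$ for $r<r_0$, $\phi(r)=0$ for $r>r_n$, $\phi$ is continuous on every interval $(r_i,r_{i+1})$, and at each of the points $r_1,\dots,r_n$ the left and right limits of $\phi$ exist (continuity and limits in $[0,\infty]$). Let $U(x_1,\sigma_1,x_2,\sigma_2)=\phi_{\sigma_1\sigma_2}(|x_1-x_2|_h)$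 be the corresponding Potts-type potential. For bounded Borel $\Lambda\subset\mathbb R^2$ let $\nu_\Lambda(\cdot\,|\bar Y)$ be the law of $Y\cup\bar Y_{\Lambda^c}$, where $Y$ is a Poisson point process in $\Lambda\times S$ with intensity measure $dy$; let $H_\Lambda(Y)$ be the sum of $U(y_1,y_2)$ over all unordered pairs of distinct particles $y_1,y_2\in Y$ at least one of which lies in $\Lambda\times S$; and let $$\gamma_\Lambda(A|\bar Y)=\frac{1}{Z_\Lambda(\bar Y)}\int_A e^{-H_\Lambda(Y)}z^{\#Y_\Lambda}\,\nu_\Lambda(dY|\bar Y),\qquad Z_\Lambda(\bar Y)=\int e^{-H_\Lambda(Y)}z^{\#Y_\Lambda}\,\nu_\Lambda(dY|\bar Y).$$ A Gibbs measure for $U$ and $z$ is a probability measure $\mu$ on $\mathcal Y$ such that for all bounded Borel $\Lambda\subset\mathbb R^2$ and all measurable $A\subset\mathcal Y$, the conditional probability of $A$ under $\mu$ given the $\sigma$-algebra generated by $Y\mapsto Y_{\Lambda^c}$ equals $\gamma_\Lambda(A|\cdot)$ $\mu$-almost surely. Then every Gibbs measure $\mu$ for $U$ and $z$ is translation invariant: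 for every $v\in\mathbb R^2$, the image of $\mu$ under the map $Y\mapsto\{(x+v,\sigma):(x,\sigma)\in Y\}$ equals $\mu$. -/

import Mathlib

open MeasureTheory Set Filter Topology
open scoped ENNReal NNReal

noncomputable section

namespace GibbsParticles

/-- The state space of a particle: a position in the plane and a spin. -/
abbrev Particle (S : Type*) : Type _ := (ℝ × ℝ) × S

/-- The reference measure on particles: Lebesgue measure on positions times the
equidistribution on the finite spin space. -/
def refMeasure (S : Type*) [MeasurableSpace S] : Measure (Particle S) :=
  (volume : Measure (ℝ × ℝ)).prod (ProbabilityTheory.uniformOn (univ : Set S))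

/-- The set of particles with position in `Λ`. -/
def cyl (S : Type*) (Λ : Set (ℝ × ℝ)) : Set (Particle S) := {y | y.1 ∈ Λ}

/-- The configuration space: all locally finite sets of particles. -/
def Config (S : Type*) : Type _ :=
  {Y : Set (Particle S) // ∀ Λ : Set (ℝ × ℝ), Bornology.IsBounded Λ → (Y ∩ cyl S Λ).Finite}

namespace Config

variable {S : Type*}

/-- The number of particles of a configuration in a set of particles. -/
def count (A : Set (Particle S)) (Y : Config S) : ℕ∞ := (Y.1 ∩ A).encard

/-- The σ-algebra on configurations generated by the counting variables of measurable sets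
(the countable set `ℕ∞` of values carries the σ-algebra of all subsets). -/
instance instMeasurableSpace [MeasurableSpace S] : MeasurableSpace (Config S) :=
  ⨆ (A : Set (Particle S)) (_ : MeasurableSet A), MeasurableSpace.comap (count A) ⊤

/-- The restriction of a configuration to the particles with position in `Λ`. -/
def restrict (Λ : Set (ℝ × ℝ)) (Y : Config S) : Config S :=
  ⟨Y.1 ∩ cyl S Λ, fun Δ hΔ => (Y.2 Δ hΔ).subset
    (inter_subset_inter_left _ inter_subset_left)⟩

/-- The superposition of two configurations. -/
def union (Y Y' : Config S) : Config S :=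
  ⟨Y.1 ∪ Y'.1, fun Δ hΔ => by
    rw [union_inter_distrib_right]
    exact (Y.2 Δ hΔ).union (Y'.2 Δ hΔ)⟩

/-- The finite configuration `{y₁, …, y_k}`. -/
def ofTuple {k : ℕ} (y : Fin k → Particle S) : Config S :=
  ⟨range y, fun _ _ => (finite_range y).subset inter_subset_left⟩

/-- The configuration in which every particle is translated by `v`. -/
def translate (v : ℝ × ℝ) (Y : Config S) : Config S :=
  ⟨(fun y : Particle S => (y.1 + v, y.2)) '' Y.1, fun Δ hΔ => by
    have hb : Bornology.IsBounded ((fun x : ℝ × ℝ => x - v) '' Δ) := by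
      obtain ⟨C, hC⟩ := hΔ.exists_norm_le
      refine isBounded_iff_forall_norm_le.2 ⟨C + ‖v‖, ?_⟩
      rintro _ ⟨x, hx, rfl⟩
      exact (norm_sub_le _ _).trans (by gcongr; exact hC x hx)
    refine ((Y.2 _ hb).image (fun y : Particle S => (y.1 + v, y.2))).subset ?_
    rintro _ ⟨⟨y, hy, rfl⟩, hΔ'⟩
    exact ⟨y, ⟨hy, y.1 + v, hΔ', by simp⟩, rfl⟩⟩

section Measurability

variable [MeasurableSpace S]

theorem measurable_count {A : Set (Particle S)} (hA : MeasurableSet A) :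
    Measurable[_, ⊤] (count A) :=
  Measurable.of_comap_le (le_iSup₂_of_le A hA le_rfl)

theorem measurable_of_count {T : Type*} {m : MeasurableSpace T} {f : T → Config S}
    (h : ∀ A : Set (Particle S), MeasurableSet A →
      @Measurable T ℕ∞ m ⊤ (fun t => count A (f t))) : Measurable f := by
  refine Measurable.of_le_map ?_
  refine iSup₂_le fun A hA => ?_
  rintro _ ⟨B, hB, rfl⟩
  exact h A hA hB

theorem measurable_restrict {Λ : Set (ℝ × ℝ)} (hΛ : MeasurableSet Λ) :
    Measurable (restrict (S := S) Λ) := by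
  refine measurable_of_count fun A hA => ?_
  have hm : MeasurableSet (cyl S Λ ∩ A) := (measurable_fst hΛ).inter hA
  have : (fun Y : Config S => count A (restrict Λ Y)) = count (cyl S Λ ∩ A) := by
    funext Y
    simp only [count, restrict, inter_assoc]
  rw [this]
  exact measurable_count hm

theorem measurable_glue {Λ : Set (ℝ × ℝ)} (hΛ : MeasurableSet Λ) (Ybar : Config S) :
    Measurable (fun Y : Config S => (Y.restrict Λ).union (Ybar.restrict Λᶜ)) := by
  refine measurable_of_count fun A hA => ?_
  have hm : MeasurableSet (cyl S Λ ∩ A) := (measurable_fst hΛ).inter hA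
  have : (fun Y : Config S => count A ((Y.restrict Λ).union (Ybar.restrict Λᶜ))) =
      (fun n : ℕ∞ => n + count A (Ybar.restrict Λᶜ)) ∘ count (cyl S Λ ∩ A) := by
    funext Y
    simp only [count, restrict, union, Function.comp, union_inter_distrib_right]
    rw [encard_union_eq, inter_assoc]
    refine disjoint_left.2 ?_
    rintro y ⟨⟨_, h1⟩, _⟩ ⟨⟨_, h2⟩, _⟩
    exact h2 h1
  rw [this]
  exact Measurable.comp (fun _ _ => trivial) (measurable_count hm)

theorem measurable_translate (v : ℝ × ℝ) : Measurable (translate (S := S) v) := by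
  refine measurable_of_count fun A hA => ?_
  have hf : Measurable (fun y : Particle S => ((y.1 + v, y.2) : Particle S)) := by fun_prop
  have : (fun Y : Config S => count A (translate v Y)) =
      count ((fun y : Particle S => ((y.1 + v, y.2) : Particle S)) ⁻¹' A) := by
    funext Y
    simp only [count, translate]
    rw [← image_inter_preimage, Function.Injective.encard_image]
    rintro ⟨x, s⟩ ⟨x', s'⟩ h
    simpa using h
  rw [this]
  exact measurable_count (hf hA)

theorem measurable_ofTuple [Countable S] [MeasurableSingletonClass S] {k : ℕ} :
    Measurable (ofTuple (S := S) (k := k)) := by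
  refine measurable_of_count fun A hA => ?_
  let T : (Fin k → Particle S) → Set (Fin k) :=
    fun y => {i | y i ∈ A ∧ ∀ j < i, y j ≠ y i}
  have heq : ∀ i j, MeasurableSet {y : Fin k → Particle S | y i = y j} := by
    intro i j
    have : {y : Fin k → Particle S | y i = y j} =
        {y | (y i).1 = (y j).1} ∩ ⋃ s : S, {y | (y i).2 = s} ∩ {y | (y j).2 = s} := by
      ext y
      simp [Prod.ext_iff, eq_comm]
    rw [this]
    refine (measurableSet_eq_fun (by fun_prop) (by fun_prop)).inter
      (MeasurableSet.iUnion fun s => ?_)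
    have h2 : ∀ l : Fin k, Measurable fun y : Fin k → Particle S => (y l).2 := fun l => by
      fun_prop
    exact (h2 i (measurableSet_singleton s)).inter (h2 j (measurableSet_singleton s))
  have hT : Measurable T := by
    refine measurable_set_iff.2 fun i => measurableSet_setOfPred.1 ?_
    have : {y : Fin k → Particle S | i ∈ T y} =
        (fun y => y i) ⁻¹' A ∩ ⋂ j : Fin k, {y | j < i → y j ≠ y i} := by
      ext y
      simp [T]
    rw [this]
    refine (measurable_pi_apply i hA).inter (MeasurableSet.iInter fun j => ?_)
    by_cases hj : j < i
    · simp only [hj, forall_const]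
      exact (heq j i).compl
    · simp [hj]
  have : (fun y : Fin k → Particle S => count A (ofTuple y)) = encard ∘ T := by
    classical
    funext y
    have him : range y ∩ A = y '' T y := by
      ext p
      constructor
      · rintro ⟨⟨i, rfl⟩, hiA⟩
        have hne : (Finset.univ.filter fun j => y j = y i).Nonempty := ⟨i, by simp⟩
        have hmin := Finset.min'_mem _ hne
        simp only [Finset.mem_filter, Finset.mem_univ, true_and] at hmin
        refine ⟨_, ⟨by rw [hmin]; exact hiA, fun j hj hjy => ?_⟩, hmin⟩
        exact absurd (Finset.min'_le (Finset.univ.filter fun j => y j = y i) j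
          (by simp [hjy, hmin])) (not_le.2 hj)
      · rintro ⟨i, hi, rfl⟩
        exact ⟨⟨i, rfl⟩, hi.1⟩
    have hinj : InjOn y (T y) := by
      intro i hi j hj hij
      rcases lt_trichotomy i j with hlt | heq' | hlt
      · exact absurd hij (hj.2 i hlt)
      · exact heq'
      · exact absurd hij.symm (hi.2 j hlt)
    simp only [count, ofTuple, Function.comp, him]
    exact hinj.encard_image
  rw [this]
  intro B _
  exact hT (t := encard ⁻¹' B) (Set.toFinite _).measurableSet

end Measurability

end Config

/-- The law of the Poisson point process in a bounded Borel set `Λ`, with intensity the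
reference measure: `e^{-λ(Λ)} ∑ₖ (1/k!) ∫_{Λᵏ} 1{ {y₁,…,y_k} ∈ · } dy₁ … dy_k`. -/
def poisson (S : Type*) [MeasurableSpace S] (Λ : Set (ℝ × ℝ)) : Measure (Config S) :=
  ENNReal.ofReal (Real.exp (-(volume Λ).toReal)) •
    Measure.sum fun k : ℕ => (Nat.factorial k : ℝ≥0∞)⁻¹ •
      (Measure.pi fun _ : Fin k => (refMeasure S).restrict (cyl S Λ)).map Config.ofTuple

variable {S : Type*}

/-- The law of the Poisson point process in `Λ` with boundary condition `Ybar`. -/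
def poissonBC [MeasurableSpace S] (Λ : Set (ℝ × ℝ)) (Ybar : Config S) : Measure (Config S) :=
  (poisson S Λ).map fun Y => (Y.restrict Λ).union (Ybar.restrict Λᶜ)

/-- The energy of a configuration for a nonnegative symmetric pair potential `U`: the sum of `U`
over unordered pairs of distinct particles, i.e. half the sum over ordered pairs. -/
def energy (U : Particle S → Particle S → ℝ≥0∞) (Y : Config S) : ℝ≥0∞ :=
  2⁻¹ * ∑' (y₁ : Y.1) (y₂ : Y.1), ({y | y ≠ y₁.1} : Set (Particle S)).indicator (U y₁) y₂

/-- The interaction energy between two configurations. -/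
def interaction (U : Particle S → Particle S → ℝ≥0∞) (Y Y' : Config S) : ℝ≥0∞ :=
  ∑' (y₁ : Y.1) (y₂ : Y'.1), U y₁ y₂

/-- The Hamiltonian of a configuration in `Λ`. -/
def hamiltonian (U : Particle S → Particle S → ℝ≥0∞) (Λ : Set (ℝ × ℝ)) (Y : Config S) : ℝ≥0∞ :=
  energy U (Y.restrict Λ) + interaction U (Y.restrict Λ) (Y.restrict Λᶜ)

/-- The weight `e^{-H_Λ(Y)} z^{#Y_Λ}`, with `e^{-∞} = 0`. -/
def weight (U : Particle S → Particle S → ℝ≥0∞) (z : ℝ) (Λ : Set (ℝ × ℝ)) (Y : Config S) :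
    ℝ≥0∞ :=
  EReal.exp (-(hamiltonian U Λ Y : EReal)) * ENNReal.ofReal z ^ (Y.restrict Λ).1.ncard

/-- The partition function in `Λ` with boundary condition `Ybar`. -/
def partitionFunction [MeasurableSpace S] (U : Particle S → Particle S → ℝ≥0∞) (z : ℝ)
    (Λ : Set (ℝ × ℝ)) (Ybar : Config S) : ℝ≥0∞ :=
  ∫⁻ Y, weight U z Λ Y ∂(poissonBC Λ Ybar)

/-- The conditional Gibbs distribution in `Λ` with boundary condition `Ybar`. -/
def gibbsKernel [MeasurableSpace S] (U : Particle S → Particle S → ℝ≥0∞) (z : ℝ)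
    (Λ : Set (ℝ × ℝ)) (Ybar : Config S) (A : Set (Config S)) : ℝ≥0∞ :=
  (partitionFunction U z Λ Ybar)⁻¹ * ∫⁻ Y, A.indicator (weight U z Λ) Y ∂(poissonBC Λ Ybar)

/-- The σ-algebra of the events that only depend on the particles in `Δ`. -/
@[reducible] def eventsIn (S : Type*) [MeasurableSpace S] (Δ : Set (ℝ × ℝ)) : MeasurableSpace (Config S) :=
  MeasurableSpace.comap (Config.restrict Δ) Config.instMeasurableSpace

theorem eventsIn_le [MeasurableSpace S] {Δ : Set (ℝ × ℝ)} (hΔ : MeasurableSet Δ) :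
    eventsIn S Δ ≤ Config.instMeasurableSpace :=
  (Config.measurable_restrict hΔ).comap_le

/-- `μ` is a Gibbs measure for the nonnegative pair potential `U` and the activity `z`: it is a
probability measure on configurations, and for every bounded Borel set `Λ` the conditional
probabilities given the configuration outside `Λ` are the conditional Gibbs distributions. -/
def IsGibbsMeasure [MeasurableSpace S] (U : Particle S → Particle S → ℝ≥0∞) (z : ℝ)
    (μ : Measure (Config S)) : Prop :=
  IsProbabilityMeasure μ ∧
    ∀ Λ : Set (ℝ × ℝ), MeasurableSet Λ → Bornology.IsBounded Λ →
      ∀ A : Set (Config S), MeasurableSet A →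
        μ[A.indicator (fun _ => (1 : ℝ)) | eventsIn S Λᶜ] =ᵐ[μ]
          fun Ybar => (gibbsKernel U z Λ Ybar A).toReal

/-- The Potts type potential `U(x₁,σ₁,x₂,σ₂) = φ_{σ₁σ₂}(|x₁ - x₂|)` for the norm `h`. -/
def pottsPotential (h : Seminorm ℝ (ℝ × ℝ)) (φ : S → S → ℝ≥0 → ℝ≥0∞) :
    Particle S → Particle S → ℝ≥0∞ :=
  fun y₁ y₂ => φ y₁.2 y₂.2 ⟨h (y₁.1 - y₂.1), apply_nonneg h _⟩

/-- Well behaved functions `φ : [0,∞) → [0,∞]`. Continuity and one-sided limits are understood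
in `[0,∞]`; nothing is required of `φ` at the points `r₀, …, r_n` themselves or of its
behaviour near `r₀`. -/
def WellBehaved (φ : ℝ≥0 → ℝ≥0∞) : Prop :=
  ∃ (n : ℕ) (r : Fin (n + 1) → ℝ≥0), StrictMono r ∧
    (∀ t, t < r 0 → φ t = ⊤) ∧
    (∀ t, r (Fin.last n) < t → φ t = 0) ∧
    (∀ i : Fin n, ContinuousOn φ (Ioo (r i.castSucc) (r i.succ))) ∧
    ∀ i : Fin n, (∃ l : ℝ≥0∞, Tendsto φ (𝓝[<] (r i.succ)) (𝓝 l)) ∧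
      ∃ l : ℝ≥0∞, Tendsto φ (𝓝[>] (r i.succ)) (𝓝 l)

end GibbsParticles

end

/-! In two dimensions a window can be translated by `w` while everything far away stays fixed, at
arbitrarily small cost: there are cutoffs `τ` that equal one on a large ball, vanish farther out and
have small Dirichlet integral (`exists_cutoff`). The goal is `μ(A) ≤ (μ(A + w) + μ(A - w)) / 2` for
every event `A` that depends on a bounded window (`IsGibbsMeasure.measureReal_le`). Along the
multiples of a vector the probabilities of the translates of `A` then form a convex bounded
sequence, which cannot increase; using both `v` and `-v` gives invariance, since local events
generate the σ-algebra (`map_translate_eq_of_midpoint_le`).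

Shifting every particle by `τ(x) w` and expanding to second order would require a smooth potential,
but here it may jump or have a hard core. So `e^{-U}` is split as `q² + bond`, where `q` satisfies
`q(x)² ≤ q(x+s) q(x-s) + C‖s‖²` and `bond` is nonnegative, of finite range and of integral as small
as desired (`exists_split`); `q` is an upper envelope of parabolas below `e^{-U/2}`. Multiplying out
the product over pairs gives a sum over sets `B` of bonds. For fixed `B` each cluster is moved
rigidly, by `τ` at the position of a representative times `w`. Bond weights do not change, and the
Jacobian is a product over representatives (`lintegral_moveJac_mul`). For the soft pairs and the
Jacobian, the geometric mean of the weights after the moves by `w` and `-w` dominates the original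
weight up to second order errors, and the arithmetic mean dominates the geometric one
(`softProd_le_of_move`). After summation over `B` this becomes the midpoint inequality with an
error.

The error has three sources: clusters of large extension, the Jacobian, and soft pairs between
different clusters. Each is dominated by a sum over paths of marked particles linked by bonds. Since
the pair weights are at most one, marked particles decouple from the others, as in Ruelle's bound
(`grand_le_of_marked`), and each bond of the path costs a factor `z * eps ≤ 1/2`. The sums over
paths converge and leave a multiple of the Dirichlet integral of `τ` plus a term for large clusters;
both tend to zero as the cutoff spreads out (`exists_lossBound_le`). -/

noncomputable section

namespace GibbsParticles

/-! ### Products over unordered pairs of entries of a tuple -/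

section Pairs

variable {P : Type*}

/-- The unordered pairs of distinct indices. -/
def edges (k : ℕ) : Finset (Sym2 (Fin k)) := Finset.univ.filter fun p => ¬ p.IsDiag

theorem mk_mem_edges {k : ℕ} {i j : Fin k} : s(i, j) ∈ edges k ↔ i ≠ j := by
  simp [edges]

/-- The value of a symmetric pair function at an unordered pair of entries of a tuple. -/
def pairVal {β : Type*} (u : P → P → β) {k : ℕ} (y : Fin k → P) (p : Sym2 (Fin k)) : β :=
  u (y (Quot.out p).1) (y (Quot.out p).2)

theorem pairVal_mk {β : Type*} {u : P → P → β} (hu : ∀ a b, u a b = u b a) {k : ℕ}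
    (y : Fin k → P) (i j : Fin k) : pairVal u y s(i, j) = u (y i) (y j) := by
  have h : s((Quot.out s(i, j)).1, (Quot.out s(i, j)).2) = s(i, j) := Quot.out_eq s(i, j)
  rcases Sym2.eq_iff.1 h with ⟨h1, h2⟩ | ⟨h1, h2⟩
  · simp only [pairVal, h1, h2]
  · simp only [pairVal, h1, h2, hu (y j)]

theorem measurable_pairVal [MeasurableSpace P] {β : Type*} [MeasurableSpace β] {u : P → P → β}
    (hu : Measurable (Function.uncurry u)) {k : ℕ} (p : Sym2 (Fin k)) :
    Measurable fun y : Fin k → P => pairVal u y p :=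
  hu.comp (f := fun y : Fin k → P => (y (Quot.out p).1, y (Quot.out p).2)) (by fun_prop)

/-- The product of a pair function over all pairs of entries of a tuple. -/
def pairProd (u : P → P → ℝ≥0∞) {k : ℕ} (y : Fin k → P) : ℝ≥0∞ :=
  ∏ p ∈ edges k, pairVal u y p

theorem measurable_pairProd [MeasurableSpace P] {u : P → P → ℝ≥0∞}
    (hu : Measurable (Function.uncurry u)) {k : ℕ} :
    Measurable fun y : Fin k → P => pairProd u y :=
  Finset.measurable_prod _ fun p _ => measurable_pairVal hu p

end Pairs

/-- Applied with `f` the bond and `g` the soft weight: once the bonds in `t` are prescribed, summing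
over the others restores the full weight on every remaining pair. It is the expansion of `∏ (f + g)`
with `g` set to zero on `t`, which kills the subsets that do not contain `t`. -/
theorem sum_powerset_filter_prod {α : Type*} [DecidableEq α] (s t : Finset α) (hts : t ⊆ s)
    (f g : α → ℝ≥0∞) :
    ∑ B ∈ s.powerset with t ⊆ B, (∏ p ∈ B, f p) * ∏ p ∈ s \ B, g p =
      (∏ p ∈ t, f p) * ∏ p ∈ s \ t, (f p + g p) := by
  have h1 := Finset.prod_add f (fun p => if p ∈ t then 0 else g p) s
  have h2 : ∏ p ∈ s, (f p + if p ∈ t then 0 else g p) =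
      (∏ p ∈ t, f p) * ∏ p ∈ s \ t, (f p + g p) := by
    rw [← Finset.prod_sdiff hts, mul_comm]
    congr 1
    · exact Finset.prod_congr rfl fun p hp => by simp [hp]
    · exact Finset.prod_congr rfl fun p hp => by simp [(Finset.mem_sdiff.1 hp).2]
  rw [← h2, h1, Finset.sum_filter]
  refine Finset.sum_congr rfl fun B hB => ?_
  split_ifs with h
  · congr 1
    refine Finset.prod_congr rfl fun p hp => ?_
    rw [if_neg fun hpt => (Finset.mem_sdiff.1 hp).2 (h hpt)]
  · obtain ⟨p, hpt, hpB⟩ := Finset.not_subset.1 h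
    rw [Finset.prod_eq_zero (Finset.mem_sdiff.2 ⟨hts hpt, hpB⟩) (by simp [hpt]), mul_zero]

/-! ### Grand canonical integrals and the decoupling of marked particles -/

section Ruelle

variable {P : Type*} [MeasurableSpace P] (ref : Measure P) [SigmaFinite ref]

/-- The Boltzmann weight of a tuple, for the one-particle weight `b` and the pair weight `e`. -/
def tupleWeight (b : P → ℝ≥0∞) (e : P → P → ℝ≥0∞) {k : ℕ} (y : Fin k → P) : ℝ≥0∞ :=
  (∏ i, b (y i)) * pairProd e y

theorem measurable_tupleWeight {b : P → ℝ≥0∞} {e : P → P → ℝ≥0∞} (hb : Measurable b)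
    (he : Measurable (Function.uncurry e)) {k : ℕ} :
    Measurable fun y : Fin k → P => tupleWeight b e y :=
  (Finset.measurable_prod _ fun i _ => hb.comp (measurable_pi_apply i)).mul
    (measurable_pairProd he)

/-- The grand canonical integral of a family of functions of tuples. -/
def grand (z : ℝ≥0∞) (F : ∀ k : ℕ, (Fin k → P) → ℝ≥0∞) : ℝ≥0∞ :=
  ∑' k : ℕ, z ^ k * (Nat.factorial k : ℝ≥0∞)⁻¹ * ∫⁻ y, F k y ∂(Measure.pi fun _ : Fin k => ref)

/-- Fubini: the disjoint images of `f` and `g` exhaust the coordinates because `m + n = k`. -/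
theorem lintegral_embeddings {m n k : ℕ} (hk : m + n = k) (f : Fin m ↪ Fin k) (g : Fin n ↪ Fin k)
    (hfg : ∀ i j, f i ≠ g j) {F : (Fin m → P) → ℝ≥0∞} {G : (Fin n → P) → ℝ≥0∞}
    (hF : Measurable F) (hG : Measurable G) :
    ∫⁻ y, F (y ∘ f) * G (y ∘ g) ∂(Measure.pi fun _ : Fin k => ref) =
      (∫⁻ y, F y ∂(Measure.pi fun _ : Fin m => ref)) *
        ∫⁻ y, G y ∂(Measure.pi fun _ : Fin n => ref) := by
  have hinj : Function.Injective (Sum.elim f g) :=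
    f.injective.sumElim g.injective hfg
  have hbij : Function.Bijective (Sum.elim f g) :=
    (Fintype.bijective_iff_injective_and_card _).2 ⟨hinj, by simp [hk]⟩
  let σ : Fin m ⊕ Fin n ≃ Fin k := Equiv.ofBijective _ hbij
  have h1 := measurePreserving_piCongrLeft (fun _ : Fin k => ref) σ
  have h2 := measurePreserving_sumPiEquivProdPi_symm (fun _ : Fin m ⊕ Fin n => ref)
  have h3 := h1.comp h2
  rw [← h3.lintegral_comp (f := fun y => F (y ∘ f) * G (y ∘ g)) (by fun_prop)]
  have h4 : ∀ p : (Fin m → P) × (Fin n → P), ∀ a,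
      (MeasurableEquiv.piCongrLeft (fun _ : Fin k => P) σ)
        ((MeasurableEquiv.sumPiEquivProdPi fun _ : Fin m ⊕ Fin n => P).symm p) (σ a) =
      Sum.elim p.1 p.2 a := by
    intro p a
    rw [MeasurableEquiv.coe_piCongrLeft, Equiv.piCongrLeft_apply_apply]
    cases a <;> rfl
  have h5 : ∀ p : (Fin m → P) × (Fin n → P),
      (F (((MeasurableEquiv.piCongrLeft (fun _ : Fin k => P) σ) ∘
        ((MeasurableEquiv.sumPiEquivProdPi fun _ : Fin m ⊕ Fin n => P).symm)) p ∘ f)) *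
      (G (((MeasurableEquiv.piCongrLeft (fun _ : Fin k => P) σ) ∘
        ((MeasurableEquiv.sumPiEquivProdPi fun _ : Fin m ⊕ Fin n => P).symm)) p ∘ g)) =
      F p.1 * G p.2 := by
    intro p
    congr 2
    · funext i; exact h4 p (Sum.inl i)
    · funext i; exact h4 p (Sum.inr i)
  rw [lintegral_congr h5, ← lintegral_prod_mul hF.aemeasurable hG.aemeasurable]

theorem exists_complementary_embedding {m n k : ℕ} (hk : m + n = k) (f : Fin m ↪ Fin k) :
    ∃ g : Fin n ↪ Fin k, ∀ i j, f i ≠ g j := by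
  classical
  have hc : Fintype.card {i : Fin k // i ∉ range f} = n := by
    rw [Fintype.card_subtype_compl, Fintype.card_fin]
    have : Fintype.card {x // x ∈ range f} = m := by
      rw [← Set.toFinset_card (range f)]
      simp [Set.toFinset_range, Finset.card_image_of_injective _ f.injective]
    omega
  let σ := (Fintype.equivFinOfCardEq hc).symm
  refine ⟨σ.toEmbedding.trans (Function.Embedding.subtype _), fun i j h => ?_⟩
  exact (σ j).2 ⟨i, h⟩

/-- The number of ways to mark `m` of `n + m` particles turns the factor `1 / (n + m)!` into `1 /
n!`, so the unmarked particles again carry the grand canonical weight. -/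
theorem inv_factorial_mul_descFactorial (n m : ℕ) :
    ((n + m).factorial : ℝ≥0∞)⁻¹ * ((n + m).descFactorial m : ℝ≥0∞) =
      (n.factorial : ℝ≥0∞)⁻¹ := by
  have hfac : ((n + m).factorial : ℝ≥0∞) = n.factorial * (n + m).descFactorial m := by
    rw [← Nat.factorial_mul_descFactorial (Nat.le_add_left m n), Nat.add_sub_cancel]
    push_cast; ring
  have h0 : ((n + m).descFactorial m : ℝ≥0∞) ≠ 0 := by
    rw [Nat.cast_ne_zero, Ne, Nat.descFactorial_eq_zero_iff_lt]; omega
  have h1 : ((n + m).descFactorial m : ℝ≥0∞) ≠ ⊤ := ENNReal.natCast_ne_top _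
  rw [hfac, ENNReal.mul_inv (Or.inr h1) (Or.inr h0), mul_assoc,
    ENNReal.inv_mul_cancel h0 h1, mul_one]

theorem tsum_eq_tsum_add_of_eq_zero (f : ℕ → ℝ≥0∞) (m : ℕ) (hf : ∀ k < m, f k = 0) :
    ∑' k, f k = ∑' n, f (n + m) := by
  rw [← Summable.sum_add_tsum_nat_add' (k := m) ENNReal.summable, Finset.sum_eq_zero, zero_add]
  exact fun k hk => hf k (Finset.mem_range.1 hk)

/-- Ruelle's bound: a family of functions that is dominated by a sum, over the choices of `m`
marked particles, of a function of the marked particles times the weight of the others. -/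
theorem grand_le_of_marked {z : ℝ≥0∞} {b : P → ℝ≥0∞} {e : P → P → ℝ≥0∞}
    (hb : Measurable b) (he : Measurable (Function.uncurry e)) {m : ℕ}
    {F : (Fin m → P) → ℝ≥0∞} (hF : Measurable F)
    {Θ : ∀ k : ℕ, (Fin m ↪ Fin k) → (Fin k → P) → ℝ≥0∞}
    (hΘm : ∀ k f, Measurable (Θ k f))
    (hΘ : ∀ (n k : ℕ) (f : Fin m ↪ Fin k) (g : Fin n ↪ Fin k), m + n = k →
      (∀ i j, f i ≠ g j) → ∀ y, Θ k f y ≤ F (y ∘ f) * tupleWeight b e (y ∘ g)) :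
    grand ref z (fun k y => ∑ f, Θ k f y) ≤
      z ^ m * (∫⁻ y, F y ∂(Measure.pi fun _ : Fin m => ref)) *
        grand ref z (fun _ y => tupleWeight b e y) := by
  have hterm : ∀ k : ℕ, k < m → ∫⁻ y, ∑ f, Θ k f y ∂(Measure.pi fun _ : Fin k => ref) = 0 := by
    intro k hk
    have : IsEmpty (Fin m ↪ Fin k) := by
      refine Function.Embedding.isEmpty_of_card_lt (by simpa using hk)
    simp
  have hterm' : ∀ n : ℕ, ∫⁻ y, ∑ f, Θ (n + m) f y ∂(Measure.pi fun _ : Fin (n + m) => ref) ≤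
      ((n + m).descFactorial m : ℝ≥0∞) *
        ((∫⁻ y, F y ∂(Measure.pi fun _ : Fin m => ref)) *
          ∫⁻ y, tupleWeight b e y ∂(Measure.pi fun _ : Fin n => ref)) := by
    intro n
    rw [lintegral_finsetSum _ fun f _ => hΘm _ f]
    calc _ ≤ ∑ f : Fin m ↪ Fin (n + m), ((∫⁻ y, F y ∂(Measure.pi fun _ : Fin m => ref)) *
          ∫⁻ y, tupleWeight b e y ∂(Measure.pi fun _ : Fin n => ref)) := by
          refine Finset.sum_le_sum fun f _ => ?_
          obtain ⟨g, hg⟩ := exists_complementary_embedding (add_comm m n) f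
          rw [← lintegral_embeddings ref (add_comm m n) f g hg hF (measurable_tupleWeight hb he)]
          exact lintegral_mono fun y => hΘ n _ f g (add_comm m n) hg y
      _ = _ := by
          rw [Finset.sum_const, Finset.card_univ, Fintype.card_embedding_eq]
          simp
  unfold grand
  -- Fewer than `m` particles cannot carry `m` marks, so the series starts at `k = m`.
  rw [tsum_eq_tsum_add_of_eq_zero _ m, ← ENNReal.tsum_mul_left]
  · refine ENNReal.tsum_le_tsum fun n => ?_
    calc _ ≤ z ^ (n + m) * ((n + m).factorial : ℝ≥0∞)⁻¹ * (((n + m).descFactorial m : ℝ≥0∞) *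
        ((∫⁻ y, F y ∂(Measure.pi fun _ : Fin m => ref)) *
          ∫⁻ y, tupleWeight b e y ∂(Measure.pi fun _ : Fin n => ref))) :=
          mul_le_mul_right (hterm' n) _
      _ = z ^ (n + m) * (((n + m).factorial : ℝ≥0∞)⁻¹ * ((n + m).descFactorial m : ℝ≥0∞)) *
        ((∫⁻ y, F y ∂(Measure.pi fun _ : Fin m => ref)) *
          ∫⁻ y, tupleWeight b e y ∂(Measure.pi fun _ : Fin n => ref)) := by
          simp only [mul_assoc]
      _ = _ := by
          rw [inv_factorial_mul_descFactorial, pow_add]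
          ring
  · intro k hk
    rw [hterm k hk, mul_zero]

/-- The last vertex occurs only in the last kernel, so integrating it out first costs the factor `c
l`. The kernels may vary along the chain because some chains begin with a proximity indicator
instead of a bond. -/
theorem lintegral_chain_le {l : ℕ} {F : P → ℝ≥0∞} (hF : Measurable F)
    (κ : ℕ → P → P → ℝ≥0∞) (hκ : ∀ a, Measurable (Function.uncurry (κ a))) (c : ℕ → ℝ≥0∞)
    (hc : ∀ a y, ∫⁻ y', κ a y y' ∂ref ≤ c a) :
    ∫⁻ y, F (y 0) * ∏ a : Fin l, κ a (y a.castSucc) (y a.succ)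
        ∂(Measure.pi fun _ : Fin (l + 1) => ref) ≤
      (∫⁻ y, F y ∂ref) * ∏ a : Fin l, c a := by
  induction l with
  | zero =>
    have := (measurePreserving_funUnique ref (Fin 1)).lintegral_comp hF
    simp only [Finset.univ_eq_empty, Finset.prod_empty, mul_one]
    exact le_of_eq this
  | succ l ih =>
    have hmp := (measurePreserving_piFinSuccAbove (fun _ : Fin (l + 1 + 1) => ref)
      (Fin.last (l + 1))).symm
    have hm : Measurable fun y : Fin (l + 1 + 1) → P =>
        F (y 0) * ∏ a : Fin (l + 1), κ a (y a.castSucc) (y a.succ) := by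
      refine (hF.comp (measurable_pi_apply 0)).mul (Finset.measurable_prod _ fun a _ => ?_)
      exact (hκ a).comp (f := fun y : Fin (l + 1 + 1) → P => (y a.castSucc, y a.succ))
        (by fun_prop)
    rw [← hmp.lintegral_comp hm]
    refine (lintegral_prod_symm _ (hm.comp hmp.measurable).aemeasurable).le.trans ?_
    have hpt : ∀ (y : Fin (l + 1) → P) (x : P),
        F ((MeasurableEquiv.piFinSuccAbove (fun _ => P) (Fin.last (l + 1))).symm (x, y) 0) *
          ∏ a : Fin (l + 1), κ a
            ((MeasurableEquiv.piFinSuccAbove (fun _ => P) (Fin.last (l + 1))).symm (x, y)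
              a.castSucc)
            ((MeasurableEquiv.piFinSuccAbove (fun _ => P) (Fin.last (l + 1))).symm (x, y)
              a.succ) =
        (F (y 0) * ∏ a : Fin l, κ a (y a.castSucc) (y a.succ)) * κ l (y (Fin.last l)) x := by
      intro y x
      have hs : ∀ i : Fin (l + 1),
          (MeasurableEquiv.piFinSuccAbove (fun _ => P) (Fin.last (l + 1))).symm (x, y)
            i.castSucc = y i := by
        intro i
        simp [MeasurableEquiv.piFinSuccAbove, Fin.insertNthEquiv, Fin.insertNth_last']
      have hl : (MeasurableEquiv.piFinSuccAbove (fun _ => P) (Fin.last (l + 1))).symm (x, y)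
            (Fin.last (l + 1)) = x := by
        simp [MeasurableEquiv.piFinSuccAbove, Fin.insertNthEquiv, Fin.insertNth_last']
      rw [Fin.prod_univ_castSucc, ← Fin.castSucc_zero, hs, mul_assoc, Fin.succ_last, hl, hs]
      congr 2
      refine Finset.prod_congr rfl fun a _ => ?_
      rw [hs, Fin.succ_castSucc, hs]
      rfl
    calc _ = ∫⁻ y, ∫⁻ x, (F (y 0) * ∏ a : Fin l, κ a (y a.castSucc) (y a.succ)) *
          κ l (y (Fin.last l)) x ∂ref ∂(Measure.pi fun _ : Fin (l + 1) => ref) :=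
          lintegral_congr fun y => lintegral_congr fun x => hpt y x
      _ ≤ ∫⁻ y, (F (y 0) * ∏ a : Fin l, κ a (y a.castSucc) (y a.succ)) * c l
          ∂(Measure.pi fun _ : Fin (l + 1) => ref) := by
          refine lintegral_mono fun y => ?_
          have : Measurable (κ l (y (Fin.last l))) := (hκ l).comp measurable_prodMk_left
          dsimp only
          rw [lintegral_const_mul _ this]
          gcongr
          exact hc _ _
      _ ≤ _ := by
          rw [lintegral_mul_const, Fin.prod_univ_castSucc, ← mul_assoc]
          · exact mul_le_mul_left ih _
          · refine (hF.comp (measurable_pi_apply 0)).mul (Finset.measurable_prod _ fun a _ => ?_)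
            exact (hκ a).comp (f := fun y : Fin (l + 1) → P => (y a.castSucc, y a.succ))
              (by fun_prop)

end Ruelle

/-! ### Soft parts: envelopes of parabolas from below -/

section SoftPart

/-- A concave parabola of curvature `M` with apex `p.2` over the point `p.1`. -/
def parabola (M : ℝ) (p : (ℝ × ℝ) × ℝ) (x : ℝ × ℝ) : ℝ :=
  p.2 - M * ((x.1 - p.1.1) ^ 2 + (x.2 - p.1.2) ^ 2)

/-- The parabolas below `f`. -/
def Subparabola (f : ℝ × ℝ → ℝ) (M : ℝ) : Type :=
  {p : (ℝ × ℝ) × ℝ // p.2 ≤ 1 ∧ ∀ u, parabola M p u ≤ f u}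

/-- The soft part of `f`: the supremum of the positive parts of the parabolas below `f`. -/
def softPart (f : ℝ × ℝ → ℝ) (M : ℝ) (x : ℝ × ℝ) : ℝ :=
  ⨆ p : Subparabola f M, max (parabola M p.1 x) 0

variable {f : ℝ × ℝ → ℝ} {M : ℝ}

theorem nonempty_subparabola (hf : ∀ x, 0 ≤ f x) (hM : 0 ≤ M) : Nonempty (Subparabola f M) :=
  ⟨⟨(0, 0), zero_le_one, fun u => by
    have := hf u
    have h2 : 0 ≤ M * ((u.1 - 0) ^ 2 + (u.2 - 0) ^ 2) := by positivity
    simp only [parabola, Prod.fst_zero, Prod.snd_zero]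
    linarith⟩⟩

theorem bddAbove_softPart (hf : ∀ x, 0 ≤ f x) (x : ℝ × ℝ) :
    BddAbove (range fun p : Subparabola f M => max (parabola M p.1 x) 0) :=
  ⟨f x, by rintro _ ⟨p, rfl⟩; exact max_le (p.2.2 x) (hf x)⟩

theorem parabola_le_softPart (hf : ∀ x, 0 ≤ f x) (p : Subparabola f M) (x : ℝ × ℝ) :
    parabola M p.1 x ≤ softPart f M x :=
  (le_max_left _ _).trans (le_ciSup (bddAbove_softPart hf x) p)

theorem softPart_nonneg (x : ℝ × ℝ) : 0 ≤ softPart f M x :=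
  Real.iSup_nonneg fun _ => le_max_right _ _

theorem softPart_le (hf : ∀ x, 0 ≤ f x) (x : ℝ × ℝ) : softPart f M x ≤ f x :=
  Real.iSup_le (fun p => max_le (p.2.2 x) (hf x)) (hf x)

theorem softPart_neg (heven : ∀ x, f (-x) = f x) (x : ℝ × ℝ) :
    softPart f M (-x) = softPart f M x := by
  have hp : ∀ (p : (ℝ × ℝ) × ℝ) u, parabola M (-p.1, p.2) u = parabola M p (-u) := by
    intro p u
    simp only [parabola, Prod.fst_neg, Prod.snd_neg]
    ring
  let e : Subparabola f M → Subparabola f M := fun p =>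
    ⟨(-p.1.1, p.1.2), p.2.1, fun u => by rw [hp, ← heven]; exact p.2.2 _⟩
  have he : Function.Involutive e := fun p => by
    apply Subtype.ext
    simp [e]
  refine (Equiv.iSup_congr (he.toPerm e) fun p => ?_)
  change max (parabola M (-p.1.1, p.1.2) x) 0 = _
  rw [hp]

theorem measurable_softPart (hf : ∀ x, 0 ≤ f x) : Measurable (softPart f M) := by
  refine LowerSemicontinuous.measurable ?_
  refine lowerSemicontinuous_ciSup (bddAbove_softPart hf) fun p => ?_
  refine Continuous.lowerSemicontinuous ?_
  unfold parabola
  fun_prop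

/-- It suffices to treat one parabola with a positive value `A ≤ 1` at `x`. Its values at `x + s`
and `x - s` are `A - u - w` and `A - u + w`, and `w² ≤ 4u` because apex height at most one forces `M
* D ≤ 1`. If both values are nonnegative, their product is at least `A² - 2u - 4u`. Otherwise `A < u
+ |w|`, and then `A² ≤ 2u² + 2w² ≤ 10u` when `u < 1`, while `A² ≤ 1 ≤ u` when `u ≥ 1`. -/
theorem softPart_sq_sub_le (hf : ∀ x, 0 ≤ f x) (hM : 0 ≤ M) (x s : ℝ × ℝ) :
    softPart f M x ^ 2 - softPart f M (x + s) * softPart f M (x - s) ≤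
      10 * (M * (s.1 ^ 2 + s.2 ^ 2)) := by
  set u := M * (s.1 ^ 2 + s.2 ^ 2) with hu
  have hu0 : 0 ≤ u := by positivity
  set Q := softPart f M (x + s) * softPart f M (x - s) with hQ
  have hQ0 : 0 ≤ Q := mul_nonneg (softPart_nonneg _) (softPart_nonneg _)
  suffices h : softPart f M x ≤ √(Q + 10 * u) by
    have := Real.sq_sqrt (show 0 ≤ Q + 10 * u by positivity)
    have := pow_le_pow_left₀ (softPart_nonneg x) h 2
    linarith
  have := nonempty_subparabola hf hM
  refine ciSup_le fun p => ?_
  rcases le_or_gt (parabola M p.1 x) 0 with hA0 | hA0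
  · exact max_le (hA0.trans (Real.sqrt_nonneg _)) (Real.sqrt_nonneg _)
  refine max_le ?_ (Real.sqrt_nonneg _)
  set A := parabola M p.1 x with hA
  refine Real.le_sqrt_of_sq_le ?_
  set w := 2 * M * ((x.1 - p.1.1.1) * s.1 + (x.2 - p.1.1.2) * s.2) with hw
  set D := (x.1 - p.1.1.1) ^ 2 + (x.2 - p.1.1.2) ^ 2 with hD
  have hAD : A = p.1.2 - M * D := rfl
  have hD0 : 0 ≤ M * D := by positivity
  have hA1 : A ≤ 1 := by linarith [p.2.1]
  have hMD : M * D ≤ 1 := by linarith [p.2.1]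
  have hw2 : w ^ 2 ≤ 4 * u := by
    have hcs : ((x.1 - p.1.1.1) * s.1 + (x.2 - p.1.1.2) * s.2) ^ 2 ≤
        D * (s.1 ^ 2 + s.2 ^ 2) := by
      rw [hD]
      nlinarith [sq_nonneg ((x.1 - p.1.1.1) * s.2 - (x.2 - p.1.1.2) * s.1)]
    calc w ^ 2 = 4 * M ^ 2 * ((x.1 - p.1.1.1) * s.1 + (x.2 - p.1.1.2) * s.2) ^ 2 := by
          rw [hw]; ring
      _ ≤ 4 * M ^ 2 * (D * (s.1 ^ 2 + s.2 ^ 2)) := by gcongr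
      _ = 4 * (M * D) * u := by rw [hu]; ring
      _ ≤ 4 * 1 * u := by gcongr
      _ = 4 * u := by ring
  have hplus : A - u - w ≤ softPart f M (x + s) := by
    refine le_trans (le_of_eq ?_) (parabola_le_softPart hf p (x + s))
    simp only [hA, hu, hw, parabola, Prod.fst_add, Prod.snd_add]
    ring
  have hminus : A - u + w ≤ softPart f M (x - s) := by
    refine le_trans (le_of_eq ?_) (parabola_le_softPart hf p (x - s))
    simp only [hA, hu, hw, parabola, Prod.fst_sub, Prod.snd_sub]
    ring
  rcases le_or_gt |w| (A - u) with hcase | hcase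
  · have h1 : 0 ≤ A - u - w := by linarith [le_abs_self w]
    have h2 : 0 ≤ A - u + w := by linarith [neg_abs_le w]
    have h3 : (A - u - w) * (A - u + w) ≤ Q := mul_le_mul hplus hminus h2 (softPart_nonneg _)
    nlinarith
  · rcases le_or_gt 1 u with hu1 | hu1
    · nlinarith
    · have h4 : A ≤ u + |w| := by linarith
      have h5 : A ^ 2 ≤ (u + |w|) ^ 2 := pow_le_pow_left₀ hA0.le h4 2
      have h6 : (u + |w|) ^ 2 ≤ 2 * u ^ 2 + 2 * w ^ 2 := by
        rw [← sq_abs w]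
        nlinarith [sq_nonneg (u - |w|)]
      nlinarith

/-- The parabola of height one over `x` is at most one on the unit ball around `x` and, as `M ≥ 1`,
at most zero outside it. Thus the soft part is exactly one beyond the range, and distant pairs never
contribute a loss. -/
theorem softPart_eq_one (hf : ∀ x, 0 ≤ f x) (hf1 : ∀ x, f x ≤ 1) (hM : 1 ≤ M) {x : ℝ × ℝ}
    (hx : ∀ u, ‖u - x‖ ≤ 1 → f u = 1) : softPart f M x = 1 := by
  refine le_antisymm ((softPart_le hf x).trans (hf1 x)) ?_
  have hp : ∀ u, parabola M (x, 1) u ≤ f u := by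
    intro u
    rcases le_or_gt ‖u - x‖ 1 with h | h
    · rw [hx u h]
      have : 0 ≤ M * ((u.1 - x.1) ^ 2 + (u.2 - x.2) ^ 2) := by positivity
      simp only [parabola]
      linarith
    · refine le_trans ?_ (hf u)
      have h1 : 1 ≤ (u.1 - x.1) ^ 2 + (u.2 - x.2) ^ 2 := by
        rcases lt_max_iff.1 (show 1 < max ‖u.1 - x.1‖ ‖u.2 - x.2‖ from h) with h | h
        · rw [Real.norm_eq_abs] at h
          have := sq_abs (u.1 - x.1)
          nlinarith [sq_nonneg (u.2 - x.2)]
        · rw [Real.norm_eq_abs] at h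
          have := sq_abs (u.2 - x.2)
          nlinarith [sq_nonneg (u.1 - x.1)]
      simp only [parabola]
      nlinarith
  have := parabola_le_softPart hf (M := M) ⟨(x, 1), le_rfl, hp⟩ x
  simpa [parabola] using this

/-- For `c` slightly below `f x`, continuity keeps `f` above `c` on a ball of radius `δ`. A parabola
of height `c` over `x` that is steep enough to be nonpositive outside this ball lies below `f`. -/
theorem tendsto_softPart (hf : ∀ x, 0 ≤ f x) (hf1 : ∀ x, f x ≤ 1) {x : ℝ × ℝ}
    (hx : ContinuousAt f x) :
    Tendsto (fun n : ℕ => softPart f n x) atTop (𝓝 (f x)) := by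
  refine tendsto_order.2 ⟨fun a ha => ?_, fun a ha =>
    Eventually.of_forall fun n => (softPart_le hf x).trans_lt ha⟩
  obtain ⟨c, hac, hcf⟩ := exists_between ha
  obtain ⟨δ, hδ, hball⟩ := Metric.eventually_nhds_iff.1 (hx.eventually (lt_mem_nhds hcf))
  filter_upwards [eventually_ge_atTop ⌈(δ ^ 2)⁻¹⌉₊] with n hn
  have hnδ : 1 ≤ (n : ℝ) * δ ^ 2 := by
    have h1 : (δ ^ 2)⁻¹ ≤ n := (Nat.le_ceil _).trans (by exact_mod_cast hn)
    have h2 : 0 < δ ^ 2 := by positivity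
    rwa [inv_le_iff_one_le_mul₀ h2] at h1
  have hp : ∀ u, parabola n (x, c) u ≤ f u := by
    intro u
    rcases lt_or_ge (dist u x) δ with h | h
    · refine le_trans ?_ (hball h).le
      have : 0 ≤ (n : ℝ) * ((u.1 - x.1) ^ 2 + (u.2 - x.2) ^ 2) := by positivity
      simp only [parabola]
      linarith
    · refine le_trans ?_ (hf u)
      have h1 : δ ^ 2 ≤ (u.1 - x.1) ^ 2 + (u.2 - x.2) ^ 2 := by
        rcases le_max_iff.1 (show δ ≤ max (dist u.1 x.1) (dist u.2 x.2) from h) with h | h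
        · rw [Real.dist_eq] at h
          have := sq_abs (u.1 - x.1)
          nlinarith [sq_nonneg (u.2 - x.2)]
        · rw [Real.dist_eq] at h
          have := sq_abs (u.2 - x.2)
          nlinarith [sq_nonneg (u.1 - x.1)]
      have h2 : (n : ℝ) * δ ^ 2 ≤ n * ((u.1 - x.1) ^ 2 + (u.2 - x.2) ^ 2) := by gcongr
      simp only [parabola]
      linarith [hf1 x]
  have := parabola_le_softPart hf (M := n) ⟨(x, c), hcf.le.trans (hf1 x), hp⟩ x
  refine hac.trans_le ?_
  simpa [parabola] using this

/-- Dominated convergence: the integrand is at most one and vanishes beyond radius `r + 1`, where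
both functions equal one. -/
theorem tendsto_lintegral_softPart (hf : ∀ x, 0 ≤ f x) (hf1 : ∀ x, f x ≤ 1)
    (hfm : Measurable f) (hfc : ∀ᵐ x, ContinuousAt f x) {r : ℝ}
    (hfr : ∀ x, r ≤ ‖x‖ → f x = 1) :
    Tendsto (fun n : ℕ => ∫⁻ x, ENNReal.ofReal (f x ^ 2 - softPart f n x ^ 2)) atTop (𝓝 0) := by
  have h0 : (0 : ℝ≥0∞) = ∫⁻ _ : ℝ × ℝ, 0 := by simp
  rw [h0]
  refine tendsto_lintegral_filter_of_dominated_convergence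
    (fun x => (Metric.closedBall (0 : ℝ × ℝ) (r + 1)).indicator 1 x) ?_ ?_ ?_ ?_
  · refine Eventually.of_forall fun n => ?_
    have := measurable_softPart (f := f) (M := n) hf
    fun_prop
  · filter_upwards [eventually_ge_atTop 1] with n hn
    refine Eventually.of_forall fun x => ?_
    by_cases hx : x ∈ Metric.closedBall (0 : ℝ × ℝ) (r + 1)
    · rw [indicator_of_mem hx]
      refine ENNReal.ofReal_le_one.2 ?_
      have := pow_le_one₀ (n := 2) (hf x) (hf1 x)
      linarith [sq_nonneg (softPart f n x)]
    · rw [mem_closedBall_zero_iff, not_le] at hx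
      have hn1 : (1 : ℝ) ≤ n := by exact_mod_cast hn
      rw [softPart_eq_one hf hf1 hn1, hfr x (by linarith)]
      · simp
      · intro u hu
        refine hfr u ?_
        have := norm_sub_norm_le x u
        rw [norm_sub_rev] at this
        linarith
  · rw [lintegral_indicator_one measurableSet_closedBall]
    exact measure_closedBall_lt_top.ne
  · filter_upwards [hfc] with x hx
    have h1 := (tendsto_softPart hf hf1 hx)
    have h2 : Tendsto (fun n : ℕ => ENNReal.ofReal (f x ^ 2 - softPart f n x ^ 2)) atTop
        (𝓝 (ENNReal.ofReal (f x ^ 2 - f x ^ 2))) :=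
      ENNReal.tendsto_ofReal ((tendsto_const_nhds).sub (h1.pow 2))
    simpa using h2

end SoftPart

/-! ### Boltzmann factors -/

section Boltzmann

/-- The Boltzmann factor `e^{-t}` of an energy `t ∈ [0,∞]`. -/
def boltz (t : ℝ≥0∞) : ℝ≥0∞ := EReal.exp (-(t : EReal))

theorem continuous_boltz : Continuous boltz :=
  ENNReal.continuous_exp.comp (continuous_neg.comp continuous_coe_ennreal_ereal)

theorem measurable_boltz : Measurable boltz := continuous_boltz.measurable

@[simp] theorem boltz_zero : boltz 0 = 1 := by simp [boltz]

@[simp] theorem boltz_top : boltz ⊤ = 0 := by simp [boltz]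

theorem boltz_add (s t : ℝ≥0∞) : boltz (s + t) = boltz s * boltz t := by
  induction s with
  | top => simp
  | coe s =>
    induction t with
    | top => simp
    | coe t =>
      have hc : ∀ u : ℝ≥0, boltz u = ENNReal.ofReal (Real.exp (-(u : ℝ))) := by
        intro u
        have : ((u : ℝ≥0∞) : EReal) = ((u : ℝ) : EReal) := rfl
        rw [boltz, this, ← EReal.coe_neg, EReal.exp_coe]
      rw [← ENNReal.coe_add, hc, hc, hc, ← ENNReal.ofReal_mul (Real.exp_nonneg _), ← Real.exp_add]
      congr 2
      push_cast
      ring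

theorem boltz_le_one (t : ℝ≥0∞) : boltz t ≤ 1 := by
  rw [boltz, ← EReal.exp_zero]
  refine EReal.exp_monotone ?_
  rw [EReal.neg_le, neg_zero]
  exact EReal.coe_ennreal_nonneg t

theorem boltz_sum {ι : Type*} (s : Finset ι) (f : ι → ℝ≥0∞) :
    boltz (∑ i ∈ s, f i) = ∏ i ∈ s, boltz (f i) := by
  classical
  induction s using Finset.induction_on with
  | empty => simp
  | insert a s ha ih => rw [Finset.sum_insert ha, Finset.prod_insert ha, boltz_add, ih]

end Boltzmann

/-! ### Regularity of radial Boltzmann factors -/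

section Potts

variable {S : Type*}

theorem continuous_seminorm (h : Seminorm ℝ (ℝ × ℝ)) : Continuous h := by
  have := h.convexOn.continuousOn isOpen_univ
  exact continuousOn_univ.1 this

theorem exists_mul_norm_le_seminorm (h : Seminorm ℝ (ℝ × ℝ)) (hnorm : ∀ x, h x = 0 → x = 0) :
    ∃ c > 0, ∀ x, c * ‖x‖ ≤ h x := by
  obtain ⟨x₀, hx₀, hmin⟩ := (isCompact_sphere (0 : ℝ × ℝ) 1).exists_isMinOn
    (NormedSpace.sphere_nonempty.2 zero_le_one) (continuous_seminorm h).continuousOn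
  have h0 : 0 < h x₀ := by
    refine lt_of_le_of_ne (apply_nonneg h _) fun h0 => ?_
    rw [hnorm x₀ h0.symm] at hx₀
    simp at hx₀
  refine ⟨h x₀, h0, fun x => ?_⟩
  rcases eq_or_ne x 0 with rfl | hx
  · simp
  have hn : ‖x‖ ≠ 0 := norm_ne_zero_iff.2 hx
  have h1 : h x₀ ≤ h (‖x‖⁻¹ • x) := hmin (by simp [norm_smul, hn])
  rw [map_smul_eq_mul, norm_inv, norm_norm] at h1
  rwa [inv_mul_eq_div, le_div_iff₀ (by positivity)] at h1

/-- The norm `h` as a map to the nonnegative reals. -/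
def nnSeminorm (h : Seminorm ℝ (ℝ × ℝ)) (x : ℝ × ℝ) : ℝ≥0 := ⟨h x, apply_nonneg h x⟩

theorem continuous_nnSeminorm (h : Seminorm ℝ (ℝ × ℝ)) : Continuous (nnSeminorm h) :=
  (continuous_seminorm h).subtype_mk _

theorem WellBehaved.exists_finite_continuousAt {φ : ℝ≥0 → ℝ≥0∞} (hφ : WellBehaved φ) :
    ∃ s : Set ℝ≥0, s.Finite ∧ ∀ t ∉ s, ContinuousAt φ t := by
  obtain ⟨n, r, hr, h0, hn, hc, -⟩ := hφ
  refine ⟨range r, finite_range r, fun t ht => ?_⟩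
  have hne : ∀ i, r i ≠ t := fun i hi => ht ⟨i, hi⟩
  rcases lt_or_ge t (r 0) with h1 | h1
  · exact (continuousAt_const (y := (⊤ : ℝ≥0∞))).congr
      (Filter.EventuallyEq.symm ((eventually_lt_nhds h1).mono fun u hu => h0 u hu))
  rcases lt_or_ge (r (Fin.last n)) t with h2 | h2
  · exact (continuousAt_const (y := (0 : ℝ≥0∞))).congr
      (Filter.EventuallyEq.symm ((eventually_gt_nhds h2).mono fun u hu => hn u hu))
  have : ∃ i : Fin n, r i.castSucc < t ∧ t < r i.succ := by
    by_contra! hcon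
    have : ∀ i : Fin (n + 1), r i < t := by
      intro i
      induction i using Fin.induction with
      | zero => exact lt_of_le_of_ne h1 (hne 0)
      | succ i ih => exact lt_of_le_of_ne (hcon i ih) (hne _)
    exact absurd (this (Fin.last n)) (not_lt.2 h2)
  obtain ⟨i, hi1, hi2⟩ := this
  exact (hc i).continuousAt (Ioo_mem_nhds hi1 hi2)

theorem WellBehaved.exists_eq_zero {φ : ℝ≥0 → ℝ≥0∞} (hφ : WellBehaved φ) :
    ∃ ρ : ℝ≥0, ∀ t, ρ < t → φ t = 0 := by
  obtain ⟨n, r, -, -, hn, -⟩ := hφ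
  exact ⟨r (Fin.last n), hn⟩

/-- A sphere of positive radius lies in the frontier of a convex ball, and frontiers of convex sets
are null. So the finitely many discontinuities of `φ` give a null set of discontinuities in the
plane. -/
theorem volume_seminorm_eq_zero (h : Seminorm ℝ (ℝ × ℝ)) (hnorm : ∀ x, h x = 0 → x = 0) (ρ : ℝ) :
    volume {x | h x = ρ} = 0 := by
  rcases le_or_gt ρ 0 with hρ | hρ
  · have : {x | h x = ρ} ⊆ {0} := by
      intro x hx
      refine hnorm x (le_antisymm (hx.trans_le hρ) (apply_nonneg h x))
    exact measure_mono_null this (by simp)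
  · have hconv : Convex ℝ (h.closedBall 0 ρ) := h.convex_closedBall 0 ρ
    refine measure_mono_null ?_ (hconv.addHaar_frontier volume)
    intro x hx
    have hx' : h x = ρ := hx
    refine ⟨subset_closure (by simp [Seminorm.mem_closedBall, hx']), fun hint => ?_⟩
    -- An interior point of the ball could be stretched slightly without leaving it, but stretching
    -- `x` makes its norm exceed `ρ`.
    have hcont : Tendsto (fun t : ℝ => t • x) (𝓝[>] 1) (𝓝 x) := by
      have : Continuous fun t : ℝ => t • x := by fun_prop
      have h2 := (this.tendsto 1).mono_left (nhdsWithin_le_nhds (s := Ioi 1))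
      simpa using h2
    have hev := hcont.eventually (isOpen_interior.mem_nhds hint)
    obtain ⟨t, ht1, ht2⟩ := (hev.and self_mem_nhdsWithin).exists
    have h3 := interior_subset ht1
    rw [Seminorm.mem_closedBall, sub_zero, map_smul_eq_mul, hx', Real.norm_eq_abs,
      abs_of_pos (by linarith [show (1 : ℝ) < t from ht2])] at h3
    nlinarith [show (1 : ℝ) < t from ht2]

/-- The square root of the Boltzmann factor of a radial potential. -/
def boltzRoot (h : Seminorm ℝ (ℝ × ℝ)) (φ : ℝ≥0 → ℝ≥0∞) (x : ℝ × ℝ) : ℝ :=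
  √(boltz (φ (nnSeminorm h x))).toReal

variable (h : Seminorm ℝ (ℝ × ℝ)) {φ : ℝ≥0 → ℝ≥0∞}

theorem boltzRoot_nonneg (x : ℝ × ℝ) : 0 ≤ boltzRoot h φ x := Real.sqrt_nonneg _

theorem boltzRoot_le_one (x : ℝ × ℝ) : boltzRoot h φ x ≤ 1 :=
  Real.sqrt_le_one.2 (ENNReal.toReal_le_of_le_ofReal zero_le_one (by simpa using boltz_le_one _))

theorem boltzRoot_neg (x : ℝ × ℝ) : boltzRoot h φ (-x) = boltzRoot h φ x := by
  simp [boltzRoot, nnSeminorm]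

theorem ofReal_boltzRoot_sq (x : ℝ × ℝ) :
    ENNReal.ofReal (boltzRoot h φ x ^ 2) = boltz (φ (nnSeminorm h x)) := by
  rw [boltzRoot, Real.sq_sqrt ENNReal.toReal_nonneg, ENNReal.ofReal_toReal]
  exact ((boltz_le_one _).trans_lt ENNReal.one_lt_top).ne

theorem measurable_boltzRoot (hφ : Measurable φ) : Measurable (boltzRoot h φ) := by
  have := (continuous_nnSeminorm h).measurable
  have := measurable_boltz
  unfold boltzRoot
  fun_prop

theorem ae_continuousAt_boltzRoot (hnorm : ∀ x, h x = 0 → x = 0) (hφ : WellBehaved φ) :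
    ∀ᵐ x, ContinuousAt (boltzRoot h φ) x := by
  obtain ⟨s, hs, hc⟩ := hφ.exists_finite_continuousAt
  have hae : ∀ t ∈ s, ∀ᵐ x : ℝ × ℝ, nnSeminorm h x ≠ t := by
    intro t _
    refine measure_mono_null ?_ (volume_seminorm_eq_zero h hnorm t)
    intro x hx
    simp only [mem_compl_iff, mem_ofPred_eq, not_not] at hx
    exact congrArg NNReal.toReal hx
  filter_upwards [(ae_ball_iff hs.countable).2 hae] with x hx
  have h1 : ContinuousAt (fun x => φ (nnSeminorm h x)) x :=
    ContinuousAt.comp (hc _ fun hm => hx _ hm rfl) (continuous_nnSeminorm h).continuousAt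
  have h2 : ContinuousAt (fun x => boltz (φ (nnSeminorm h x))) x :=
    continuous_boltz.continuousAt.comp h1
  have h3 := (ENNReal.tendsto_toReal
    ((boltz_le_one (φ (nnSeminorm h x))).trans_lt ENNReal.one_lt_top).ne).comp h2
  exact h3.sqrt

theorem exists_boltzRoot_eq_one [Finite S] (hnorm : ∀ x, h x = 0 → x = 0)
    {φ : S → S → ℝ≥0 → ℝ≥0∞} (hwell : ∀ σ₁ σ₂, WellBehaved (φ σ₁ σ₂)) :
    ∃ r : ℝ, 0 < r ∧ ∀ x, r ≤ ‖x‖ → ∀ σ₁ σ₂, φ σ₁ σ₂ (nnSeminorm h x) = 0 := by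
  obtain ⟨c, hc, hch⟩ := exists_mul_norm_le_seminorm h hnorm
  choose ρ hρ using fun σ : S × S => (hwell σ.1 σ.2).exists_eq_zero
  obtain ⟨K, hK⟩ := (finite_range ρ).bddAbove
  refine ⟨(K + 1) / c, by positivity, fun x hx σ₁ σ₂ => hρ (σ₁, σ₂) _ ?_⟩
  refine (hK ⟨(σ₁, σ₂), rfl⟩).trans_lt ?_
  rw [div_le_iff₀ hc] at hx
  have h1 := hch x
  rw [← NNReal.coe_lt_coe]
  change (K : ℝ) < h x
  linarith

end Potts

/-! ### Splitting the pair weight into a soft part and small bonds -/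

/-- A translation invariant pair weight `e` with values in `[0, 1]` that is the sum of a soft part
`q²` and of a remainder of integral at most `eps`. -/
structure Split (S : Type*) where
  e : S → S → ℝ × ℝ → ℝ≥0∞
  q : S → S → ℝ × ℝ → ℝ
  r : ℝ
  C : ℝ
  eps : ℝ≥0∞
  r_pos : 0 < r
  C_nonneg : 0 ≤ C
  e_le_one : ∀ σ σ' x, e σ σ' x ≤ 1
  q_nonneg : ∀ σ σ' x, 0 ≤ q σ σ' x
  q_le : ∀ σ σ' x, ENNReal.ofReal (q σ σ' x ^ 2) ≤ e σ σ' x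
  e_symm : ∀ σ σ' x, e σ σ' (-x) = e σ' σ x
  q_symm : ∀ σ σ' x, q σ σ' (-x) = q σ' σ x
  measurable_e : ∀ σ σ', Measurable (e σ σ')
  measurable_q : ∀ σ σ', Measurable (q σ σ')
  q_far : ∀ σ σ' x, r ≤ ‖x‖ → q σ σ' x = 1
  q_sq_sub_le : ∀ σ σ' x s, q σ σ' x ^ 2 - q σ σ' (x + s) * q σ σ' (x - s) ≤ C * ‖s‖ ^ 2
  lintegral_le : ∀ σ σ', ∫⁻ x, (e σ σ' x - ENNReal.ofReal (q σ σ' x ^ 2)) ≤ eps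

theorem exists_split {S : Type*} [Finite S] (h : Seminorm ℝ (ℝ × ℝ)) (hnorm : ∀ x, h x = 0 → x = 0)
    (φ : S → S → ℝ≥0 → ℝ≥0∞) (hmeas : ∀ σ₁ σ₂, Measurable (φ σ₁ σ₂))
    (hsymm : ∀ σ₁ σ₂, φ σ₁ σ₂ = φ σ₂ σ₁) (hwell : ∀ σ₁ σ₂, WellBehaved (φ σ₁ σ₂))
    {ε : ℝ≥0∞} (hε : ε ≠ 0) :
    ∃ D : Split S, D.eps = ε ∧ ∀ σ₁ σ₂ x, D.e σ₁ σ₂ x = boltz (φ σ₁ σ₂ (nnSeminorm h x)) := by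
  obtain ⟨r, hr, hfar⟩ := exists_boltzRoot_eq_one h hnorm hwell
  have hone : ∀ σ₁ σ₂ x, r ≤ ‖x‖ → boltzRoot h (φ σ₁ σ₂) x = 1 := by
    intro σ₁ σ₂ x hx
    simp [boltzRoot, hfar x hx σ₁ σ₂]
  have hev : ∀ σ : S × S, ∀ᶠ n : ℕ in atTop,
      ∫⁻ x, ENNReal.ofReal (boltzRoot h (φ σ.1 σ.2) x ^ 2 -
        softPart (boltzRoot h (φ σ.1 σ.2)) n x ^ 2) < ε := by
    intro σ
    exact (tendsto_lintegral_softPart (boltzRoot_nonneg h) (boltzRoot_le_one h)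
      (measurable_boltzRoot h (hmeas _ _)) (ae_continuousAt_boltzRoot h hnorm (hwell _ _))
      (hone σ.1 σ.2)).eventually (gt_mem_nhds (pos_iff_ne_zero.2 hε))
  obtain ⟨n, hn, hn1⟩ := ((eventually_all.2 hev).and (eventually_ge_atTop 1)).exists
  have hn1' : (1 : ℝ) ≤ n := by exact_mod_cast hn1
  refine ⟨{
    e := fun σ σ' x => boltz (φ σ σ' (nnSeminorm h x))
    q := fun σ σ' => softPart (boltzRoot h (φ σ σ')) n
    -- One more than the range, since `softPart_eq_one` needs the whole unit ball around the point
    -- to be out of range.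
    r := r + 1
    -- The factor 10 of `softPart_sq_sub_le`, doubled because the sum of squares is at most twice
    -- the squared sup norm.
    C := 20 * n
    eps := ε
    r_pos := by positivity
    C_nonneg := by positivity
    e_le_one := fun _ _ _ => boltz_le_one _
    q_nonneg := fun _ _ _ => softPart_nonneg _
    q_le := fun σ σ' x => ?_
    e_symm := fun σ σ' x => ?_
    q_symm := fun σ σ' x => ?_
    measurable_e := fun σ σ' => ?_
    measurable_q := fun σ σ' => measurable_softPart (boltzRoot_nonneg h)
    q_far := fun σ σ' x hx => ?_
    q_sq_sub_le := fun σ σ' x s => ?_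
    lintegral_le := fun σ σ' => ?_ }, rfl, fun _ _ _ => rfl⟩
  · rw [← ofReal_boltzRoot_sq]
    exact ENNReal.ofReal_le_ofReal
      (pow_le_pow_left₀ (softPart_nonneg _) (softPart_le (boltzRoot_nonneg h) x) 2)
  · rw [hsymm]
    simp [nnSeminorm]
  · rw [hsymm]
    exact softPart_neg (boltzRoot_neg h) x
  · exact measurable_boltz.comp ((hmeas σ σ').comp (continuous_nnSeminorm h).measurable)
  · refine softPart_eq_one (boltzRoot_nonneg h) (boltzRoot_le_one h) hn1' fun u hu => ?_
    refine hone σ σ' u ?_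
    have := norm_sub_norm_le x u
    rw [norm_sub_rev] at this
    linarith
  · refine (softPart_sq_sub_le (boltzRoot_nonneg h) (by positivity) x s).trans ?_
    have h1 : s.1 ^ 2 ≤ ‖s‖ ^ 2 := sq_le_sq' (by
      have := norm_fst_le s; have := neg_abs_le s.1; rw [Real.norm_eq_abs] at *; linarith)
      ((le_abs_self _).trans (norm_fst_le s))
    have h2 : s.2 ^ 2 ≤ ‖s‖ ^ 2 := sq_le_sq' (by
      have := norm_snd_le s; have := neg_abs_le s.2; rw [Real.norm_eq_abs] at *; linarith)
      ((le_abs_self _).trans (norm_snd_le s))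
    nlinarith
  · refine le_trans (le_of_eq ?_) (hn (σ, σ')).le
    refine lintegral_congr fun x => ?_
    rw [← ofReal_boltzRoot_sq, ← ENNReal.ofReal_sub _ (sq_nonneg _)]

namespace Split

variable {S : Type*} (D : Split S)

/-- The pair weight. -/
def full (y y' : Particle S) : ℝ≥0∞ := D.e y.2 y'.2 (y.1 - y'.1)

/-- The soft part of the pair weight. -/
def soft (y y' : Particle S) : ℝ≥0∞ := ENNReal.ofReal (D.q y.2 y'.2 (y.1 - y'.1) ^ 2)

/-- The remainder of the pair weight. -/
def bond (y y' : Particle S) : ℝ≥0∞ := D.full y y' - D.soft y y'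

theorem bond_add_soft (y y' : Particle S) : D.bond y y' + D.soft y y' = D.full y y' :=
  tsub_add_cancel_of_le (D.q_le _ _ _)

theorem full_le_one (y y' : Particle S) : D.full y y' ≤ 1 := D.e_le_one _ _ _

theorem full_symm (y y' : Particle S) : D.full y y' = D.full y' y := by
  rw [full, full, ← D.e_symm, neg_sub]

theorem soft_symm (y y' : Particle S) : D.soft y y' = D.soft y' y := by
  rw [soft, soft, ← D.q_symm, neg_sub]

theorem bond_symm (y y' : Particle S) : D.bond y y' = D.bond y' y := by
  rw [bond, bond, full_symm, soft_symm]

theorem bond_eq_zero {y y' : Particle S} (h : D.r ≤ ‖y.1 - y'.1‖) : D.bond y y' = 0 := by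
  rw [bond, soft, D.q_far _ _ _ h, one_pow, ENNReal.ofReal_one]
  exact tsub_eq_zero_of_le (D.full_le_one y y')

section Measurability

variable [MeasurableSpace S] [MeasurableSingletonClass S] [Finite S]

theorem measurable_pair {β : Type*} [MeasurableSpace β] {F : S → S → ℝ × ℝ → β}
    (hF : ∀ σ σ', Measurable (F σ σ')) :
    Measurable fun p : Particle S × Particle S => F p.1.2 p.2.2 (p.1.1 - p.2.1) := by
  have h1 : Measurable fun p : (S × S) × (ℝ × ℝ) => F p.1.1 p.1.2 p.2 :=
    measurable_from_prod_countable_right fun σ => hF σ.1 σ.2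
  exact h1.comp (f := fun p : Particle S × Particle S => ((p.1.2, p.2.2), p.1.1 - p.2.1))
    (by fun_prop)

theorem measurable_full : Measurable (Function.uncurry D.full) := measurable_pair D.measurable_e

theorem measurable_soft : Measurable (Function.uncurry D.soft) :=
  ENNReal.measurable_ofReal.comp ((measurable_pair D.measurable_q).pow_const 2)

theorem measurable_bond : Measurable (Function.uncurry D.bond) :=
  D.measurable_full.sub D.measurable_soft

end Measurability

end Split

/-! ### Integrals against the reference measure of particles -/

section Reference

variable {S : Type*} [Finite S] [Nonempty S] [MeasurableSpace S] [MeasurableSingletonClass S]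

instance : IsProbabilityMeasure (ProbabilityTheory.uniformOn (univ : Set S)) :=
  ProbabilityTheory.isProbabilityMeasure_uniformOn finite_univ univ_nonempty

instance : SigmaFinite (refMeasure S) := by
  unfold refMeasure
  infer_instance

theorem lintegral_refMeasure_le {F : Particle S → ℝ≥0∞} (hF : Measurable F) {c : ℝ≥0∞}
    (hc : ∀ σ, ∫⁻ x, F (x, σ) ≤ c) : ∫⁻ y, F y ∂(refMeasure S) ≤ c := by
  rw [refMeasure, lintegral_prod_symm _ hF.aemeasurable]
  calc _ ≤ ∫⁻ _ : S, c ∂(ProbabilityTheory.uniformOn (univ : Set S)) := lintegral_mono hc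
    _ = c := by simp

theorem lintegral_refMeasure_fst {F : ℝ × ℝ → ℝ≥0∞} (hF : Measurable F) :
    ∫⁻ y, F y.1 ∂(refMeasure S) = ∫⁻ x, F x := by
  rw [refMeasure]
  refine (lintegral_prod_symm _ (hF.comp measurable_fst).aemeasurable).trans ?_
  simp

theorem Split.lintegral_bond_le (D : Split S) (y : Particle S) :
    ∫⁻ y', D.bond y y' ∂(refMeasure S) ≤ D.eps := by
  have hm : Measurable (D.bond y) := D.measurable_bond.comp measurable_prodMk_left
  refine lintegral_refMeasure_le hm fun σ => ?_
  refine le_trans (le_of_eq ?_) (D.lintegral_le y.2 σ)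
  exact lintegral_sub_left_eq_self (μ := (volume : Measure (ℝ × ℝ)))
    (fun x => D.e y.2 σ x - ENNReal.ofReal (D.q y.2 σ x ^ 2)) y.1

/-- The indicator of the pairs of particles at distance at most `ρ`. -/
def near (ρ : ℝ) (y y' : Particle S) : ℝ≥0∞ := {x : ℝ × ℝ | ‖x‖ ≤ ρ}.indicator 1 (y.1 - y'.1)

theorem measurable_near (ρ : ℝ) : Measurable (Function.uncurry (near (S := S) ρ)) := by
  have h1 : MeasurableSet {x : ℝ × ℝ | ‖x‖ ≤ ρ} := measurableSet_le measurable_norm measurable_const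
  exact (measurable_one.indicator h1).comp
    (f := fun p : Particle S × Particle S => p.1.1 - p.2.1) (by fun_prop)

theorem lintegral_near_le (ρ : ℝ) (y : Particle S) :
    ∫⁻ y', near ρ y y' ∂(refMeasure S) ≤ volume (Metric.closedBall (0 : ℝ × ℝ) ρ) := by
  have h1 : MeasurableSet {x : ℝ × ℝ | ‖x‖ ≤ ρ} := measurableSet_le measurable_norm measurable_const
  refine lintegral_refMeasure_le ((measurable_near ρ).comp measurable_prodMk_left) fun σ => ?_
  refine le_of_eq ((lintegral_sub_left_eq_self (μ := (volume : Measure (ℝ × ℝ)))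
    ({x : ℝ × ℝ | ‖x‖ ≤ ρ}.indicator 1) y.1).trans ?_)
  rw [lintegral_indicator_one h1]
  congr 1
  ext x
  simp

end Reference

/-! ### Cutoffs and the shifts of the plane that they generate -/

/-- A differentiable function on the plane that equals `1` near the origin, vanishes far away, and
whose derivative decays like `rho / (1 + ‖x‖)`. -/
structure Cutoff where
  τ : ℝ × ℝ → ℝ
  rho : ℝ
  R : ℝ
  N : ℝ
  rho_nonneg : 0 ≤ rho
  nonneg : ∀ x, 0 ≤ τ x
  le_one : ∀ x, τ x ≤ 1
  contDiff : ContDiff ℝ 1 τ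
  norm_fderiv_le : ∀ x, ‖fderiv ℝ τ x‖ ≤ rho / (1 + ‖x‖)
  eq_one : ∀ x, ‖x‖ ≤ R → τ x = 1
  eq_zero : ∀ x, N ≤ ‖x‖ → τ x = 0

namespace Cutoff

variable (T : Cutoff)

theorem continuous : Continuous T.τ := T.contDiff.continuous

theorem differentiable : Differentiable ℝ T.τ := T.contDiff.differentiable one_ne_zero

theorem continuous_fderiv_apply (w : ℝ × ℝ) : Continuous fun x => fderiv ℝ T.τ x w :=
  (T.contDiff.continuous_fderiv one_ne_zero).clm_apply continuous_const

theorem norm_fderiv_le_rho (x : ℝ × ℝ) : ‖fderiv ℝ T.τ x‖ ≤ T.rho :=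
  (T.norm_fderiv_le x).trans (div_le_self T.rho_nonneg (by linarith [norm_nonneg x]))

theorem abs_fderiv_apply_le (x w : ℝ × ℝ) : |fderiv ℝ T.τ x w| ≤ T.rho / (1 + ‖x‖) * ‖w‖ :=
  ((fderiv ℝ T.τ x).le_opNorm w).trans
    (mul_le_mul_of_nonneg_right (T.norm_fderiv_le x) (norm_nonneg w))

theorem one_add_norm_le (x y : ℝ × ℝ) : (1 + ‖x‖) ≤ (1 + ‖x - y‖) * (1 + ‖y‖) := by
  have := norm_add_le (x - y) y
  rw [sub_add_cancel] at this
  nlinarith [norm_nonneg (x - y), norm_nonneg y]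

theorem div_le_div_mul {ρ : ℝ} (hρ : 0 ≤ ρ) (x y : ℝ × ℝ) :
    ρ / (1 + ‖y‖) ≤ ρ / (1 + ‖x‖) * (1 + ‖x - y‖) := by
  have hx : 0 < 1 + ‖x‖ := by positivity
  have hy : 0 < 1 + ‖y‖ := by positivity
  rw [div_mul_eq_mul_div, div_le_div_iff₀ hy hx]
  have := mul_le_mul_of_nonneg_left (one_add_norm_le x y) hρ
  linarith

/-- Mean value inequality on the ball around `x` of radius `‖x - y‖`, in which the decay of the
derivative differs from that at `x` by at most the factor `1 + ‖x - y‖`. Keeping the decay at a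
single point lets the losses be integrated over the position of one particle. -/
theorem abs_sub_le (x y : ℝ × ℝ) :
    |T.τ x - T.τ y| ≤ T.rho / (1 + ‖x‖) * ((1 + ‖x - y‖) * ‖x - y‖) := by
  have h1 : ∀ u ∈ Metric.closedBall x ‖x - y‖,
      ‖fderiv ℝ T.τ u‖ ≤ T.rho / (1 + ‖x‖) * (1 + ‖x - y‖) := by
    intro u hu
    refine (T.norm_fderiv_le u).trans ((div_le_div_mul T.rho_nonneg x u).trans ?_)
    rw [mem_closedBall_iff_norm'] at hu
    have := T.rho_nonneg
    gcongr
  have h2 := (convex_closedBall x ‖x - y‖).norm_image_sub_le_of_norm_fderiv_le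
    (fun u _ => T.differentiable u) h1 (x := y) (y := x)
    (by rw [mem_closedBall_iff_norm'])
    (Metric.mem_closedBall_self (norm_nonneg _))
  rw [Real.norm_eq_abs] at h2
  linarith

/-- The shift of the plane by the vector `w`, tuned by the cutoff. -/
def shift (w x : ℝ × ℝ) : ℝ × ℝ := x + T.τ x • w

/-- The Jacobian of the shift. -/
def jac (w x : ℝ × ℝ) : ℝ := 1 + fderiv ℝ T.τ x w

theorem continuous_jac (w : ℝ × ℝ) : Continuous (T.jac w) :=
  continuous_const.add (T.continuous_fderiv_apply w)

theorem jac_pos {w : ℝ × ℝ} (hw : T.rho * ‖w‖ < 1) (x : ℝ × ℝ) : 0 < T.jac w x := by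
  have h1 := ((fderiv ℝ T.τ x).le_opNorm w).trans
    (mul_le_mul_of_nonneg_right (T.norm_fderiv_le_rho x) (norm_nonneg w))
  rw [Real.norm_eq_abs] at h1
  have := neg_abs_le (fderiv ℝ T.τ x w)
  unfold jac
  linarith

theorem measurable_shift (w : ℝ × ℝ) : Measurable (T.shift w) := by
  have := T.continuous
  exact Continuous.measurable (by unfold shift; fun_prop)

theorem abs_sub_le_rho (x y : ℝ × ℝ) : |T.τ x - T.τ y| ≤ T.rho * ‖x - y‖ := by
  have h2 := convex_univ.norm_image_sub_le_of_norm_fderiv_le (s := (univ : Set (ℝ × ℝ)))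
    (fun u _ => T.differentiable u) (fun u _ => T.norm_fderiv_le_rho u) (mem_univ y) (mem_univ x)
  rwa [Real.norm_eq_abs] at h2

theorem injective_shift {w : ℝ × ℝ} (hw : T.rho * ‖w‖ < 1) : Function.Injective (T.shift w) := by
  intro x y hxy
  by_contra hne
  have h1 : x - y = (T.τ y - T.τ x) • w := by
    simp only [shift] at hxy
    rw [sub_smul]
    linear_combination (exp := 1) hxy
  have h2 : ‖x - y‖ = |T.τ x - T.τ y| * ‖w‖ := by
    conv_lhs => rw [h1]
    rw [norm_smul, Real.norm_eq_abs, abs_sub_comm]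
  have h3 := mul_le_mul_of_nonneg_right (T.abs_sub_le_rho x y) (norm_nonneg w)
  have h4 : 0 < ‖x - y‖ := norm_pos_iff.2 (sub_ne_zero.2 hne)
  nlinarith

/-- A preimage of `y` is a fixed point of `x ↦ y - τ(x) w`, which is a contraction. -/
theorem surjective_shift {w : ℝ × ℝ} (hw : T.rho * ‖w‖ < 1) :
    Function.Surjective (T.shift w) := by
  intro y
  have hc : ContractingWith (T.rho * ‖w‖).toNNReal fun x => y - T.τ x • w := by
    refine ⟨by simpa using hw, LipschitzWith.of_dist_le_mul fun a b => ?_⟩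
    rw [dist_eq_norm, dist_eq_norm, sub_sub_sub_cancel_left, ← sub_smul, norm_smul,
      Real.norm_eq_abs, abs_sub_comm]
    have := mul_le_mul_of_nonneg_right (T.abs_sub_le_rho a b) (norm_nonneg w)
    calc _ ≤ T.rho * ‖a - b‖ * ‖w‖ := this
      _ = _ := by
        rw [Real.coe_toNNReal _ (mul_nonneg T.rho_nonneg (norm_nonneg w))]; ring
  refine ⟨ContractingWith.fixedPoint _ hc, ?_⟩
  have := hc.fixedPoint_isFixedPt
  unfold shift
  nth_rw 1 [← this.eq]
  simp

theorem hasFDerivAt_shift (w x : ℝ × ℝ) : HasFDerivAt (T.shift w)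
    (ContinuousLinearMap.id ℝ (ℝ × ℝ) + (fderiv ℝ T.τ x).smulRight w) x :=
  (hasFDerivAt_id x).add ((T.differentiable x).hasFDerivAt.smul_const w)

/-- Change of variables: the derivative of the shift is a rank one perturbation of the identity,
with determinant `1 + Dτ(w)`. -/
theorem measurePreserving_shift {w : ℝ × ℝ} (hw : T.rho * ‖w‖ < 1) :
    MeasurePreserving (T.shift w)
      (volume.withDensity fun x => ENNReal.ofReal (T.jac w x)) volume := by
  refine ⟨T.measurable_shift w, ?_⟩
  have hdet : ∀ x, (ContinuousLinearMap.id ℝ (ℝ × ℝ) + (fderiv ℝ T.τ x).smulRight w).det =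
      T.jac w x := by
    intro x
    exact LinearMap.transvection.det (fderiv ℝ T.τ x : (ℝ × ℝ) →ₗ[ℝ] ℝ) w
  have h := map_withDensity_abs_det_fderiv_eq_addHaar (volume : Measure (ℝ × ℝ))
    (s := univ) MeasurableSet.univ.nullMeasurableSet
    (fun x _ => (T.hasFDerivAt_shift w x).hasFDerivWithinAt) (T.injective_shift hw).injOn
  rw [image_univ, (T.surjective_shift hw).range_eq, Measure.restrict_univ] at h
  simp_rw [hdet, abs_of_pos (T.jac_pos hw _)] at h
  exact h

end Cutoff

theorem exists_abs_deriv_smoothTransition_le :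
    ∃ K : ℝ, 0 ≤ K ∧ ∀ x, |deriv Real.smoothTransition x| ≤ K := by
  have hc : Continuous (deriv Real.smoothTransition) :=
    (Real.smoothTransition.contDiff (n := 1)).continuous_deriv le_rfl
  obtain ⟨K, hK⟩ := (isCompact_Icc (a := (0 : ℝ)) (b := 1)).exists_bound_of_continuousOn
    hc.continuousOn
  refine ⟨K, (norm_nonneg _).trans (hK 0 ⟨le_rfl, zero_le_one⟩), fun x => ?_⟩
  by_cases hx : x ∈ Icc (0 : ℝ) 1
  · exact hK x hx
  · have h0 : deriv Real.smoothTransition x = 0 := by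
      rcases lt_or_ge x 0 with h | h
      · have : Real.smoothTransition =ᶠ[𝓝 x] fun _ => 0 :=
          (eventually_lt_nhds h).mono fun u hu => Real.smoothTransition.zero_of_nonpos hu.le
        rw [this.deriv_eq, deriv_const]
      · have h1 : 1 < x := by
          by_contra h1
          exact hx ⟨h, not_lt.1 h1⟩
        have : Real.smoothTransition =ᶠ[𝓝 x] fun _ => 1 :=
          (eventually_gt_nhds h1).mono fun u hu => Real.smoothTransition.one_of_one_le hu.le
        rw [this.deriv_eq, deriv_const]
    rw [h0, abs_zero]
    exact (norm_nonneg _).trans (hK 0 ⟨le_rfl, zero_le_one⟩)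

theorem sq_norm_le (x : ℝ × ℝ) : ‖x‖ ^ 2 ≤ x.1 ^ 2 + x.2 ^ 2 := by
  rcases max_cases ‖x.1‖ ‖x.2‖ with h | h <;> rw [Prod.norm_def, h.1, Real.norm_eq_abs, sq_abs]
  · linarith [sq_nonneg x.2]
  · linarith [sq_nonneg x.1]

theorem sq_add_sq_le (x : ℝ × ℝ) : x.1 ^ 2 + x.2 ^ 2 ≤ 2 * ‖x‖ ^ 2 := by
  have h1 : |x.1| ≤ ‖x‖ := norm_fst_le x
  have h2 : |x.2| ≤ ‖x‖ := norm_snd_le x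
  have h3 := pow_le_pow_left₀ (abs_nonneg _) h1 2
  have h4 := pow_le_pow_left₀ (abs_nonneg _) h2 2
  rw [sq_abs] at h3 h4
  linarith

/-- The logarithmic profile `1 - θ(log (1 + |x|²) / L - 1)` for the smooth transition `θ`. -/
def logProfile (L : ℝ) (x : ℝ × ℝ) : ℝ :=
  1 - Real.smoothTransition (Real.log (1 + (x.1 ^ 2 + x.2 ^ 2)) / L - 1)

theorem contDiff_logProfile (L : ℝ) : ContDiff ℝ 1 (logProfile L) := by
  have h1 : ∀ x : ℝ × ℝ, 1 + (x.1 ^ 2 + x.2 ^ 2) ≠ 0 := fun x => by positivity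
  unfold logProfile
  refine contDiff_const.sub ((Real.smoothTransition.contDiff (n := 1)).comp ?_)
  refine ContDiff.sub (ContDiff.div_const (ContDiff.log ?_ h1) _) contDiff_const
  fun_prop

/-- The gradient of `log (1 + |x|²)` decays like `1 / ‖x‖`, and the division by `L` makes it small.
-/
theorem norm_fderiv_logProfile_le {L K : ℝ} (hL : 0 < L)
    (hK : ∀ x, |deriv Real.smoothTransition x| ≤ K) (x : ℝ × ℝ) :
    ‖fderiv ℝ (logProfile L) x‖ ≤ (8 * K / L) / (1 + ‖x‖) := by
  have hK0 : 0 ≤ K := (abs_nonneg _).trans (hK 0)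
  have hpos : 0 < 1 + (x.1 ^ 2 + x.2 ^ 2) := by positivity
  have h1 : HasFDerivAt (fun x : ℝ × ℝ => 1 + (x.1 ^ 2 + x.2 ^ 2))
      ((2 * x.1) • ContinuousLinearMap.fst ℝ ℝ ℝ + (2 * x.2) • ContinuousLinearMap.snd ℝ ℝ ℝ)
      x := by
    have ha := (hasFDerivAt_fst (𝕜 := ℝ) (p := x)).pow 2
    have hb := (hasFDerivAt_snd (𝕜 := ℝ) (p := x)).pow 2
    have hc := (ha.add hb).const_add 1
    refine hc.congr_fderiv ?_
    ext <;> simp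
  have h2 := ((h1.log hpos.ne').mul_const L⁻¹).sub_const 1
  have h3 : HasFDerivAt (logProfile L) _ x :=
    (((Real.smoothTransition.contDiff (n := 1)).differentiable one_ne_zero
      _).hasDerivAt.comp_hasFDerivAt x h2).const_sub 1
  rw [h3.fderiv, norm_neg, norm_smul, norm_smul, norm_smul, Real.norm_eq_abs, Real.norm_eq_abs,
    Real.norm_eq_abs, abs_of_pos (inv_pos.2 hL), abs_of_pos (inv_pos.2 hpos)]
  have h4 : ‖(2 * x.1) • ContinuousLinearMap.fst ℝ ℝ ℝ +
      (2 * x.2) • ContinuousLinearMap.snd ℝ ℝ ℝ‖ ≤ 4 * ‖x‖ := by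
    refine (norm_add_le _ _).trans ?_
    rw [norm_smul, norm_smul]
    have h1 : |x.1| ≤ ‖x‖ := norm_fst_le x
    have h2 : |x.2| ≤ ‖x‖ := norm_snd_le x
    have h5 := ContinuousLinearMap.norm_fst_le (𝕜 := ℝ) (E := ℝ) (F := ℝ)
    have h6 := ContinuousLinearMap.norm_snd_le (𝕜 := ℝ) (E := ℝ) (F := ℝ)
    rw [Real.norm_eq_abs, Real.norm_eq_abs, abs_mul, abs_mul, abs_two]
    have h7 : 2 * |x.1| * ‖ContinuousLinearMap.fst ℝ ℝ ℝ‖ ≤ 2 * ‖x‖ * 1 := by gcongr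
    have h8 : 2 * |x.2| * ‖ContinuousLinearMap.snd ℝ ℝ ℝ‖ ≤ 2 * ‖x‖ * 1 := by gcongr
    linarith
  have h5 : (1 + (x.1 ^ 2 + x.2 ^ 2))⁻¹ * (4 * ‖x‖) ≤ 8 / (1 + ‖x‖) := by
    rw [inv_mul_eq_div, div_le_div_iff₀ hpos (by positivity)]
    nlinarith [sq_norm_le x, sq_nonneg (‖x‖ - 1)]
  calc _ ≤ K * (L⁻¹ * ((1 + (x.1 ^ 2 + x.2 ^ 2))⁻¹ * (4 * ‖x‖))) := by
        gcongr
        exact hK _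
    _ ≤ K * (L⁻¹ * (8 / (1 + ‖x‖))) := by gcongr
    _ = _ := by field_simp

/-- With `L = m log 4` the transition happens where `log (1 + |x|²)` runs from `L` to `2L`, roughly
between the radii `2^m` and `4^m`. The squared derivative bound is `(K/m)²` times an integrand with
integral of order `m` up to radius `4^m`, so the Dirichlet integral is of order `1/m`. -/
theorem exists_cutoff : ∃ K : ℝ, 0 ≤ K ∧ ∀ m : ℕ, 1 ≤ m →
    ∃ T : Cutoff, T.rho = K / m ∧ T.R = 2 ^ m / 2 ∧ T.N = 4 ^ m := by
  obtain ⟨K, hK0, hK⟩ := exists_abs_deriv_smoothTransition_le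
  have hlog : 0 < Real.log 4 := Real.log_pos (by norm_num)
  refine ⟨8 * K / Real.log 4, by positivity, fun m hm => ?_⟩
  have hm0 : 0 < (m : ℝ) := by exact_mod_cast hm
  have hL : 0 < m * Real.log 4 := by positivity
  have h42 : (2 : ℝ) ≤ 4 ^ m := by
    calc (2 : ℝ) ≤ 4 ^ 1 := by norm_num
      _ ≤ 4 ^ m := pow_le_pow_right₀ (by norm_num) hm
  have h4 : ((2 : ℝ) ^ m) ^ 2 = 4 ^ m := by rw [← pow_mul, mul_comm, pow_mul]; norm_num
  refine ⟨{
    τ := logProfile (m * Real.log 4)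
    rho := 8 * K / Real.log 4 / m
    R := 2 ^ m / 2
    N := 4 ^ m
    rho_nonneg := by positivity
    nonneg := fun x => sub_nonneg.2 (Real.smoothTransition.le_one _)
    le_one := fun x => sub_le_self _ (Real.smoothTransition.nonneg _)
    contDiff := contDiff_logProfile _
    norm_fderiv_le := fun x => ?_
    eq_one := fun x hx => ?_
    eq_zero := fun x hx => ?_ }, rfl, rfl, rfl⟩
  · refine (norm_fderiv_logProfile_le hL hK x).trans (le_of_eq ?_)
    field_simp
  · rw [logProfile, Real.smoothTransition.zero_of_nonpos, sub_zero]
    rw [sub_nonpos, div_le_one hL, ← Real.log_pow]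
    refine Real.log_le_log (by positivity) ?_
    have h1 := pow_le_pow_left₀ (norm_nonneg x) hx 2
    have h2 := sq_add_sq_le x
    rw [div_pow, h4] at h1
    linarith
  · rw [logProfile, Real.smoothTransition.one_of_one_le, sub_self]
    rw [le_sub_iff_add_le, le_div_iff₀ hL]
    have h1 := pow_le_pow_left₀ (by positivity) hx 2
    have h2 := sq_norm_le x
    have h3 : (1 + 1) * (m * Real.log 4) = Real.log ((4 ^ m) ^ 2) := by
      rw [Real.log_pow, Real.log_pow]; push_cast; ring
    rw [h3]
    exact Real.log_le_log (by positivity) (by linarith)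

/-! ### Product densities -/

section PiDensity

theorem lintegral_pi_prod_fin {P : Type*} [MeasurableSpace P] (ref : Measure P) [SigmaFinite ref] :
    ∀ {n : ℕ} {g : Fin n → P → ℝ≥0∞}, (∀ i, Measurable (g i)) →
      ∫⁻ y, ∏ i, g i (y i) ∂(Measure.pi fun _ : Fin n => ref) = ∏ i, ∫⁻ x, g i x ∂ref
  | 0, g, _ => by simp
  | n + 1, g, hg => by
    have hmp := (measurePreserving_piFinSuccAbove (fun _ : Fin (n + 1) => ref) 0).symm
    have hm : Measurable fun y : Fin (n + 1) → P => ∏ i, g i (y i) := by fun_prop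
    rw [← hmp.lintegral_comp hm, Fin.prod_univ_succ,
      ← lintegral_pi_prod_fin ref (fun i => hg i.succ),
      ← lintegral_prod_mul (hg 0).aemeasurable
        (Finset.measurable_prod _ fun i _ => (hg i.succ).comp (measurable_pi_apply i)).aemeasurable]
    refine lintegral_congr fun p => ?_
    rw [Fin.prod_univ_succ]
    rfl

theorem lintegral_pi_prod {P ι : Type*} [Fintype ι] [MeasurableSpace P] (ref : Measure P)
    [SigmaFinite ref] {g : ι → P → ℝ≥0∞} (hg : ∀ i, Measurable (g i)) :
    ∫⁻ y, ∏ i, g i (y i) ∂(Measure.pi fun _ : ι => ref) = ∏ i, ∫⁻ x, g i x ∂ref := by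
  let σ := (Fintype.equivFin ι).symm
  have hmp := measurePreserving_piCongrLeft (fun _ : ι => ref) σ
  rw [← hmp.lintegral_comp (by fun_prop), ← σ.prod_comp, ← lintegral_pi_prod_fin ref
    (fun i => hg (σ i))]
  refine lintegral_congr fun y => ?_
  rw [← σ.prod_comp]
  refine Finset.prod_congr rfl fun i _ => ?_
  rw [MeasurableEquiv.coe_piCongrLeft, Equiv.piCongrLeft_apply_apply]

theorem pi_withDensity {P ι : Type*} [Fintype ι] [MeasurableSpace P] (ref : Measure P)
    [SigmaFinite ref] {J : P → ℝ≥0∞} (hJ : Measurable J)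
    [SigmaFinite (ref.withDensity J)] :
    (Measure.pi fun _ : ι => ref).withDensity (fun y => ∏ i, J (y i)) =
      Measure.pi fun _ : ι => ref.withDensity J := by
  refine (Measure.pi_eq fun s hs => ?_).symm
  rw [withDensity_apply _ (MeasurableSet.univ_pi hs),
    ← lintegral_indicator (MeasurableSet.univ_pi hs)]
  have : ∀ y : ι → P, (pi univ s).indicator (fun y => ∏ i, J (y i)) y =
      ∏ i, (s i).indicator J (y i) := by
    intro y
    by_cases hy : y ∈ pi univ s
    · rw [indicator_of_mem hy]
      exact Finset.prod_congr rfl fun i _ => (indicator_of_mem (hy i (mem_univ i)) _).symm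
    · rw [indicator_of_notMem hy]
      simp only [mem_univ_pi, not_forall] at hy
      obtain ⟨i, hi⟩ := hy
      exact (Finset.prod_eq_zero (Finset.mem_univ i) (indicator_of_notMem hi _)).symm
  rw [lintegral_congr this, lintegral_pi_prod ref fun i => hJ.indicator (hs i)]
  refine Finset.prod_congr rfl fun i _ => ?_
  rw [withDensity_apply _ (hs i), lintegral_indicator (hs i)]

end PiDensity

/-! ### Clusters of a set of bonds -/

section Bonds

variable {k : ℕ}

/-- The graph of a set of bonds. -/
def bondGraph (B : Finset (Sym2 (Fin k))) : SimpleGraph (Fin k) :=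
  SimpleGraph.fromEdgeSet (B : Set (Sym2 (Fin k)))

/-- A representative of the cluster of an index. -/
def rep (B : Finset (Sym2 (Fin k))) (i : Fin k) : Fin k :=
  Quot.out ((bondGraph B).connectedComponentMk i)

theorem reachable_rep (B : Finset (Sym2 (Fin k))) (i : Fin k) :
    (bondGraph B).Reachable i (rep B i) := by
  refine (SimpleGraph.ConnectedComponent.exact ?_).symm
  exact Quot.out_eq ((bondGraph B).connectedComponentMk i)

theorem rep_eq_of_reachable {B : Finset (Sym2 (Fin k))} {i j : Fin k}
    (h : (bondGraph B).Reachable i j) : rep B i = rep B j := by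
  rw [rep, rep, SimpleGraph.ConnectedComponent.sound h]

theorem rep_rep (B : Finset (Sym2 (Fin k))) (i : Fin k) : rep B (rep B i) = rep B i :=
  (rep_eq_of_reachable (reachable_rep B i)).symm

theorem rep_eq_of_mem {B : Finset (Sym2 (Fin k))} {i j : Fin k} (h : s(i, j) ∈ B) :
    rep B i = rep B j := by
  rcases eq_or_ne i j with rfl | hij
  · rfl
  · exact rep_eq_of_reachable (SimpleGraph.Adj.reachable
      ((SimpleGraph.fromEdgeSet_adj _).2 ⟨h, hij⟩))

/-- The indices that represent their cluster. -/
def reps (B : Finset (Sym2 (Fin k))) : Finset (Fin k) := Finset.univ.filter fun i => rep B i = i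

/-- Reachable indices are the endpoints of a path of distinct indices along bonds. -/
theorem exists_path_embedding {B : Finset (Sym2 (Fin k))} {i j : Fin k}
    (h : (bondGraph B).Reachable i j) :
    ∃ (l : ℕ) (f : Fin (l + 1) ↪ Fin k), f 0 = i ∧ f (Fin.last l) = j ∧
      (∀ a : Fin l, s(f a.castSucc, f a.succ) ∈ B) ∧
      ∀ a, (bondGraph B).Reachable i (f a) := by
  obtain ⟨p⟩ := h
  classical
  let w := p.toPath.1
  have hw : w.IsPath := p.toPath.2
  refine ⟨w.length, ⟨fun a => w.getVert a, fun a b hab => ?_⟩, ?_, ?_, fun a => ?_, fun a => ?_⟩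
  · have h1 : (a : ℕ) ≤ w.length := Nat.lt_succ_iff.1 a.2
    have h2 : (b : ℕ) ≤ w.length := Nat.lt_succ_iff.1 b.2
    exact Fin.ext (hw.getVert_injOn h1 h2 hab)
  · exact w.getVert_zero
  · exact w.getVert_length
  · have h1 := w.adj_getVert_succ (i := (a : ℕ)) a.2
    exact ((SimpleGraph.fromEdgeSet_adj _).1 h1).1
  · exact ⟨w.take a⟩

end Bonds

/-! ### Moving the clusters of a tuple and the change of variables -/

section Move

variable {S : Type*} (T : Cutoff) (w : ℝ × ℝ)

/-- The transformation of tuples: each cluster is translated by a multiple of `w` that depends on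
the position of the representative of the cluster. -/
def move {k : ℕ} (B : Finset (Sym2 (Fin k))) (y : Fin k → Particle S) : Fin k → Particle S :=
  fun i => ((y i).1 + T.τ (y (rep B i)).1 • w, (y i).2)

/-- The Jacobian of the transformation of tuples. -/
def moveJac {k : ℕ} (B : Finset (Sym2 (Fin k))) (y : Fin k → Particle S) : ℝ≥0∞ :=
  ∏ i ∈ reps B, ENNReal.ofReal (T.jac w (y i).1)

variable [MeasurableSpace S]

theorem measurable_move {k : ℕ} (B : Finset (Sym2 (Fin k))) :
    Measurable (move (S := S) T w B) := by
  have := T.continuous.measurable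
  unfold move
  fun_prop

theorem measurable_moveJac {k : ℕ} (B : Finset (Sym2 (Fin k))) :
    Measurable (moveJac (S := S) T w B) := by
  have := (T.continuous_jac w).measurable
  unfold moveJac
  fun_prop

variable [Finite S] [Nonempty S] [MeasurableSingletonClass S]

theorem measurePreserving_particleShift {w : ℝ × ℝ} (hw : T.rho * ‖w‖ < 1) :
    MeasurePreserving (fun y : Particle S => (T.shift w y.1, y.2))
      ((refMeasure S).withDensity fun y => ENNReal.ofReal (T.jac w y.1)) (refMeasure S) := by
  have h1 : Measurable fun x => ENNReal.ofReal (T.jac w x) :=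
    ENNReal.measurable_ofReal.comp (T.continuous_jac w).measurable
  have h2 := (T.measurePreserving_shift hw).prod
    (MeasurePreserving.id (ProbabilityTheory.uniformOn (univ : Set S)))
  rw [prod_withDensity_left h1] at h2
  exact h2

theorem measurePreserving_particleTranslate (u : ℝ × ℝ) :
    MeasurePreserving (fun y : Particle S => (y.1 + u, y.2)) (refMeasure S) (refMeasure S) :=
  (measurePreserving_add_right volume u).prod (MeasurePreserving.id _)

/-- As `B` does not depend on `y`, the map is triangular: the representatives undergo independent
shifts of the plane, and given their positions every other particle is translated by a constant.
This is a skew product in which only the representatives contribute to the Jacobian. -/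
theorem lintegral_moveJac_mul {w : ℝ × ℝ} (hw : T.rho * ‖w‖ < 1) {k : ℕ}
    (B : Finset (Sym2 (Fin k))) {F : (Fin k → Particle S) → ℝ≥0∞} (hF : Measurable F) :
    ∫⁻ y, moveJac T w B y * F (move T w B y) ∂(Measure.pi fun _ : Fin k => refMeasure S) =
      ∫⁻ y, F y ∂(Measure.pi fun _ : Fin k => refMeasure S) := by
  classical
  have hJ : Measurable fun y : Particle S => ENNReal.ofReal (T.jac w y.1) :=
    ENNReal.measurable_ofReal.comp ((T.continuous_jac w).measurable.comp measurable_fst)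
  let p : Fin k → Prop := fun i => rep B i = i
  let E := MeasurableEquiv.piEquivPiSubtypeProd (fun _ : Fin k => Particle S) p
  have hE : MeasurePreserving E.symm _ _ :=
    (measurePreserving_piEquivPiSubtypeProd (fun _ : Fin k => refMeasure S) p).symm
  let r : Fin k → Subtype p := fun i => ⟨rep B i, rep_rep B i⟩
  have : SigmaFinite ((refMeasure S).withDensity fun y => ENNReal.ofReal (T.jac w y.1)) :=
    SigmaFinite.withDensity_of_ne_top (by simp)
  have h1 := measurePreserving_pi (ι := Subtype p) (fun _ => _) (fun _ => _)
    fun _ => measurePreserving_particleShift (S := S) T hw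
  have h2 := h1.skew_product (μc := Measure.pi fun _ : {i // ¬p i} => refMeasure S)
    (μd := Measure.pi fun _ : {i // ¬p i} => refMeasure S)
    (g := fun a c i => ((c i).1 + T.τ (a (r i)).1 • w, (c i).2)) (by
      have := T.continuous.measurable
      unfold Function.uncurry
      fun_prop)
    (Eventually.of_forall fun a => (measurePreserving_pi (ι := {i // ¬p i}) (fun _ => _)
      (fun _ => _) fun i => measurePreserving_particleTranslate (S := S)
        (T.τ (a (r i)).1 • w)).map_eq)
  have hJm : Measurable fun z : (Subtype p → Particle S) × ({i // ¬p i} → Particle S) =>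
      ∏ i, ENNReal.ofReal (T.jac w (z.1 i).1) :=
    Finset.measurable_prod _ fun i _ => hJ.comp ((measurable_pi_apply i).comp measurable_fst)
  have hJp : Measurable fun z : Subtype p → Particle S => ∏ i, ENNReal.ofReal (T.jac w (z i).1) :=
    Finset.measurable_prod _ fun i _ => hJ.comp (measurable_pi_apply i)
  rw [← pi_withDensity (refMeasure S) hJ, prod_withDensity_left hJp] at h2
  refine (hE.lintegral_comp
    ((measurable_moveJac T w B).mul (hF.comp (measurable_move T w B)))).symm.trans
    (Eq.trans ?_ ((lintegral_withDensity_eq_lintegral_mul _ hJm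
      ((hF.comp E.symm.measurable).comp h2.measurable)).symm.trans
      ((h2.lintegral_comp (hF.comp E.symm.measurable)).trans (hE.lintegral_comp hF))))
  refine lintegral_congr fun ac => ?_
  have hval1 : ∀ i (hi : p i), E.symm ac i = ac.1 ⟨i, hi⟩ := fun i hi => dif_pos hi
  have hval2 : ∀ i (hi : ¬p i), E.symm ac i = ac.2 ⟨i, hi⟩ := fun i hi => dif_neg hi
  simp only [Pi.mul_apply]
  congr 1
  · rw [moveJac]
    have h3 := Finset.prod_subtype (reps B) (p := p) (F := inferInstance)
      (fun i => by simp [reps, p]) (fun i => ENNReal.ofReal (T.jac w (E.symm ac i).1))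
    refine h3.trans ?_
    exact Finset.prod_congr rfl fun i _ => by rw [hval1 i.1 i.2]
  · refine congrArg F ?_
    funext i
    by_cases hi : p i
    · refine Eq.trans ?_ (dif_pos hi).symm
      have : rep B i = i := hi
      rw [move, this, hval1 i hi]
      rfl
    · refine Eq.trans ?_ (dif_neg hi).symm
      rw [move, hval2 i hi, hval1 (rep B i) (rep_rep B i)]

end Move

/-! ### Elementary inequalities -/

section Arithmetic

/-- The factors are exchanged one at a time. Exchanging `a p₀` for `min (a p₀) (c p₀)` rather than
`c p₀` makes every error term a product of factors `a`, that is, of weights of the configuration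
that has not been moved. -/
theorem prod_le_prod_add_sum {α : Type*} [DecidableEq α] (s : Finset α) (a c d : α → ℝ≥0∞)
    (h : ∀ p ∈ s, a p ≤ c p + d p) :
    ∏ p ∈ s, a p ≤ ∏ p ∈ s, c p + ∑ p ∈ s, d p * ∏ p' ∈ s.erase p, a p' := by
  induction s using Finset.induction_on with
  | empty => simp
  | insert p₀ s hp ih =>
    have ih := ih fun p hps => h p (Finset.mem_insert_of_mem hps)
    rw [Finset.prod_insert hp, Finset.prod_insert hp, Finset.sum_insert hp,
      Finset.erase_insert hp]
    have h0 : a p₀ ≤ min (a p₀) (c p₀) + d p₀ := by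
      rcases le_total (a p₀) (c p₀) with h1 | h1
      · rw [min_eq_left h1]; exact le_self_add
      · rw [min_eq_right h1]; exact h p₀ (Finset.mem_insert_self _ _)
    have h1 : ∑ p ∈ s, d p * ∏ p' ∈ (insert p₀ s).erase p, a p' =
        a p₀ * ∑ p ∈ s, d p * ∏ p' ∈ s.erase p, a p' := by
      rw [Finset.mul_sum]
      refine Finset.sum_congr rfl fun p hps => ?_
      have hne : p ≠ p₀ := fun h => hp (h ▸ hps)
      rw [Finset.erase_insert_of_ne hne.symm, Finset.prod_insert
        (fun h => hp (Finset.mem_of_mem_erase h))]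
      ring
    rw [h1]
    calc a p₀ * ∏ p ∈ s, a p
        ≤ (min (a p₀) (c p₀) + d p₀) * ∏ p ∈ s, a p := by gcongr
      _ = min (a p₀) (c p₀) * ∏ p ∈ s, a p + d p₀ * ∏ p ∈ s, a p := add_mul _ _ _
      _ ≤ min (a p₀) (c p₀) * (∏ p ∈ s, c p + ∑ p ∈ s, d p * ∏ p' ∈ s.erase p, a p') +
          d p₀ * ∏ p ∈ s, a p := by gcongr
      _ ≤ (c p₀ * ∏ p ∈ s, c p + a p₀ * ∑ p ∈ s, d p * ∏ p' ∈ s.erase p, a p') +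
          d p₀ * ∏ p ∈ s, a p := by
          rw [mul_add]
          gcongr
          · exact min_le_right _ _
          · exact min_le_left _ _
      _ = _ := by ring

theorem mul_le_half_sq_add_half_sq (a b : ℝ≥0∞) : a * b ≤ 2⁻¹ * a ^ 2 + 2⁻¹ * b ^ 2 := by
  have key : 2 * (a * b) ≤ a ^ 2 + b ^ 2 := by
    induction a with
    | top => simp
    | coe a =>
      induction b with
      | top => simp
      | coe b =>
        have := two_mul_le_add_sq a b
        rw [mul_assoc] at this
        exact_mod_cast this
  calc a * b = 2⁻¹ * (2 * (a * b)) := by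
        rw [← mul_assoc, ENNReal.inv_mul_cancel two_ne_zero ENNReal.ofNat_ne_top, one_mul]
    _ ≤ 2⁻¹ * (a ^ 2 + b ^ 2) := by gcongr
    _ = _ := mul_add _ _ _

/-- For `d = Dτ(w)` the moves by `w` and `-w` have Jacobian factors `1 + d` and `1 - d`; in their
geometric mean the first order terms cancel. -/
theorem one_le_sqrt_mul_sqrt_add_sq {d : ℝ} (hd : |d| < 1) :
    1 ≤ √(1 + d) * √(1 - d) + d ^ 2 := by
  have h1 := abs_lt.1 hd
  rw [← Real.sqrt_mul (by linarith)]
  have h2 : d ^ 2 ≤ 1 := by rw [← sq_abs]; exact pow_le_one₀ (abs_nonneg d) hd.le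
  have h3 : 1 - d ^ 2 ≤ √((1 + d) * (1 - d)) := by
    refine Real.le_sqrt_of_sq_le ?_
    nlinarith [sq_nonneg d]
  linarith

end Arithmetic

/-! ### Expansion over sets of bonds and the comparison of opposite moves -/

section Expansion

variable {S : Type*} (D : Split S) (b : Particle S → ℝ≥0∞) {k : ℕ}

/-- The product of the bond weights. -/
def bondProd (B : Finset (Sym2 (Fin k))) (y : Fin k → Particle S) : ℝ≥0∞ :=
  ∏ p ∈ B, pairVal D.bond y p

/-- The product of the soft weights over a set of pairs. -/
def softProd (s : Finset (Sym2 (Fin k))) (y : Fin k → Particle S) : ℝ≥0∞ :=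
  ∏ p ∈ s, pairVal D.soft y p

/-- The weight of a tuple together with a set of bonds. -/
def splitWeight (B : Finset (Sym2 (Fin k))) (y : Fin k → Particle S) : ℝ≥0∞ :=
  (∏ i, b (y i)) * (bondProd D B y * softProd D (edges k \ B) y)

theorem pairVal_full (y : Fin k → Particle S) (p : Sym2 (Fin k)) :
    pairVal D.bond y p + pairVal D.soft y p = pairVal D.full y p := D.bond_add_soft _ _

theorem tupleWeight_eq_sum_splitWeight (y : Fin k → Particle S) :
    tupleWeight b D.full y = ∑ B ∈ (edges k).powerset, splitWeight D b B y := by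
  simp only [tupleWeight, splitWeight, ← Finset.mul_sum, bondProd, softProd]
  rw [← Finset.prod_add]
  simp only [pairVal_full]
  rfl

section Measurability

variable [MeasurableSpace S] [MeasurableSingletonClass S] [Finite S]

theorem measurable_bondProd (B : Finset (Sym2 (Fin k))) : Measurable (bondProd D B) :=
  Finset.measurable_prod _ fun _ _ => measurable_pairVal D.measurable_bond _

theorem measurable_softProd (s : Finset (Sym2 (Fin k))) : Measurable (softProd D s) :=
  Finset.measurable_prod _ fun _ _ => measurable_pairVal D.measurable_soft _

theorem measurable_splitWeight (hb : Measurable b) (B : Finset (Sym2 (Fin k))) :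
    Measurable (splitWeight D b B) :=
  (Finset.measurable_prod _ fun i _ => hb.comp (measurable_pi_apply i)).mul
    ((measurable_bondProd D B).mul (measurable_softProd D _))

end Measurability

variable (T : Cutoff) (w : ℝ × ℝ)

/-- The squared difference of the displacement factors of the members of a pair. -/
def gapSq (B : Finset (Sym2 (Fin k))) (y : Fin k → Particle S) (p : Sym2 (Fin k)) : ℝ :=
  pairVal (fun a b : ℝ => (a - b) ^ 2) (fun i => T.τ (y (rep B i)).1) p

/-- The loss in the pair weight that is caused by the transformation. -/
def pairLoss (B : Finset (Sym2 (Fin k))) (y : Fin k → Particle S) (p : Sym2 (Fin k)) : ℝ≥0∞ :=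
  ENNReal.ofReal (D.C * ‖w‖ ^ 2 * gapSq T B y p) * pairVal (near (D.r + ‖w‖)) y p

/-- The loss in the Jacobian. -/
def jacLoss (y : Particle S) : ℝ≥0∞ := ENNReal.ofReal ((fderiv ℝ T.τ y.1 w) ^ 2)

/-- Bonded particles have the same representative, hence the same displacement. This is why the
irregular part of the weight is left untouched. -/
theorem bondProd_move {B : Finset (Sym2 (Fin k))} (y : Fin k → Particle S) :
    bondProd D B (move T w B y) = bondProd D B y := by
  refine Finset.prod_congr rfl fun p hp => ?_
  have h : s((Quot.out p).1, (Quot.out p).2) ∈ B := by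
    have : s((Quot.out p).1, (Quot.out p).2) = p := Quot.out_eq p
    rwa [this]
  simp only [pairVal, Split.bond, Split.full, Split.soft, move, rep_eq_of_mem h,
    add_sub_add_right_eq_sub]

/-- The soft root at a pair, displaced by the transformation. -/
def rootMove (B : Finset (Sym2 (Fin k))) (y : Fin k → Particle S) (p : Sym2 (Fin k)) : ℝ :=
  D.q (y (Quot.out p).1).2 (y (Quot.out p).2).2
    ((y (Quot.out p).1).1 - (y (Quot.out p).2).1 +
      (T.τ (y (rep B (Quot.out p).1)).1 - T.τ (y (rep B (Quot.out p).2)).1) • w)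

theorem pairVal_soft_move (B : Finset (Sym2 (Fin k))) (y : Fin k → Particle S)
    (p : Sym2 (Fin k)) :
    pairVal D.soft (move T w B y) p = ENNReal.ofReal (rootMove D T w B y p) ^ 2 := by
  rw [rootMove, ← ENNReal.ofReal_pow (D.q_nonneg _ _ _), pairVal, Split.soft]
  congr 3
  simp only [move, sub_smul]
  abel

/-- For near pairs this is the defining inequality of `q` with `s = t • w`. For the others `q`
equals one at all three points, because `‖t • w‖ ≤ ‖w‖`, and there is no loss. -/
theorem pairVal_soft_le (B : Finset (Sym2 (Fin k))) (y : Fin k → Particle S)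
    (p : Sym2 (Fin k)) :
    pairVal D.soft y p ≤ ENNReal.ofReal (rootMove D T w B y p) *
      ENNReal.ofReal (rootMove D T (-w) B y p) + pairLoss D T w B y p := by
  set i := (Quot.out p).1 with hi
  set j := (Quot.out p).2 with hj
  set x := (y i).1 - (y j).1 with hx
  set t := T.τ (y (rep B i)).1 - T.τ (y (rep B j)).1 with ht
  have e1 : rootMove D T w B y p = D.q (y i).2 (y j).2 (x + t • w) := rfl
  have e2 : rootMove D T (-w) B y p = D.q (y i).2 (y j).2 (x - t • w) := by
    rw [sub_eq_add_neg, ← smul_neg]; rfl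
  have e3 : pairVal D.soft y p = ENNReal.ofReal (D.q (y i).2 (y j).2 x ^ 2) := rfl
  have e4 : pairLoss D T w B y p = ENNReal.ofReal (D.C * ‖w‖ ^ 2 * t ^ 2) *
      {x : ℝ × ℝ | ‖x‖ ≤ D.r + ‖w‖}.indicator 1 x := rfl
  rw [e1, e2, e3, e4, ← ENNReal.ofReal_mul (D.q_nonneg _ _ _)]
  have ht1 : |t| ≤ 1 := by
    rw [abs_le]
    constructor <;> linarith [T.nonneg (y (rep B i)).1, T.nonneg (y (rep B j)).1,
      T.le_one (y (rep B i)).1, T.le_one (y (rep B j)).1]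
  have htw : ‖t • w‖ ≤ ‖w‖ := by
    rw [norm_smul, Real.norm_eq_abs]
    exact mul_le_of_le_one_left (norm_nonneg _) ht1
  by_cases hn : ‖x‖ ≤ D.r + ‖w‖
  · rw [indicator_of_mem (by exact hn), Pi.one_apply, mul_one, ← ENNReal.ofReal_add
      (mul_nonneg (D.q_nonneg _ _ _) (D.q_nonneg _ _ _))
      (mul_nonneg (mul_nonneg D.C_nonneg (sq_nonneg _)) (sq_nonneg _))]
    refine ENNReal.ofReal_le_ofReal ?_
    have h := D.q_sq_sub_le (y i).2 (y j).2 x (t • w)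
    rw [norm_smul, mul_pow, Real.norm_eq_abs, sq_abs] at h
    linarith
  · have hn' := not_le.1 hn
    have h1 := norm_sub_norm_le x (-(t • w))
    have h2 := norm_sub_norm_le x (t • w)
    rw [norm_neg, sub_neg_eq_add] at h1
    rw [D.q_far _ _ x (by linarith [norm_nonneg w]), D.q_far _ _ (x + t • w) (by linarith),
      D.q_far _ _ (x - t • w) (by linarith)]
    simp

/-- `X²` and `Y²` are the weights, Jacobian included, after the moves by `w` and `-w`. `X * Y`
dominates the original soft product up to the losses, by telescoping over the pairs and over the
representatives separately; then `X * Y ≤ (X² + Y²) / 2`. -/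
theorem softProd_le_of_move (hw : T.rho * ‖w‖ < 1) (B : Finset (Sym2 (Fin k)))
    (y : Fin k → Particle S) :
    softProd D (edges k \ B) y ≤
      2⁻¹ * (moveJac T w B y * softProd D (edges k \ B) (move T w B y)) +
      2⁻¹ * (moveJac T (-w) B y * softProd D (edges k \ B) (move T (-w) B y)) +
      (∑ p ∈ edges k \ B, pairLoss D T w B y p * softProd D ((edges k \ B).erase p) y) +
      softProd D (edges k \ B) y * ∑ i, jacLoss T w (y i) := by
  set d : Fin k → ℝ := fun i => fderiv ℝ T.τ (y i).1 w with hd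
  have hd1 : ∀ i, |d i| < 1 := fun i =>
    (((fderiv ℝ T.τ (y i).1).le_opNorm w).trans (mul_le_mul_of_nonneg_right
      (T.norm_fderiv_le_rho _) (norm_nonneg w))).trans_lt hw
  set Jc : ℝ≥0∞ := ∏ i ∈ reps B, (ENNReal.ofReal √(1 + d i) * ENNReal.ofReal √(1 - d i)) with hJc
  have hJ1 : 1 ≤ Jc + ∑ i, jacLoss T w (y i) := by
    have h := prod_le_prod_add_sum (reps B) (fun _ => 1)
      (fun i => ENNReal.ofReal √(1 + d i) * ENNReal.ofReal √(1 - d i))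
      (fun i => jacLoss T w (y i)) (fun i _ => by
        rw [← ENNReal.ofReal_mul (Real.sqrt_nonneg _), jacLoss, ← ENNReal.ofReal_add
          (mul_nonneg (Real.sqrt_nonneg _) (Real.sqrt_nonneg _)) (sq_nonneg _),
          ENNReal.one_le_ofReal]
        exact one_le_sqrt_mul_sqrt_add_sq (hd1 i))
    simp only [Finset.prod_const_one, mul_one] at h
    refine h.trans ?_
    gcongr
    exact Finset.subset_univ _
  have hJle : Jc ≤ 1 := by
    refine Finset.prod_le_one' fun i _ => ?_
    rw [← ENNReal.ofReal_mul (Real.sqrt_nonneg _), ← Real.sqrt_mul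
      (by linarith [(abs_lt.1 (hd1 i)).1])]
    refine ENNReal.ofReal_le_one.2 (Real.sqrt_le_one.2 ?_)
    nlinarith [sq_nonneg (d i)]
  set X : ℝ≥0∞ := (∏ i ∈ reps B, ENNReal.ofReal √(1 + d i)) *
    ∏ p ∈ edges k \ B, ENNReal.ofReal (rootMove D T w B y p) with hX
  set Y : ℝ≥0∞ := (∏ i ∈ reps B, ENNReal.ofReal √(1 - d i)) *
    ∏ p ∈ edges k \ B, ENNReal.ofReal (rootMove D T (-w) B y p) with hY
  have hX2 : X ^ 2 = moveJac T w B y * softProd D (edges k \ B) (move T w B y) := by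
    rw [hX, mul_pow, ← Finset.prod_pow, ← Finset.prod_pow, moveJac, softProd]
    congr 1
    · refine Finset.prod_congr rfl fun i _ => ?_
      rw [← ENNReal.ofReal_pow (Real.sqrt_nonneg _), Real.sq_sqrt
        (by linarith [(abs_lt.1 (hd1 i)).1])]
      rfl
    · exact Finset.prod_congr rfl fun p _ => (pairVal_soft_move D T w B y p).symm
  have hY2 : Y ^ 2 = moveJac T (-w) B y * softProd D (edges k \ B) (move T (-w) B y) := by
    rw [hY, mul_pow, ← Finset.prod_pow, ← Finset.prod_pow, moveJac, softProd]
    congr 1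
    · refine Finset.prod_congr rfl fun i _ => ?_
      rw [← ENNReal.ofReal_pow (Real.sqrt_nonneg _), Real.sq_sqrt
        (by linarith [(abs_lt.1 (hd1 i)).2]), Cutoff.jac, map_neg, ← sub_eq_add_neg]
    · exact Finset.prod_congr rfl fun p _ => (pairVal_soft_move D T (-w) B y p).symm
  have hXY : X * Y = Jc * ∏ p ∈ edges k \ B, (ENNReal.ofReal (rootMove D T w B y p) *
      ENNReal.ofReal (rootMove D T (-w) B y p)) := by
    rw [hX, hY, hJc, Finset.prod_mul_distrib, Finset.prod_mul_distrib]
    ring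
  have hs := prod_le_prod_add_sum (edges k \ B) (pairVal D.soft y)
    (fun p => ENNReal.ofReal (rootMove D T w B y p) * ENNReal.ofReal (rootMove D T (-w) B y p))
    (pairLoss D T w B y) (fun p _ => pairVal_soft_le D T w B y p)
  calc softProd D (edges k \ B) y
      ≤ softProd D (edges k \ B) y * (Jc + ∑ i, jacLoss T w (y i)) := le_mul_of_one_le_right' hJ1
    _ = Jc * softProd D (edges k \ B) y +
        softProd D (edges k \ B) y * ∑ i, jacLoss T w (y i) := by ring
    _ ≤ Jc * (∏ p ∈ edges k \ B, (ENNReal.ofReal (rootMove D T w B y p) *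
          ENNReal.ofReal (rootMove D T (-w) B y p)) +
          ∑ p ∈ edges k \ B, pairLoss D T w B y p * softProd D ((edges k \ B).erase p) y) +
        softProd D (edges k \ B) y * ∑ i, jacLoss T w (y i) := by gcongr; exact hs
    _ ≤ (X * Y + ∑ p ∈ edges k \ B, pairLoss D T w B y p *
          softProd D ((edges k \ B).erase p) y) +
        softProd D (edges k \ B) y * ∑ i, jacLoss T w (y i) := by
        rw [mul_add, hXY]
        gcongr
        exact mul_le_of_le_one_left' hJle
    _ ≤ _ := by
        rw [← hX2, ← hY2]
        gcongr
        exact mul_le_half_sq_add_half_sq X Y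

end Expansion

/-! ### Paths along bonds -/

section Paths

variable {k : ℕ}

/-- The edges of a sequence of indices. -/
def pathEdges {l : ℕ} (f : Fin (l + 1) → Fin k) : Finset (Sym2 (Fin k)) :=
  Finset.univ.image fun a : Fin l => s(f a.castSucc, f a.succ)

theorem mem_of_pathEdges_subset {l : ℕ} {f : Fin (l + 1) → Fin k} {B : Finset (Sym2 (Fin k))}
    (h : pathEdges f ⊆ B) (a : Fin l) : s(f a.castSucc, f a.succ) ∈ B :=
  h (Finset.mem_image_of_mem _ (Finset.mem_univ a))

theorem pathEdges_subset_iff {l : ℕ} {f : Fin (l + 1) → Fin k} {B : Finset (Sym2 (Fin k))} :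
    pathEdges f ⊆ B ↔ ∀ a : Fin l, s(f a.castSucc, f a.succ) ∈ B := by
  simp [pathEdges, Finset.image_subset_iff]

theorem pathEdges_injective {l : ℕ} {f : Fin (l + 1) → Fin k} (hf : Function.Injective f) :
    Function.Injective fun a : Fin l => s(f a.castSucc, f a.succ) := by
  intro a b hab
  rcases Sym2.eq_iff.1 hab with ⟨h, -⟩ | ⟨h1, h2⟩
  · exact Fin.castSucc_injective _ (hf h)
  · have h3 := congrArg Fin.val (hf h1)
    have h4 := congrArg Fin.val (hf h2)
    simp only [Fin.val_castSucc, Fin.val_succ] at h3 h4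
    omega

theorem pathEdges_subset_edges {l : ℕ} {f : Fin (l + 1) → Fin k} (hf : Function.Injective f) :
    pathEdges f ⊆ edges k := by
  rw [pathEdges_subset_iff]
  intro a
  rw [mk_mem_edges]
  intro h
  have := congrArg Fin.val (hf h)
  simp at this

variable {S : Type*} (D : Split S)

theorem prod_pathEdges {l : ℕ} {f : Fin (l + 1) → Fin k} (hf : Function.Injective f)
    (y : Fin k → Particle S) :
    ∏ p ∈ pathEdges f, pairVal D.bond y p =
      ∏ a : Fin l, D.bond (y (f a.castSucc)) (y (f a.succ)) := by
  rw [pathEdges, Finset.prod_image fun a _ b _ h => pathEdges_injective hf h]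
  exact Finset.prod_congr rfl fun a _ => pairVal_mk D.bond_symm _ _ _

theorem norm_sub_le_of_mem {B : Finset (Sym2 (Fin k))} {y : Fin k → Particle S}
    (hB : bondProd D B y ≠ 0) {i j : Fin k} (h : s(i, j) ∈ B) :
    ‖(y i).1 - (y j).1‖ ≤ D.r := by
  by_contra hcon
  refine hB (Finset.prod_eq_zero h ?_)
  rw [pairVal_mk D.bond_symm]
  exact D.bond_eq_zero (not_le.1 hcon).le

theorem norm_sub_le_of_path {B : Finset (Sym2 (Fin k))} {y : Fin k → Particle S}
    (hB : bondProd D B y ≠ 0) {l : ℕ} {f : Fin (l + 1) → Fin k} (h : pathEdges f ⊆ B)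
    (a : Fin (l + 1)) : ‖(y (f 0)).1 - (y (f a)).1‖ ≤ (a : ℕ) * D.r := by
  induction a using Fin.induction with
  | zero => simp
  | succ a ih =>
    have h1 := norm_sub_le_of_mem D hB (mem_of_pathEdges_subset h a)
    have h2 := norm_sub_le_norm_sub_add_norm_sub (y (f 0)).1 (y (f a.castSucc)).1 (y (f a.succ)).1
    simp only [Fin.val_castSucc, Fin.val_succ] at ih ⊢
    push_cast
    linarith

/-- Pair weights are at most one, so all pairs except those between particles listed by `g` can be
dropped. This decouples the marked particles from the rest. -/
theorem prod_full_le {n : ℕ} (g : Fin n ↪ Fin k) {s : Finset (Sym2 (Fin k))}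
    (hs : ∀ i j, i ≠ j → s(g i, g j) ∈ s) (y : Fin k → Particle S) :
    ∏ p ∈ s, pairVal D.full y p ≤ pairProd D.full (y ∘ g) := by
  have h1 : pairProd D.full (y ∘ g) = ∏ p ∈ (edges n).image (Sym2.map g), pairVal D.full y p := by
    rw [Finset.prod_image fun a _ b _ h => Sym2.map.injective g.injective h]
    refine Finset.prod_congr rfl fun p _ => ?_
    induction p using Sym2.inductionOn with
    | hf i j =>
      rw [Sym2.map_mk, pairVal_mk D.full_symm, pairVal_mk D.full_symm]
      rfl
  rw [h1]
  refine Finset.prod_le_prod_of_subset_of_le_one' ?_ fun p _ _ => D.full_le_one _ _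
  intro q hq
  obtain ⟨p, hp, rfl⟩ := Finset.mem_image.1 hq
  clear hq
  induction p using Sym2.inductionOn with
  | hf i j => exact hs i j (mk_mem_edges.1 hp)

theorem prod_weight_le {b : Particle S → ℝ≥0∞} (hb1 : ∀ y, b y ≤ 1) {m n : ℕ}
    (f : Fin (m + 1) ↪ Fin k) (g : Fin n ↪ Fin k) (hfg : ∀ i j, f i ≠ g j)
    (y : Fin k → Particle S) :
    ∏ i, b (y i) ≤ b (y (f 0)) * ∏ i, b ((y ∘ g) i) := by
  have h1 : ∏ i, b ((y ∘ g) i) = ∏ i ∈ Finset.univ.map g, b (y i) := by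
    rw [Finset.prod_map]; rfl
  have h2 : f 0 ∉ Finset.univ.map g := by
    simp only [Finset.mem_map, Finset.mem_univ, true_and, not_exists]
    exact fun j h => hfg 0 j h.symm
  rw [h1, ← Finset.prod_insert (f := fun i => b (y i)) h2]
  exact Finset.prod_le_prod_of_subset_of_le_one' (Finset.subset_univ _) fun i _ _ => hb1 _

end Paths

/-! ### Sums over bond sets that contain a marked path -/

section MarkedSums

variable {k : ℕ} {S : Type*} (D : Split S) (b : Particle S → ℝ≥0∞)

/-- The total weight of the sets of bonds that contain a given path. -/
def pathTerm {l : ℕ} (K : Particle S → ℝ≥0∞) (f : Fin (l + 1) ↪ Fin k)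
    (y : Fin k → Particle S) : ℝ≥0∞ :=
  ∑ B ∈ (edges k).powerset, if pathEdges f ⊆ B then
    K (y (f 0)) * splitWeight D b B y else 0

/-- The total weight of the sets of bonds that contain a given path and avoid a given pair, when
the weight of this pair is dropped. -/
def pairTerm {l : ℕ} (ρ : ℝ) (K : Particle S → ℝ≥0∞) (f : Fin (l + 2) ↪ Fin k)
    (y : Fin k → Particle S) : ℝ≥0∞ :=
  ∑ B ∈ (edges k).powerset, if pathEdges (fun a : Fin (l + 1) => f a.succ) ⊆ B ∧
      s(f 0, f 1) ∉ B then
    K (y (f 0)) * near ρ (y (f 0)) (y (f 1)) * ((∏ i, b (y i)) * (bondProd D B y *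
      softProd D ((edges k \ B).erase s(f 0, f 1)) y)) else 0

variable {b}

/-- Summation over the bonds off the path restores the full weight there; then every interaction
with or among marked particles is dropped, apart from the bonds of the path. Of the one-particle
weights of the marked particles only that of the starting point is kept, to confine the path to the
volume. -/
theorem pathTerm_le (hb1 : ∀ y, b y ≤ 1) {l n : ℕ} (K : Particle S → ℝ≥0∞)
    (f : Fin (l + 1) ↪ Fin k) (g : Fin n ↪ Fin k) (hfg : ∀ i j, f i ≠ g j)
    (y : Fin k → Particle S) :
    pathTerm D b K f y ≤ (b ((y ∘ f) 0) * K ((y ∘ f) 0) *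
      ∏ a : Fin l, D.bond ((y ∘ f) a.castSucc) ((y ∘ f) a.succ)) *
      tupleWeight b D.full (y ∘ g) := by
  have hsum : ∑ B ∈ edges k |>.powerset with pathEdges f ⊆ B,
      bondProd D B y * softProd D (edges k \ B) y = (∏ p ∈ pathEdges f, pairVal D.bond y p) *
        ∏ p ∈ edges k \ pathEdges f, pairVal D.full y p := by
    have := sum_powerset_filter_prod (edges k) (pathEdges f)
      (pathEdges_subset_edges f.injective) (pairVal D.bond y) (pairVal D.soft y)
    simp only [pairVal_full] at this
    exact this
  have hle := prod_full_le D g (s := edges k \ pathEdges f) (y := y) (fun i j hij => by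
    refine Finset.mem_sdiff.2 ⟨mk_mem_edges.2 (g.injective.ne hij), fun h => ?_⟩
    obtain ⟨a, -, ha⟩ := Finset.mem_image.1 h
    rcases Sym2.eq_iff.1 ha with ⟨h1, -⟩ | ⟨h1, -⟩
    · exact hfg _ _ h1
    · exact hfg _ _ h1)
  calc pathTerm D b K f y = K (y (f 0)) * (∏ i, b (y i)) *
        ∑ B ∈ edges k |>.powerset with pathEdges f ⊆ B,
          bondProd D B y * softProd D (edges k \ B) y := by
        rw [pathTerm, Finset.mul_sum, Finset.sum_filter]
        refine Finset.sum_congr rfl fun B _ => ?_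
        split_ifs
        · rw [splitWeight]; ring
        · rfl
    _ ≤ K (y (f 0)) * (b (y (f 0)) * ∏ i, b ((y ∘ g) i)) *
        ((∏ a : Fin l, D.bond (y (f a.castSucc)) (y (f a.succ))) * pairProd D.full (y ∘ g)) := by
        rw [hsum, prod_pathEdges D f.injective]
        gcongr
        exact prod_weight_le hb1 f g hfg y
    _ = _ := by
        simp only [tupleWeight, Function.comp]
        ring

/-- The pair of the first two marked particles occurs neither among the bonds nor among the soft
factors, so the sum is an expansion over the remaining pairs; the proximity indicator takes the
place of the weight of that pair. -/
theorem pairTerm_le (hb1 : ∀ y, b y ≤ 1) {l n : ℕ} (ρ : ℝ) (K : Particle S → ℝ≥0∞)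
    (f : Fin (l + 2) ↪ Fin k) (g : Fin n ↪ Fin k) (hfg : ∀ i j, f i ≠ g j)
    (y : Fin k → Particle S) :
    pairTerm D b ρ K f y ≤ (b ((y ∘ f) 0) * K ((y ∘ f) 0) * (near ρ ((y ∘ f) 0) ((y ∘ f) 1) *
      ∏ a : Fin l, D.bond ((y ∘ f) a.castSucc.succ) ((y ∘ f) a.succ.succ))) *
      tupleWeight b D.full (y ∘ g) := by
  set p := s(f 0, f 1) with hp
  set P := pathEdges (fun a : Fin (l + 1) => f a.succ) with hP
  have hinj : Function.Injective (fun a : Fin (l + 1) => f a.succ) :=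
    f.injective.comp (Fin.succ_injective _)
  have hPE : P ⊆ (edges k).erase p := by
    refine Finset.subset_erase.2 ⟨pathEdges_subset_edges hinj, fun h => ?_⟩
    obtain ⟨a, -, ha⟩ := Finset.mem_image.1 h
    rcases Sym2.eq_iff.1 ha with ⟨h1, -⟩ | ⟨-, h1⟩
    · exact absurd (f.injective h1) (Fin.succ_ne_zero _)
    · exact absurd (f.injective h1) (Fin.succ_ne_zero _)
  have hsum : ∑ B ∈ ((edges k).erase p).powerset with P ⊆ B,
      bondProd D B y * softProd D ((edges k).erase p \ B) y =
        (∏ q ∈ P, pairVal D.bond y q) * ∏ q ∈ (edges k).erase p \ P, pairVal D.full y q := by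
    have := sum_powerset_filter_prod _ P hPE (pairVal D.bond y) (pairVal D.soft y)
    simp only [pairVal_full] at this
    exact this
  have hle := prod_full_le D g (s := (edges k).erase p \ P) (y := y) (fun i j hij => by
    refine Finset.mem_sdiff.2 ⟨Finset.mem_erase.2 ⟨fun h => ?_,
      mk_mem_edges.2 (g.injective.ne hij)⟩, fun h => ?_⟩
    · rcases Sym2.eq_iff.1 h with ⟨h1, -⟩ | ⟨h1, -⟩
      · exact hfg _ _ h1.symm
      · exact hfg _ _ h1.symm
    · obtain ⟨a, -, ha⟩ := Finset.mem_image.1 h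
      rcases Sym2.eq_iff.1 ha with ⟨h1, -⟩ | ⟨h1, -⟩
      · exact hfg _ _ h1
      · exact hfg _ _ h1)
  have hfil : ((edges k).powerset.filter fun B => P ⊆ B ∧ p ∉ B) =
      ((edges k).erase p).powerset.filter fun B => P ⊆ B := by
    ext B
    simp only [Finset.mem_filter, Finset.mem_powerset, Finset.subset_erase]
    tauto
  calc pairTerm D b ρ K f y = K (y (f 0)) * near ρ (y (f 0)) (y (f 1)) * (∏ i, b (y i)) *
        ∑ B ∈ ((edges k).erase p).powerset with P ⊆ B,
          bondProd D B y * softProd D ((edges k).erase p \ B) y := by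
        rw [← hfil, Finset.mul_sum, Finset.sum_filter, pairTerm]
        refine Finset.sum_congr rfl fun B _ => ?_
        rw [Finset.erase_sdiff_comm]
        split_ifs
        · ring
        · rfl
    _ ≤ K (y (f 0)) * near ρ (y (f 0)) (y (f 1)) * (b (y (f 0)) * ∏ i, b ((y ∘ g) i)) *
        ((∏ a : Fin l, D.bond (y (f a.castSucc.succ)) (y (f a.succ.succ))) *
          pairProd D.full (y ∘ g)) := by
        rw [hsum, hP, prod_pathEdges D hinj]
        gcongr
        exact prod_weight_le hb1 f g hfg y
    _ = _ := by
        simp only [tupleWeight, Function.comp]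
        ring

variable [MeasurableSpace S] [MeasurableSingletonClass S] [Finite S] [Nonempty S]

theorem measurable_pathTerm (hb : Measurable b) {l : ℕ} {K : Particle S → ℝ≥0∞}
    (hK : Measurable K) (f : Fin (l + 1) ↪ Fin k) : Measurable (pathTerm D b K f) := by
  refine Finset.measurable_sum _ fun B _ => ?_
  split_ifs
  · exact (hK.comp (measurable_pi_apply _)).mul (measurable_splitWeight D b hb B)
  · exact measurable_const

theorem measurable_pairTerm (hb : Measurable b) {l : ℕ} {ρ : ℝ} {K : Particle S → ℝ≥0∞}
    (hK : Measurable K) (f : Fin (l + 2) ↪ Fin k) : Measurable (pairTerm D b ρ K f) := by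
  refine Finset.measurable_sum _ fun B _ => ?_
  split_ifs
  · refine ((hK.comp (measurable_pi_apply _)).mul ?_).mul
      ((Finset.measurable_prod _ fun i _ => hb.comp (measurable_pi_apply i)).mul
        ((measurable_bondProd D B).mul (measurable_softProd D _)))
    exact (measurable_near ρ).comp (f := fun y : Fin k → Particle S => (y (f 0), y (f 1)))
      (by fun_prop)
  · exact measurable_const

theorem grand_pathTerm_le (hb : Measurable b) (hb1 : ∀ y, b y ≤ 1) (z : ℝ≥0∞) {l : ℕ}
    {K : Particle S → ℝ≥0∞} (hK : Measurable K) :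
    grand (refMeasure S) z (fun k y => ∑ f : Fin (l + 1) ↪ Fin k, pathTerm D b K f y) ≤
      z ^ (l + 1) * ((∫⁻ y, b y * K y ∂(refMeasure S)) * D.eps ^ l) *
        grand (refMeasure S) z (fun _ y => tupleWeight b D.full y) := by
  have hF : Measurable fun y : Fin (l + 1) → Particle S => b (y 0) * K (y 0) *
      ∏ a : Fin l, D.bond (y a.castSucc) (y a.succ) := by
    refine ((hb.mul hK).comp (measurable_pi_apply 0)).mul (Finset.measurable_prod _ fun a _ => ?_)
    exact D.measurable_bond.comp (f := fun y : Fin (l + 1) → Particle S =>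
      (y a.castSucc, y a.succ)) (by fun_prop)
  refine (grand_le_of_marked (refMeasure S) hb D.measurable_full hF
    (fun k f => measurable_pathTerm D hb hK f)
    (fun n k f g _ hfg y => pathTerm_le D hb1 K f g hfg y)).trans ?_
  have h := lintegral_chain_le (refMeasure S) (l := l) (hb.mul hK) (fun _ => D.bond)
    (fun _ => D.measurable_bond) (fun _ => D.eps) (fun _ => D.lintegral_bond_le)
  rw [Finset.prod_const, Finset.card_univ, Fintype.card_fin] at h
  gcongr
  exact h

theorem grand_pairTerm_le (hb : Measurable b) (hb1 : ∀ y, b y ≤ 1) (z : ℝ≥0∞) {l : ℕ} {ρ : ℝ}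
    {K : Particle S → ℝ≥0∞} (hK : Measurable K) :
    grand (refMeasure S) z (fun k y => ∑ f : Fin (l + 2) ↪ Fin k, pairTerm D b ρ K f y) ≤
      z ^ (l + 2) * ((∫⁻ y, b y * K y ∂(refMeasure S)) *
        (volume (Metric.closedBall (0 : ℝ × ℝ) ρ) * D.eps ^ l)) *
        grand (refMeasure S) z (fun _ y => tupleWeight b D.full y) := by
  have hF : Measurable fun y : Fin (l + 2) → Particle S => b (y 0) * K (y 0) *
      (near ρ (y 0) (y 1) * ∏ a : Fin l, D.bond (y a.castSucc.succ) (y a.succ.succ)) := by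
    refine ((hb.mul hK).comp (measurable_pi_apply 0)).mul (Measurable.mul ?_
      (Finset.measurable_prod _ fun a _ => ?_))
    · exact (measurable_near ρ).comp (f := fun y : Fin (l + 2) → Particle S => (y 0, y 1))
        (by fun_prop)
    · exact D.measurable_bond.comp (f := fun y : Fin (l + 2) → Particle S =>
        (y a.castSucc.succ, y a.succ.succ)) (by fun_prop)
  refine (grand_le_of_marked (refMeasure S) hb D.measurable_full hF
    (fun k f => measurable_pairTerm D hb hK f)
    (fun n k f g _ hfg y => pairTerm_le D hb1 ρ K f g hfg y)).trans ?_
  have h := lintegral_chain_le (refMeasure S) (l := l + 1) (hb.mul hK)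
    -- The first link is the nearby pair and costs the volume of a ball; each later link is a bond
    -- and costs `eps`.
    (fun a => if a = 0 then near ρ else D.bond)
    (fun a => by split_ifs; exacts [measurable_near ρ, D.measurable_bond])
    (fun a => if a = 0 then volume (Metric.closedBall (0 : ℝ × ℝ) ρ) else D.eps)
    (fun a y => by split_ifs; exacts [lintegral_near_le ρ y, D.lintegral_bond_le y])
  simp only [Fin.prod_univ_succ (n := l), Fin.val_zero, if_true, Fin.val_succ,
    Nat.add_one_ne_zero, if_false, Finset.prod_const, Finset.card_univ, Fintype.card_fin] at h
  gcongr
  exact h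

end MarkedSums

/-! ### Domination of the losses by marked paths -/

section Losses

variable {S : Type*} (D : Split S) (T : Cutoff) (w : ℝ × ℝ) (ρ : ℝ)

/-- Every cluster that meets the ball of radius `T.N` has small extension. -/
def Good {k : ℕ} (B : Finset (Sym2 (Fin k))) (y : Fin k → Particle S) : Prop :=
  ∀ i j, (bondGraph B).Reachable i j → ‖(y i).1‖ ≤ T.N → ‖(y i).1 - (y j).1‖ < ρ

/-- The weight that controls large clusters. -/
def badKernel (l : ℕ) (y : Particle S) : ℝ≥0∞ :=
  {x : ℝ × ℝ | ‖x‖ ≤ T.N}.indicator (fun _ => ENNReal.ofReal ((l * D.r / ρ) ^ 5)) y.1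

/-- The weight of paths: it controls large clusters and the loss in the Jacobian. -/
def pathKernel (l : ℕ) (y : Particle S) : ℝ≥0∞ :=
  badKernel D T ρ l y + if l = 0 then jacLoss T w y else 0

/-- The weight that controls the losses in the pair weights. -/
def pairKernel (l : ℕ) (y : Particle S) : ℝ≥0∞ :=
  ENNReal.ofReal (6 * D.C * ‖w‖ ^ 2 * (1 + (D.r + ‖w‖)) ^ 6 * (l + 1) ^ 4 *
    (T.rho / (1 + ‖y.1‖)) ^ 2)

variable {D T w ρ} {k : ℕ} {b : Particle S → ℝ≥0∞}

/-- Bonds have length at most `r`, so a cluster of extension at least `ρ` contains a path of `l`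
bonds with `l * r ≥ ρ`, and for it the kernel is at least one. The fifth power will beat the area of
the ball of radius `T.N`, which is of order `ρ⁴` for the parameters chosen later. -/
theorem splitWeight_le_of_not_good (hρ : 0 < ρ) {B : Finset (Sym2 (Fin k))}
    {y : Fin k → Particle S} (hgood : ¬ Good T ρ B y) :
    splitWeight D b B y ≤ ∑' l : ℕ, ∑ f : Fin (l + 1) ↪ Fin k,
      if pathEdges f ⊆ B then badKernel D T ρ l (y (f 0)) * splitWeight D b B y else 0 := by
  by_cases h0 : bondProd D B y = 0
  · simp [splitWeight, h0]
  simp only [Good, not_forall, not_lt] at hgood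
  obtain ⟨i, j, hij, hi, hd⟩ := hgood
  obtain ⟨l, f, hf0, hfl, hfB, -⟩ := exists_path_embedding hij
  have hB := pathEdges_subset_iff.2 hfB
  have h1 := norm_sub_le_of_path D h0 hB (Fin.last l)
  rw [hf0, hfl, Fin.val_last] at h1
  have h2 : 1 ≤ badKernel D T ρ l (y (f 0)) := by
    rw [badKernel, hf0, indicator_of_mem (by exact hi), ENNReal.one_le_ofReal]
    refine one_le_pow₀ ?_
    rw [one_le_div hρ]
    linarith
  calc splitWeight D b B y ≤ badKernel D T ρ l (y (f 0)) * splitWeight D b B y :=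
        le_mul_of_one_le_left' h2
    _ = if pathEdges f ⊆ B then badKernel D T ρ l (y (f 0)) * splitWeight D b B y else 0 := by
        rw [if_pos hB]
    _ ≤ ∑ f : Fin (l + 1) ↪ Fin k,
        if pathEdges f ⊆ B then badKernel D T ρ l (y (f 0)) * splitWeight D b B y else 0 :=
        Finset.single_le_sum (f := fun f : Fin (l + 1) ↪ Fin k => if pathEdges f ⊆ B then
          badKernel D T ρ l (y (f 0)) * splitWeight D b B y else 0)
          (fun _ _ => zero_le) (Finset.mem_univ f)
    _ ≤ _ := ENNReal.le_tsum (f := fun l : ℕ => ∑ f : Fin (l + 1) ↪ Fin k,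
        if pathEdges f ⊆ B then badKernel D T ρ l (y (f 0)) * splitWeight D b B y else 0) l

/-- The Jacobian loss marks a single particle, which is a path with `l = 0`. -/
theorem splitWeight_mul_jacLoss_le {B : Finset (Sym2 (Fin k))} {y : Fin k → Particle S} :
    splitWeight D b B y * ∑ i, jacLoss T w (y i) ≤ ∑' l : ℕ, ∑ f : Fin (l + 1) ↪ Fin k,
      if pathEdges f ⊆ B then (if l = 0 then jacLoss T w (y (f 0)) else 0) *
        splitWeight D b B y else 0 := by
  refine le_trans (le_of_eq ?_) (ENNReal.le_tsum 0)
  have h := (Equiv.uniqueEmbeddingEquivResult (α := Fin 1) (β := Fin k)).sum_comp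
    fun i => jacLoss T w (y i) * splitWeight D b B y
  rw [mul_comm, Finset.sum_mul, ← h]
  refine Finset.sum_congr rfl fun f _ => ?_
  rw [if_pos, if_pos rfl]
  · rfl
  · rw [pathEdges_subset_iff]; exact fun a => a.elim0

/-- The representative of `i` is reached from `i` by a path of distinct bonded particles; `j` can be
put in front of it because it lies in another cluster. The two differences of `τ` are then bounded
by the decay at the position of `j`, with a polynomial factor in the length of the path. -/
theorem one_orientation_le {B : Finset (Sym2 (Fin k))} {y : Fin k → Particle S}
    (h0 : bondProd D B y ≠ 0) {i j : Fin k} (hij : rep B i ≠ rep B j)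
    (hn : ‖(y j).1 - (y i).1‖ ≤ D.r + ‖w‖) :
    ∃ (l : ℕ) (f : Fin (l + 2) ↪ Fin k), f 0 = j ∧ f 1 = i ∧
      pathEdges (fun a : Fin (l + 1) => f a.succ) ⊆ B ∧
      ENNReal.ofReal (D.C * ‖w‖ ^ 2 * (3 * ((T.τ (y j).1 - T.τ (y i).1) ^ 2 +
        (T.τ (y i).1 - T.τ (y (rep B i)).1) ^ 2))) ≤ pairKernel D T w l (y j) := by
  obtain ⟨l, f, hf0, hfl, hfB, hreach⟩ := exists_path_embedding (reachable_rep B i)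
  have hjr : j ∉ range f := by
    rintro ⟨a, rfl⟩
    exact hij (rep_eq_of_reachable (hreach a))
  refine ⟨l, ⟨Fin.cons j f, Fin.cons_injective_iff.2 ⟨hjr, f.injective⟩⟩, rfl, ?_, ?_, ?_⟩
  · exact hf0
  · exact pathEdges_subset_iff.2 hfB
  have h1 := norm_sub_le_of_path D h0 (pathEdges_subset_iff.2 hfB) (Fin.last l)
  rw [hf0, hfl, Fin.val_last] at h1
  refine ENNReal.ofReal_le_ofReal ?_
  have hr := D.r_pos
  have hw0 := norm_nonneg w
  have hC := D.C_nonneg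
  have hrho := T.rho_nonneg
  set r' := D.r + ‖w‖ with hr'
  set ψ := T.rho / (1 + ‖(y j).1‖) with hψ
  have hψ0 : 0 ≤ ψ := by positivity
  have hl0 : (0 : ℝ) ≤ l := by positivity
  have hA : |T.τ (y j).1 - T.τ (y i).1| ≤ ψ * (1 + r') ^ 3 * (l + 1) ^ 2 := by
    refine (T.abs_sub_le _ _).trans ?_
    calc ψ * ((1 + ‖(y j).1 - (y i).1‖) * ‖(y j).1 - (y i).1‖) ≤ ψ * ((1 + r') * r') := by gcongr
      _ ≤ ψ * ((1 + r') * (1 + r') * (1 + r') * (l + 1) ^ 2) := by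
          have h3 : 0 ≤ r' := by positivity
          have h2 : 1 ≤ ((l : ℝ) + 1) ^ 2 := one_le_pow₀ (by linarith)
          have h4 : (1 + r') * r' ≤ (1 + r') * (1 + r') * (1 + r') := by
            have : r' ≤ (1 + r') * (1 + r') := by nlinarith
            nlinarith
          have h5 : (1 + r') * (1 + r') * (1 + r') * 1 ≤
            (1 + r') * (1 + r') * (1 + r') * ((l : ℝ) + 1) ^ 2 := by gcongr
          exact mul_le_mul_of_nonneg_left (h4.trans (by linarith)) hψ0
      _ = _ := by ring
  have hB' : |T.τ (y i).1 - T.τ (y (rep B i)).1| ≤ ψ * (1 + r') ^ 3 * (l + 1) ^ 2 := by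
    refine (T.abs_sub_le _ _).trans ?_
    have h2 : T.rho / (1 + ‖(y i).1‖) ≤ ψ * (1 + r') :=
      (Cutoff.div_le_div_mul hrho _ _).trans (by gcongr)
    have h3 : D.r ≤ 1 + r' := by linarith
    have h4 : ‖(y i).1 - (y (rep B i)).1‖ ≤ (l + 1) * (1 + r') := by nlinarith
    have h5 : 1 + ‖(y i).1 - (y (rep B i)).1‖ ≤ (l + 1) * (1 + r') := by nlinarith
    calc _ ≤ ψ * (1 + r') * (((l + 1) * (1 + r')) * ((l + 1) * (1 + r'))) := by gcongr
      _ = _ := by ring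
  have hA2 := pow_le_pow_left₀ (abs_nonneg _) hA 2
  have hB2 := pow_le_pow_left₀ (abs_nonneg _) hB' 2
  rw [sq_abs] at hA2 hB2
  calc _ ≤ D.C * ‖w‖ ^ 2 * (3 * ((ψ * (1 + r') ^ 3 * (l + 1) ^ 2) ^ 2 +
        (ψ * (1 + r') ^ 3 * (l + 1) ^ 2) ^ 2)) := by gcongr
    _ = _ := by ring

/-- The sum over the marked paths that control the loss of a pair. -/
def pairMajorant (D : Split S) (T : Cutoff) (w : ℝ × ℝ) (B : Finset (Sym2 (Fin k)))
    (y : Fin k → Particle S) (p : Sym2 (Fin k)) (X : ℝ≥0∞) : ℝ≥0∞ :=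
  ∑' l : ℕ, ∑ f : Fin (l + 2) ↪ Fin k,
    if pathEdges (fun a : Fin (l + 1) => f a.succ) ⊆ B ∧ s(f 0, f 1) = p then
      pairKernel D T w l (y (f 0)) * near (D.r + ‖w‖) (y (f 0)) (y (f 1)) * X else 0

theorem one_orientation_le_majorant {B : Finset (Sym2 (Fin k))} {y : Fin k → Particle S}
    (h0 : bondProd D B y ≠ 0) {i j : Fin k} (hij : rep B i ≠ rep B j)
    (hn : ‖(y j).1 - (y i).1‖ ≤ D.r + ‖w‖) (X : ℝ≥0∞) :
    ENNReal.ofReal (D.C * ‖w‖ ^ 2 * (3 * ((T.τ (y j).1 - T.τ (y i).1) ^ 2 +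
      (T.τ (y i).1 - T.τ (y (rep B i)).1) ^ 2))) * X ≤ pairMajorant D T w B y s(i, j) X := by
  obtain ⟨l, f, hf0, hf1, hB, hle⟩ := one_orientation_le (T := T) h0 hij hn
  have hnear : near (D.r + ‖w‖) (y (f 0)) (y (f 1)) = 1 := by
    rw [hf0, hf1, near, indicator_of_mem (by exact hn), Pi.one_apply]
  have hterm : ENNReal.ofReal (D.C * ‖w‖ ^ 2 * (3 * ((T.τ (y j).1 - T.τ (y i).1) ^ 2 +
      (T.τ (y i).1 - T.τ (y (rep B i)).1) ^ 2))) * X ≤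
      if pathEdges (fun a : Fin (l + 1) => f a.succ) ⊆ B ∧ s(f 0, f 1) = s(i, j) then
      pairKernel D T w l (y (f 0)) * near (D.r + ‖w‖) (y (f 0)) (y (f 1)) * X else 0 := by
    rw [if_pos ⟨hB, by rw [hf0, hf1, Sym2.eq_swap]⟩, hnear, mul_one, hf0]
    gcongr
  refine hterm.trans ?_
  refine le_trans ?_ (ENNReal.le_tsum l)
  exact Finset.single_le_sum (f := fun f : Fin (l + 2) ↪ Fin k =>
    if pathEdges (fun a : Fin (l + 1) => f a.succ) ⊆ B ∧ s(f 0, f 1) = s(i, j) then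
      pairKernel D T w l (y (f 0)) * near (D.r + ‖w‖) (y (f 0)) (y (f 1)) * X else 0)
    (fun _ _ => zero_le) (Finset.mem_univ f)

/-- Particles of one cluster have no relative displacement. Otherwise the relative displacement is
`t = a + c - d`, with `a` the difference of `τ` between `i` and `j` and `c`, `d` those between `j`,
`i` and their representatives. As `t² ≤ 3 (a² + c²) + 3 (a² + d²)`, each orientation of the pair
pays for one path. -/
theorem pairLoss_mul_le {B : Finset (Sym2 (Fin k))} {y : Fin k → Particle S}
    (h0 : bondProd D B y ≠ 0) (p : Sym2 (Fin k)) (X : ℝ≥0∞) :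
    pairLoss D T w B y p * X ≤ 2 * pairMajorant D T w B y p X := by
  set i := (Quot.out p).1 with hi
  set j := (Quot.out p).2 with hj
  have hp : s(i, j) = p := Quot.out_eq p
  set t := T.τ (y (rep B i)).1 - T.τ (y (rep B j)).1 with ht
  have e4 : pairLoss D T w B y p = ENNReal.ofReal (D.C * ‖w‖ ^ 2 * t ^ 2) *
      {x : ℝ × ℝ | ‖x‖ ≤ D.r + ‖w‖}.indicator 1 ((y i).1 - (y j).1) := rfl
  by_cases hn : ‖(y i).1 - (y j).1‖ ≤ D.r + ‖w‖
  swap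
  · rw [e4, indicator_of_notMem (by exact hn), mul_zero, zero_mul]
    exact zero_le
  rw [e4, indicator_of_mem (by exact hn), Pi.one_apply, mul_one]
  by_cases hij : rep B i = rep B j
  · rw [ht, hij, sub_self]
    simp
  have h1 := one_orientation_le_majorant (T := T) (w := w) h0 hij (by rwa [norm_sub_rev]) X
  have h2 := one_orientation_le_majorant (T := T) (w := w) h0 (Ne.symm hij) hn X
  rw [Sym2.eq_swap, hp] at h2
  rw [hp] at h1
  rw [two_mul]
  refine le_trans ?_ (add_le_add h1 h2)
  rw [← add_mul, ← ENNReal.ofReal_add (by have := D.C_nonneg; positivity)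
    (by have := D.C_nonneg; positivity), ← mul_add]
  have hC := D.C_nonneg
  gcongr
  have e : t = (T.τ (y i).1 - T.τ (y j).1) + (T.τ (y j).1 - T.τ (y (rep B j)).1) -
      (T.τ (y i).1 - T.τ (y (rep B i)).1) := by rw [ht]; ring
  rw [e]
  set a := T.τ (y i).1 - T.τ (y j).1 with ha
  have ha' : T.τ (y j).1 - T.τ (y i).1 = -a := by rw [ha]; ring
  rw [ha']
  generalize T.τ (y j).1 - T.τ (y (rep B j)).1 = c
  generalize T.τ (y i).1 - T.τ (y (rep B i)).1 = d
  nlinarith [sq_nonneg (a - c), sq_nonneg (a + d), sq_nonneg (c + d), sq_nonneg a]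

/-- The total loss for a set of bonds. -/
def lossWeight (D : Split S) (T : Cutoff) (w : ℝ × ℝ) (ρ : ℝ) (b : Particle S → ℝ≥0∞)
    (B : Finset (Sym2 (Fin k))) (y : Fin k → Particle S) : ℝ≥0∞ :=
  ({y | Good T ρ B y}ᶜ.indicator (splitWeight D b B) y + splitWeight D b B y *
    ∑ i, jacLoss T w (y i)) + ∑ p ∈ edges k \ B, pairLoss D T w B y p *
      ((∏ i, b (y i)) * (bondProd D B y * softProd D ((edges k \ B).erase p) y))

theorem sum_lossWeight_le (hρ : 0 < ρ) (y : Fin k → Particle S) :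
    ∑ B ∈ (edges k).powerset, lossWeight D T w ρ b B y ≤
      (∑' l : ℕ, ∑ f : Fin (l + 1) ↪ Fin k, pathTerm D b (pathKernel D T w ρ l) f y) +
      2 * ∑' l : ℕ, ∑ f : Fin (l + 2) ↪ Fin k,
        pairTerm D b (D.r + ‖w‖) (pairKernel D T w l) f y := by
  have h1 : ∀ B, {y | Good T ρ B y}ᶜ.indicator (splitWeight D b B) y + splitWeight D b B y *
      ∑ i, jacLoss T w (y i) ≤ ∑' l : ℕ, ∑ f : Fin (l + 1) ↪ Fin k,
        if pathEdges f ⊆ B then pathKernel D T w ρ l (y (f 0)) * splitWeight D b B y else 0 := by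
    intro B
    have ha : {y | Good T ρ B y}ᶜ.indicator (splitWeight D b B) y ≤
        ∑' l : ℕ, ∑ f : Fin (l + 1) ↪ Fin k,
        if pathEdges f ⊆ B then badKernel D T ρ l (y (f 0)) * splitWeight D b B y else 0 := by
      by_cases hg : Good T ρ B y
      · rw [indicator_of_notMem (by rw [mem_compl_iff, not_not]; exact hg)]
        exact zero_le
      · rw [indicator_of_mem (by exact hg)]
        exact splitWeight_le_of_not_good hρ hg
    refine (add_le_add ha splitWeight_mul_jacLoss_le).trans (le_of_eq ?_)
    rw [← ENNReal.tsum_add]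
    refine tsum_congr fun l => ?_
    rw [← Finset.sum_add_distrib]
    refine Finset.sum_congr rfl fun f _ => ?_
    split_ifs <;> simp only [pathKernel, *, if_true, if_false, add_mul, add_zero, zero_mul]
  have h2 : ∀ B, ∑ p ∈ edges k \ B, pairLoss D T w B y p *
      ((∏ i, b (y i)) * (bondProd D B y * softProd D ((edges k \ B).erase p) y)) ≤
      2 * ∑' l : ℕ, ∑ f : Fin (l + 2) ↪ Fin k,
        if pathEdges (fun a : Fin (l + 1) => f a.succ) ⊆ B ∧ s(f 0, f 1) ∉ B then
        pairKernel D T w l (y (f 0)) * near (D.r + ‖w‖) (y (f 0)) (y (f 1)) *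
        ((∏ i, b (y i)) * (bondProd D B y * softProd D ((edges k \ B).erase s(f 0, f 1)) y))
        else 0 := by
    intro B
    by_cases h0 : bondProd D B y = 0
    · simp [h0]
    calc _ ≤ ∑ p ∈ edges k \ B, 2 * pairMajorant D T w B y p
          ((∏ i, b (y i)) * (bondProd D B y * softProd D ((edges k \ B).erase p) y)) :=
          Finset.sum_le_sum fun p _ => pairLoss_mul_le h0 p _
      _ = _ := by
          rw [← Finset.mul_sum]
          simp only [pairMajorant]
          rw [← Summable.tsum_finsetSum fun _ _ => ENNReal.summable]
          congr 1
          refine tsum_congr fun l => ?_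
          rw [Finset.sum_comm]
          refine Finset.sum_congr rfl fun f _ => ?_
          have hmem : s(f 0, f 1) ∈ edges k :=
            mk_mem_edges.2 (f.injective.ne (by simp))
          by_cases hP : pathEdges (fun a : Fin (l + 1) => f a.succ) ⊆ B
          · simp only [hP, true_and]
            rw [Finset.sum_ite_eq]
            simp only [Finset.mem_sdiff, hmem, true_and]
          · simp [hP]
  calc _ ≤ ∑ B ∈ (edges k).powerset, _ := Finset.sum_le_sum fun B _ => add_le_add (h1 B) (h2 B)
    _ = _ := by
        rw [Finset.sum_add_distrib, ← Finset.mul_sum,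
          ← Summable.tsum_finsetSum fun _ _ => ENNReal.summable,
          ← Summable.tsum_finsetSum fun _ _ => ENNReal.summable]
        congr 1
        · refine tsum_congr fun l => ?_
          rw [Finset.sum_comm]
          rfl
        · congr 1
          refine tsum_congr fun l => ?_
          rw [Finset.sum_comm]
          rfl

end Losses

/-! ### Linearity of grand canonical integrals -/

section Grand

variable {P : Type*} [MeasurableSpace P] (ref : Measure P) [SigmaFinite ref] (z : ℝ≥0∞)

theorem grand_mono {F G : ∀ k : ℕ, (Fin k → P) → ℝ≥0∞}
    (h : ∀ k, ∫⁻ y, F k y ∂(Measure.pi fun _ : Fin k => ref) ≤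
      ∫⁻ y, G k y ∂(Measure.pi fun _ : Fin k => ref)) : grand ref z F ≤ grand ref z G :=
  ENNReal.tsum_le_tsum fun k => mul_le_mul_right (h k) _

theorem grand_add {F G : ∀ k : ℕ, (Fin k → P) → ℝ≥0∞} (hF : ∀ k, Measurable (F k)) :
    grand ref z (fun k y => F k y + G k y) = grand ref z F + grand ref z G := by
  unfold grand
  rw [← ENNReal.tsum_add]
  refine tsum_congr fun k => ?_
  rw [lintegral_add_left (hF k), mul_add]

theorem grand_const_mul {F : ∀ k : ℕ, (Fin k → P) → ℝ≥0∞} (hF : ∀ k, Measurable (F k))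
    (c : ℝ≥0∞) : grand ref z (fun k y => c * F k y) = c * grand ref z F := by
  unfold grand
  rw [← ENNReal.tsum_mul_left]
  refine tsum_congr fun k => ?_
  rw [lintegral_const_mul _ (hF k)]
  ring

theorem grand_tsum {F : ℕ → ∀ k : ℕ, (Fin k → P) → ℝ≥0∞} (hF : ∀ l k, Measurable (F l k)) :
    grand ref z (fun k y => ∑' l, F l k y) = ∑' l, grand ref z (F l) := by
  unfold grand
  rw [ENNReal.tsum_comm]
  refine tsum_congr fun k => ?_
  rw [lintegral_tsum fun l => (hF l k).aemeasurable, ENNReal.tsum_mul_left]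

end Grand

/-! ### The midpoint inequality in finite volume -/

section FiniteVolume

variable {S : Type*} [Finite S] [Nonempty S] [MeasurableSpace S] [MeasurableSingletonClass S]
  (D : Split S) (T : Cutoff) (w : ℝ × ℝ) (ρ : ℝ) (b : Particle S → ℝ≥0∞) (z : ℝ≥0∞)

theorem measurable_jacLoss : Measurable (jacLoss (S := S) T w) := by
  have := (T.continuous_fderiv_apply w).measurable
  unfold jacLoss
  fun_prop

theorem measurable_pathKernel (l : ℕ) : Measurable (pathKernel D T w ρ l) := by
  refine Measurable.add ?_ ?_
  · exact (measurable_const.indicator (measurableSet_le measurable_norm measurable_const)).comp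
      measurable_fst
  · split_ifs
    · exact measurable_jacLoss T w
    · exact measurable_const

theorem measurable_pairKernel (l : ℕ) : Measurable (pairKernel D T w l) := by
  unfold pairKernel
  fun_prop

/-- The bound on the total loss. -/
def lossBound : ℝ≥0∞ :=
  (∑' l : ℕ, z ^ (l + 1) * ((∫⁻ y, b y * pathKernel D T w ρ l y ∂(refMeasure S)) * D.eps ^ l)) +
  2 * ∑' l : ℕ, z ^ (l + 2) * ((∫⁻ y, b y * pairKernel D T w l y ∂(refMeasure S)) *
    (volume (Metric.closedBall (0 : ℝ × ℝ) (D.r + ‖w‖)) * D.eps ^ l))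

variable {D T w ρ b}

/-- A cluster that moves has its representative within `T.N`, and goodness keeps its particles
within `T.N + ρ`. So wherever a particle moves, the boundary weight is one before and after. -/
theorem prod_weight_move {k : ℕ} {B : Finset (Sym2 (Fin k))} {y : Fin k → Particle S}
    (hfar : ∀ y : Particle S, ‖y.1‖ ≤ T.N + ρ + ‖w‖ → b y = 1) (hgood : Good T ρ B y) :
    ∏ i, b (move T w B y i) = ∏ i, b (y i) := by
  refine Finset.prod_congr rfl fun i _ => ?_
  by_cases ht : T.τ (y (rep B i)).1 = 0
  · rw [move, ht, zero_smul, add_zero]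
  have hN : ‖(y (rep B i)).1‖ ≤ T.N := by
    by_contra hcon
    exact ht (T.eq_zero _ (not_le.1 hcon).le)
  have h1 := hgood (rep B i) i (reachable_rep B i).symm hN
  have h2 : ‖(y i).1‖ ≤ T.N + ρ := by
    have := norm_sub_norm_le (y i).1 (y (rep B i)).1
    rw [norm_sub_rev] at this
    linarith
  have h3 : ‖T.τ (y (rep B i)).1 • w‖ ≤ ‖w‖ := by
    rw [norm_smul, Real.norm_eq_abs, abs_of_nonneg (T.nonneg _)]
    exact mul_le_of_le_one_left (norm_nonneg _) (T.le_one _)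
  rw [hfar (y i) (by linarith [norm_nonneg w]), hfar]
  refine (norm_add_le _ _).trans ?_
  linarith

/-- Tuples with a large cluster are charged to the loss entirely; for the others the boundary and
bond weights are invariant, and the soft product is handled by `softProd_le_of_move`. -/
theorem indicator_splitWeight_le (hw : T.rho * ‖w‖ < 1)
    (hfar : ∀ y : Particle S, ‖y.1‖ ≤ T.N + ρ + ‖w‖ → b y = 1)
    {k : ℕ} {A A₁ A₂ : Set (Fin k → Particle S)} {B : Finset (Sym2 (Fin k))}
    (h₁ : ∀ y ∈ A, Good T ρ B y → move T w B y ∈ A₁)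
    (h₂ : ∀ y ∈ A, Good T ρ B y → move T (-w) B y ∈ A₂) (y : Fin k → Particle S) :
    A.indicator (splitWeight D b B) y ≤
      2⁻¹ * (moveJac T w B y * A₁.indicator (splitWeight D b B) (move T w B y)) +
      2⁻¹ * (moveJac T (-w) B y * A₂.indicator (splitWeight D b B) (move T (-w) B y)) +
      lossWeight D T w ρ b B y := by
  by_cases hA : y ∈ A
  swap
  · rw [indicator_of_notMem hA]; exact zero_le
  rw [indicator_of_mem hA]
  by_cases hg : Good T ρ B y
  swap
  · refine le_trans ?_ le_add_self
    rw [lossWeight, add_assoc, indicator_of_mem (by exact hg)]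
    exact le_self_add
  rw [indicator_of_mem (h₁ y hA hg), indicator_of_mem (h₂ y hA hg)]
  have hb1 := prod_weight_move (w := w) hfar hg
  have hb2 := prod_weight_move (w := -w) (by rwa [norm_neg]) hg
  simp only [splitWeight, lossWeight, hb1, hb2, bondProd_move]
  have h := softProd_le_of_move D T w hw B y
  refine (mul_le_mul_right (mul_le_mul_right h (bondProd D B y)) (∏ i, b (y i))).trans ?_
  simp only [mul_add, Finset.mul_sum]
  have e : ∀ p, (∏ i, b (y i)) * (bondProd D B y *
      (pairLoss D T w B y p * softProd D ((edges k \ B).erase p) y)) =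
      pairLoss D T w B y p * ((∏ i, b (y i)) * (bondProd D B y *
        softProd D ((edges k \ B).erase p) y)) := fun p => by ring
  simp only [e]
  have e2 : ∀ i, (∏ i, b (y i)) * (bondProd D B y *
      (softProd D (edges k \ B) y * jacLoss T w (y i))) =
      (∏ i, b (y i)) * (bondProd D B y * softProd D (edges k \ B) y) * jacLoss T w (y i) :=
    fun i => by ring
  simp only [e2]
  have e3 : ∀ J s : ℝ≥0∞, (∏ i, b (y i)) * (bondProd D B y * (2⁻¹ * (J * s))) =
      2⁻¹ * (J * ((∏ i, b (y i)) * (bondProd D B y * s))) := fun J s => by ring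
  simp only [e3]
  rw [add_assoc, add_comm (∑ p ∈ _, _)]
  gcongr
  exact le_add_self

/-- The change of variables is undone for each `B` separately. As `A₁` and `A₂` do not depend on
`B`, the sum over `B` then restores the full weight on them, although the move itself depends on
`B`. -/
theorem lintegral_indicator_le (hw : T.rho * ‖w‖ < 1) (hρ : 0 < ρ) (hb : Measurable b)
    (hfar : ∀ y : Particle S, ‖y.1‖ ≤ T.N + ρ + ‖w‖ → b y = 1)
    {k : ℕ} {A A₁ A₂ : Set (Fin k → Particle S)} (hA₁ : MeasurableSet A₁) (hA₂ : MeasurableSet A₂)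
    (h₁ : ∀ B, ∀ y ∈ A, Good T ρ B y → move T w B y ∈ A₁)
    (h₂ : ∀ B, ∀ y ∈ A, Good T ρ B y → move T (-w) B y ∈ A₂) :
    ∫⁻ y, A.indicator (tupleWeight b D.full) y ∂(Measure.pi fun _ : Fin k => refMeasure S) ≤
      ∫⁻ y, (2⁻¹ * A₁.indicator (tupleWeight b D.full) y +
        2⁻¹ * A₂.indicator (tupleWeight b D.full) y) +
        ((∑' l : ℕ, ∑ f : Fin (l + 1) ↪ Fin k, pathTerm D b (pathKernel D T w ρ l) f y) +
        2 * ∑' l : ℕ, ∑ f : Fin (l + 2) ↪ Fin k,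
          pairTerm D b (D.r + ‖w‖) (pairKernel D T w l) f y)
        ∂(Measure.pi fun _ : Fin k => refMeasure S) := by
  have hw' : T.rho * ‖-w‖ < 1 := by rwa [norm_neg]
  have hsum : ∀ (A : Set (Fin k → Particle S)) y, A.indicator (tupleWeight b D.full) y =
      ∑ B ∈ (edges k).powerset, A.indicator (splitWeight D b B) y := by
    intro A y
    by_cases hy : y ∈ A
    · simp only [indicator_of_mem hy, tupleWeight_eq_sum_splitWeight]
    · simp only [indicator_of_notMem hy, Finset.sum_const_zero]
  have hsm := measurable_splitWeight (k := k) D b hb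
  have hm : ∀ (A : Set (Fin k → Particle S)), MeasurableSet A → ∀ (w : ℝ × ℝ) B,
      Measurable fun y => moveJac T w B y * A.indicator (splitWeight D b B) (move T w B y) :=
    fun A hA w B => (measurable_moveJac T w B).mul
      (((hsm B).indicator hA).comp (measurable_move T w B))
  have hint : ∀ (A : Set (Fin k → Particle S)), MeasurableSet A → ∀ w : ℝ × ℝ,
      T.rho * ‖w‖ < 1 →
      ∑ B ∈ (edges k).powerset, ∫⁻ y, moveJac T w B y *
        A.indicator (splitWeight D b B) (move T w B y)
        ∂(Measure.pi fun _ : Fin k => refMeasure S) =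
      ∫⁻ y, A.indicator (tupleWeight b D.full) y
        ∂(Measure.pi fun _ : Fin k => refMeasure S) := by
    intro A hA w hw
    simp only [hsum]
    rw [lintegral_finsetSum _ fun B _ => (hsm B).indicator hA]
    exact Finset.sum_congr rfl fun B _ => lintegral_moveJac_mul T hw B ((hsm B).indicator hA)
  have htm : Measurable (tupleWeight (k := k) b D.full) :=
    measurable_tupleWeight hb D.measurable_full
  calc _ ≤ ∫⁻ y, ((∑ B ∈ (edges k).powerset,
          2⁻¹ * (moveJac T w B y * A₁.indicator (splitWeight D b B) (move T w B y))) +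
          (∑ B ∈ (edges k).powerset,
          2⁻¹ * (moveJac T (-w) B y * A₂.indicator (splitWeight D b B) (move T (-w) B y)))) +
          ∑ B ∈ (edges k).powerset, lossWeight D T w ρ b B y
          ∂(Measure.pi fun _ : Fin k => refMeasure S) := by
        refine lintegral_mono fun y => ?_
        rw [hsum, ← Finset.sum_add_distrib, ← Finset.sum_add_distrib]
        exact Finset.sum_le_sum fun B _ => indicator_splitWeight_le hw hfar (h₁ B) (h₂ B) y
    _ = (2⁻¹ * ∫⁻ y, A₁.indicator (tupleWeight b D.full) y
          ∂(Measure.pi fun _ : Fin k => refMeasure S)) +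
        (2⁻¹ * ∫⁻ y, A₂.indicator (tupleWeight b D.full) y
          ∂(Measure.pi fun _ : Fin k => refMeasure S)) +
        ∫⁻ y, ∑ B ∈ (edges k).powerset, lossWeight D T w ρ b B y
          ∂(Measure.pi fun _ : Fin k => refMeasure S) := by
        rw [lintegral_add_left, lintegral_add_left, lintegral_finsetSum, lintegral_finsetSum]
        · simp only [lintegral_const_mul _ (hm A₁ hA₁ w _),
            lintegral_const_mul _ (hm A₂ hA₂ (-w) _), ← Finset.mul_sum]
          rw [hint A₁ hA₁ w hw, hint A₂ hA₂ (-w) hw']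
        · exact fun B _ => (hm A₂ hA₂ (-w) B).const_mul _
        · exact fun B _ => (hm A₁ hA₁ w B).const_mul _
        · exact Finset.measurable_sum _ fun B _ => (hm A₁ hA₁ w B).const_mul _
        · exact (Finset.measurable_sum _ fun B _ => (hm A₁ hA₁ w B).const_mul _).add
            (Finset.measurable_sum _ fun B _ => (hm A₂ hA₂ (-w) B).const_mul _)
    _ ≤ _ := by
        rw [lintegral_add_left, lintegral_add_left, lintegral_const_mul _ (htm.indicator hA₁),
          lintegral_const_mul _ (htm.indicator hA₂)]
        · gcongr with y
          exact sum_lossWeight_le hρ y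
        · exact (htm.indicator hA₁).const_mul _
        · exact ((htm.indicator hA₁).const_mul _).add ((htm.indicator hA₂).const_mul _)

theorem grand_indicator_le (hw : T.rho * ‖w‖ < 1) (hρ : 0 < ρ) (hb : Measurable b)
    (hb1 : ∀ y, b y ≤ 1) (hfar : ∀ y : Particle S, ‖y.1‖ ≤ T.N + ρ + ‖w‖ → b y = 1)
    {A A₁ A₂ : ∀ k : ℕ, Set (Fin k → Particle S)} (hA₁ : ∀ k, MeasurableSet (A₁ k))
    (hA₂ : ∀ k, MeasurableSet (A₂ k))
    (h₁ : ∀ k B, ∀ y ∈ A k, Good T ρ B y → move T w B y ∈ A₁ k)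
    (h₂ : ∀ k B, ∀ y ∈ A k, Good T ρ B y → move T (-w) B y ∈ A₂ k) :
    grand (refMeasure S) z (fun k y => (A k).indicator (tupleWeight b D.full) y) ≤
      2⁻¹ * grand (refMeasure S) z (fun k y => (A₁ k).indicator (tupleWeight b D.full) y) +
      2⁻¹ * grand (refMeasure S) z (fun k y => (A₂ k).indicator (tupleWeight b D.full) y) +
      lossBound D T w ρ b z * grand (refMeasure S) z (fun _ y => tupleWeight b D.full y) := by
  have htm : ∀ k, Measurable (tupleWeight (k := k) b D.full) := fun k =>
    measurable_tupleWeight hb D.measurable_full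
  have hm₁ : ∀ l k, Measurable fun y : Fin k → Particle S => ∑ f : Fin (l + 1) ↪ Fin k,
      pathTerm D b (pathKernel D T w ρ l) f y := fun l k =>
    Finset.measurable_sum _ fun f _ =>
      measurable_pathTerm D hb (measurable_pathKernel D T w ρ l) f
  have hm₂ : ∀ l k, Measurable fun y : Fin k → Particle S => ∑ f : Fin (l + 2) ↪ Fin k,
      pairTerm D b (D.r + ‖w‖) (pairKernel D T w l) f y := fun l k =>
    Finset.measurable_sum _ fun f _ => measurable_pairTerm D hb (measurable_pairKernel D T w l) f
  refine (grand_mono (refMeasure S) z fun k =>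
    lintegral_indicator_le hw hρ hb hfar (hA₁ k) (hA₂ k) (h₁ k) (h₂ k)).trans ?_
  rw [grand_add, grand_add, grand_const_mul, grand_const_mul, grand_add, grand_const_mul,
    grand_tsum, grand_tsum]
  · gcongr
    rw [lossBound, add_mul, mul_assoc, ← ENNReal.tsum_mul_right, ← ENNReal.tsum_mul_right]
    gcongr with l l
    · exact grand_pathTerm_le D hb hb1 z (measurable_pathKernel D T w ρ l)
    · exact grand_pairTerm_le D hb hb1 z (measurable_pairKernel D T w l)
  · exact hm₂
  · exact hm₁
  · exact fun k => Measurable.tsum fun l => hm₂ l k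
  · exact fun k => Measurable.tsum fun l => hm₁ l k
  · exact fun k => (htm k).indicator (hA₂ k)
  · exact fun k => (htm k).indicator (hA₁ k)
  · exact fun k => ((htm k).indicator (hA₁ k)).const_mul _
  · exact fun k => (((htm k).indicator (hA₁ k)).const_mul _).add
      (((htm k).indicator (hA₂ k)).const_mul _)

end FiniteVolume

/-! ### Quantitative bounds for the loss -/

theorem volume_closedBall_prod (R : ℝ) :
    volume (Metric.closedBall (0 : ℝ × ℝ) R) = ENNReal.ofReal (2 * R) ^ 2 := by
  have : Metric.closedBall (0 : ℝ × ℝ) R = Metric.closedBall (0 : ℝ) R ×ˢ Metric.closedBall 0 R :=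
    (closedBall_prod_same 0 0 R).symm
  rw [this, Measure.volume_eq_prod, Measure.prod_prod, Real.volume_closedBall, sq]

/-- The logarithmic growth of the integral of `(1 + ‖x‖)⁻²` over balls. -/
theorem lintegral_inv_one_add_norm_sq_le (J : ℕ) :
    ∫⁻ x in Metric.closedBall (0 : ℝ × ℝ) (2 ^ J), ENNReal.ofReal ((1 / (1 + ‖x‖)) ^ 2) ≤
      ENNReal.ofReal (16 * (J + 1)) := by
  have hvol : ∀ (s : Set (ℝ × ℝ)) (R c : ℝ), MeasurableSet s → 0 ≤ R → 0 ≤ c →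
      s ⊆ Metric.closedBall 0 R → (∀ x ∈ s, 1 / (1 + ‖x‖) ≤ c) →
      ∫⁻ x in s, ENNReal.ofReal ((1 / (1 + ‖x‖)) ^ 2) ≤ ENNReal.ofReal (c ^ 2 * (2 * R) ^ 2) := by
    intro s R c hs hR hc hsub hle
    calc ∫⁻ x in s, ENNReal.ofReal ((1 / (1 + ‖x‖)) ^ 2)
        ≤ ∫⁻ x in s, ENNReal.ofReal (c ^ 2) := by
          refine setLIntegral_mono measurable_const fun x hx => ENNReal.ofReal_le_ofReal ?_
          have := hle x hx
          gcongr
      _ = ENNReal.ofReal (c ^ 2) * volume s := setLIntegral_const _ _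
      _ ≤ ENNReal.ofReal (c ^ 2) * volume (Metric.closedBall (0 : ℝ × ℝ) R) := by gcongr
      _ = _ := by
          rw [volume_closedBall_prod, ← ENNReal.ofReal_pow (by positivity),
            ← ENNReal.ofReal_mul (by positivity)]
  induction J with
  | zero =>
    refine (hvol _ 1 1 measurableSet_closedBall zero_le_one zero_le_one (by simp) ?_).trans ?_
    · intro x _
      rw [div_le_one (by positivity)]
      linarith [norm_nonneg x]
    · exact ENNReal.ofReal_le_ofReal (by norm_num)
  | succ J ih =>
    have hsub : Metric.closedBall (0 : ℝ × ℝ) (2 ^ (J + 1)) ⊆ Metric.closedBall 0 (2 ^ J) ∪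
        (Metric.closedBall 0 (2 ^ (J + 1)) \ Metric.closedBall 0 (2 ^ J)) := by
      rw [union_sdiff_self]; exact subset_union_right
    refine (lintegral_mono_set hsub).trans ((lintegral_union_le _ _ _).trans ?_)
    -- Each dyadic shell contributes at most `2^(-2J) * (2 * 2^(J+1))² = 16`.
    have h2 := hvol (Metric.closedBall (0 : ℝ × ℝ) (2 ^ (J + 1)) \ Metric.closedBall 0 (2 ^ J))
      (2 ^ (J + 1)) (1 / 2 ^ J) (measurableSet_closedBall.diff measurableSet_closedBall)
      (by positivity) (by positivity) sdiff_subset (by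
        rintro x ⟨_, hx⟩
        rw [mem_closedBall_zero_iff, not_le] at hx
        gcongr
        linarith)
    refine (add_le_add ih h2).trans ?_
    rw [← ENNReal.ofReal_add (by positivity) (by positivity)]
    refine ENNReal.ofReal_le_ofReal (le_of_eq ?_)
    push_cast
    field_simp
    ring

/-- The series `∑ (l + 1)⁵ / 2ˡ`. -/
def weightSeries : ℝ≥0∞ := ∑' l : ℕ, ENNReal.ofReal ((l + 1) ^ 5) * 2⁻¹ ^ l

theorem weightSeries_ne_top : weightSeries ≠ ⊤ := by
  have h := summable_pow_mul_geometric_of_norm_lt_one 5 (r := (2⁻¹ : ℝ)) (by norm_num)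
  have h1 : Summable fun l : ℕ => ((l + 1 : ℕ) : ℝ) ^ 5 * (2⁻¹ : ℝ) ^ (l + 1) :=
    (summable_nat_add_iff (f := fun l : ℕ => (l : ℝ) ^ 5 * (2⁻¹ : ℝ) ^ l) 1).2 h
  have h2 := (h1.mul_left 2).tsum_ofReal_ne_top
  convert h2 using 1
  rw [weightSeries]
  refine tsum_congr fun l => ?_
  have h3 : (2 : ℝ≥0∞)⁻¹ = ENNReal.ofReal 2⁻¹ := by
    rw [ENNReal.ofReal_inv_of_pos two_pos]; norm_num
  rw [h3, ← ENNReal.ofReal_pow (by norm_num), ← ENNReal.ofReal_mul (by positivity)]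
  congr 1
  push_cast
  ring

/-- The factor `(z * e)^l ≤ 2^(-l)` absorbs the polynomial growth; the exponent 5 covers both
`badKernel` (power 5) and `pairKernel` (power 4). -/
theorem tsum_geometric_weight_le {z e c : ℝ≥0∞} (hze : z * e ≤ 2⁻¹) {I : ℕ → ℝ≥0∞}
    (hI : ∀ l : ℕ, I l ≤ ENNReal.ofReal ((l + 1) ^ 5) * c) (n : ℕ) :
    ∑' l : ℕ, z ^ (l + n) * (I l * e ^ l) ≤ z ^ n * weightSeries * c := by
  rw [weightSeries, ← ENNReal.tsum_mul_left, ← ENNReal.tsum_mul_right]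
  refine ENNReal.tsum_le_tsum fun l => ?_
  calc z ^ (l + n) * (I l * e ^ l) = z ^ n * I l * (z * e) ^ l := by rw [mul_pow]; ring
    _ ≤ z ^ n * (ENNReal.ofReal ((l + 1) ^ 5) * c) * 2⁻¹ ^ l := by
      gcongr
      exact hI l
    _ = _ := by ring

section LossBound

variable {S : Type*} [Finite S] [Nonempty S] [MeasurableSpace S] [MeasurableSingletonClass S]
  {D : Split S} {T : Cutoff} {w : ℝ × ℝ} {ρ : ℝ} {b : Particle S → ℝ≥0∞} {z : ℝ≥0∞}

theorem lintegral_mul_indicator_le (hb1 : ∀ y, b y ≤ 1) {L : ℝ}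
    (hbL : ∀ y, L < ‖y.1‖ → b y = 0) {F : Particle S → ℝ≥0∞} {G : ℝ × ℝ → ℝ≥0∞}
    (hG : Measurable G) (hFG : ∀ y, F y ≤ G y.1) :
    ∫⁻ y, b y * F y ∂(refMeasure S) ≤ ∫⁻ x in Metric.closedBall (0 : ℝ × ℝ) L, G x := by
  rw [← lintegral_indicator measurableSet_closedBall,
    ← lintegral_refMeasure_fst (S := S) (hG.indicator measurableSet_closedBall)]
  refine lintegral_mono fun y => ?_
  by_cases hy : ‖y.1‖ ≤ L
  · simp only
    rw [indicator_of_mem (by simpa using hy)]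
    exact (mul_le_of_le_one_left' (hb1 y)).trans (hFG y)
  · simp [hbL y (not_le.1 hy)]

/-- The first summand comes from large clusters. Everything else is proportional to the integral of
`(rho / (1 + ‖x‖))²`, which controls the Dirichlet integral of the cutoff. -/
theorem lossBound_le (hz : z * D.eps ≤ 2⁻¹) (hρ : 0 < ρ) (hb1 : ∀ y, b y ≤ 1)
    (hbm : Measurable b) {L : ℝ} (hbL : ∀ y, L < ‖y.1‖ → b y = 0) :
    lossBound D T w ρ b z ≤ z * weightSeries * (ENNReal.ofReal ((D.r / ρ) ^ 5) *
        volume (Metric.closedBall (0 : ℝ × ℝ) T.N)) +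
      (z * weightSeries * ENNReal.ofReal (‖w‖ ^ 2) +
        2 * (z ^ 2 * weightSeries * (ENNReal.ofReal (6 * D.C * ‖w‖ ^ 2 * (1 + (D.r + ‖w‖)) ^ 6) *
          volume (Metric.closedBall (0 : ℝ × ℝ) (D.r + ‖w‖))))) *
      ∫⁻ x in Metric.closedBall (0 : ℝ × ℝ) L, ENNReal.ofReal ((T.rho / (1 + ‖x‖)) ^ 2) := by
  have hr := D.r_pos
  have hC := D.C_nonneg
  set J := ∫⁻ x in Metric.closedBall (0 : ℝ × ℝ) L, ENNReal.ofReal ((T.rho / (1 + ‖x‖)) ^ 2)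
    with hJ
  have hGm : Measurable fun x : ℝ × ℝ => ENNReal.ofReal ((T.rho / (1 + ‖x‖)) ^ 2) := by fun_prop
  have hpow : ∀ l : ℕ, (1 : ℝ) ≤ ((l : ℝ) + 1) ^ 5 := fun l =>
    one_le_pow₀ (by linarith [(Nat.cast_nonneg l : (0 : ℝ) ≤ l)])
  have hbad : ∀ l, ∫⁻ y, b y * badKernel D T ρ l y ∂(refMeasure S) ≤
      ENNReal.ofReal ((l + 1) ^ 5) * (ENNReal.ofReal ((D.r / ρ) ^ 5) *
        volume (Metric.closedBall (0 : ℝ × ℝ) T.N)) := by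
    intro l
    calc ∫⁻ y, b y * badKernel D T ρ l y ∂(refMeasure S)
        ≤ ∫⁻ y, badKernel D T ρ l y ∂(refMeasure S) :=
          lintegral_mono fun y => mul_le_of_le_one_left' (hb1 y)
      _ = ∫⁻ x, (Metric.closedBall (0 : ℝ × ℝ) T.N).indicator
            (fun _ => ENNReal.ofReal ((l * D.r / ρ) ^ 5)) x := by
          rw [← lintegral_refMeasure_fst (S := S)
            (measurable_const.indicator measurableSet_closedBall)]
          refine lintegral_congr fun y => ?_
          rw [badKernel]
          congr 1
          ext x
          simp
      _ = ENNReal.ofReal ((l * D.r / ρ) ^ 5) * volume (Metric.closedBall (0 : ℝ × ℝ) T.N) :=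
          lintegral_indicator_const measurableSet_closedBall _
      _ ≤ _ := by
          rw [← mul_assoc, ← ENNReal.ofReal_mul (by positivity)]
          gcongr
          rw [← mul_pow, mul_div_assoc]
          gcongr
          linarith
  have hjac : ∀ l : ℕ, ∫⁻ y, b y * (if l = 0 then jacLoss T w y else 0) ∂(refMeasure S) ≤
      ENNReal.ofReal ((l + 1) ^ 5) * (ENNReal.ofReal (‖w‖ ^ 2) * J) := by
    intro l
    refine (lintegral_mul_indicator_le hb1 hbL (hGm.const_mul (ENNReal.ofReal (‖w‖ ^ 2)))
      fun y => ?_).trans ?_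
    · split_ifs
      · rw [jacLoss, ← ENNReal.ofReal_mul (by positivity)]
        refine ENNReal.ofReal_le_ofReal ?_
        have := T.abs_fderiv_apply_le y.1 w
        rw [← sq_abs, mul_comm, ← mul_pow]
        gcongr
      · exact zero_le
    · rw [lintegral_const_mul _ hGm]
      exact le_mul_of_one_le_left' (by rw [ENNReal.one_le_ofReal]; exact hpow l)
  have hpair : ∀ l : ℕ, (∫⁻ y, b y * pairKernel D T w l y ∂(refMeasure S)) *
        volume (Metric.closedBall (0 : ℝ × ℝ) (D.r + ‖w‖)) ≤
      ENNReal.ofReal ((l + 1) ^ 5) *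
        (ENNReal.ofReal (6 * D.C * ‖w‖ ^ 2 * (1 + (D.r + ‖w‖)) ^ 6) *
          volume (Metric.closedBall (0 : ℝ × ℝ) (D.r + ‖w‖)) * J) := by
    intro l
    have : ∫⁻ y, b y * pairKernel D T w l y ∂(refMeasure S) ≤
        ENNReal.ofReal ((l + 1) ^ 5) *
          (ENNReal.ofReal (6 * D.C * ‖w‖ ^ 2 * (1 + (D.r + ‖w‖)) ^ 6) * J) := by
      refine (lintegral_mul_indicator_le hb1 hbL (hGm.const_mul
        (ENNReal.ofReal ((l + 1) ^ 5) *
          ENNReal.ofReal (6 * D.C * ‖w‖ ^ 2 * (1 + (D.r + ‖w‖)) ^ 6))) fun y => ?_).trans ?_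
      · rw [pairKernel, ← ENNReal.ofReal_mul (by positivity), ← ENNReal.ofReal_mul (by positivity)]
        refine ENNReal.ofReal_le_ofReal ?_
        rw [mul_comm (((l : ℝ) + 1) ^ 5)]
        gcongr
        · linarith [(Nat.cast_nonneg l : (0 : ℝ) ≤ l)]
        · norm_num
      · rw [lintegral_const_mul _ hGm, mul_assoc]
    calc _ ≤ ENNReal.ofReal ((l + 1) ^ 5) *
          (ENNReal.ofReal (6 * D.C * ‖w‖ ^ 2 * (1 + (D.r + ‖w‖)) ^ 6) * J) *
            volume (Metric.closedBall (0 : ℝ × ℝ) (D.r + ‖w‖)) := by gcongr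
      _ = _ := by ring
  have h1 : ∀ l, ∫⁻ y, b y * pathKernel D T w ρ l y ∂(refMeasure S) ≤
      ENNReal.ofReal ((l + 1) ^ 5) * (ENNReal.ofReal ((D.r / ρ) ^ 5) *
        volume (Metric.closedBall (0 : ℝ × ℝ) T.N) + ENNReal.ofReal (‖w‖ ^ 2) * J) := by
    intro l
    have hm : Measurable (badKernel (S := S) D T ρ l) :=
      (measurable_const.indicator (measurableSet_le measurable_norm measurable_const)).comp
        measurable_fst
    simp only [pathKernel, mul_add]
    rw [lintegral_add_left (f := fun y => b y * badKernel D T ρ l y) (hbm.mul hm)]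
    exact add_le_add (hbad l) (hjac l)
  rw [lossBound]
  have h2 : ∑' l : ℕ, z ^ (l + 2) * ((∫⁻ y, b y * pairKernel D T w l y ∂(refMeasure S)) *
      (volume (Metric.closedBall (0 : ℝ × ℝ) (D.r + ‖w‖)) * D.eps ^ l)) ≤
      z ^ 2 * weightSeries * (ENNReal.ofReal (6 * D.C * ‖w‖ ^ 2 * (1 + (D.r + ‖w‖)) ^ 6) *
          volume (Metric.closedBall (0 : ℝ × ℝ) (D.r + ‖w‖)) * J) := by
    simp only [← mul_assoc (lintegral _ _)]
    exact tsum_geometric_weight_le hz hpair 2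
  refine (add_le_add (tsum_geometric_weight_le hz h1 1) (mul_le_mul_right h2 2)).trans
    (le_of_eq ?_)
  ring

variable (D) in
/-- The total loss can be made arbitrarily small. -/
theorem exists_lossBound_le (hz : z * D.eps ≤ 2⁻¹) (hztop : z ≠ ⊤) (w : ℝ × ℝ) (M : ℝ)
    {ε : ℝ≥0∞} (hε : ε ≠ 0) :
    ∃ (T : Cutoff) (ρ L : ℝ), 0 < ρ ∧ T.rho * ‖w‖ < 1 ∧ M + ρ ≤ T.R ∧ M ≤ T.N ∧
      T.N + ρ + ‖w‖ + M ≤ L ∧ ∀ b : Particle S → ℝ≥0∞, Measurable b → (∀ y, b y ≤ 1) →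
        (∀ y, L < ‖y.1‖ → b y = 0) → lossBound D T w ρ b z ≤ ε := by
  obtain ⟨K, hK, hcut⟩ := exists_cutoff
  have hr := D.r_pos
  set c₁ := z * weightSeries with hc₁
  set c₂ := z * weightSeries * ENNReal.ofReal (‖w‖ ^ 2) +
        2 * (z ^ 2 * weightSeries * (ENNReal.ofReal (6 * D.C * ‖w‖ ^ 2 * (1 + (D.r + ‖w‖)) ^ 6) *
          volume (Metric.closedBall (0 : ℝ × ℝ) (D.r + ‖w‖)))) with hc₂
  have hc₁t : c₁ ≠ ⊤ := ENNReal.mul_ne_top hztop weightSeries_ne_top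
  have hc₂t : c₂ ≠ ⊤ := by
    refine ENNReal.add_ne_top.2 ⟨ENNReal.mul_ne_top hc₁t ENNReal.ofReal_ne_top,
      ENNReal.mul_ne_top ENNReal.ofNat_ne_top (ENNReal.mul_ne_top (ENNReal.mul_ne_top
        (ENNReal.pow_ne_top hztop) weightSeries_ne_top) (ENNReal.mul_ne_top
          ENNReal.ofReal_ne_top measure_closedBall_lt_top.ne))⟩
  have htwo : Tendsto (fun m : ℕ => (2 : ℝ) ^ m) atTop atTop :=
    tendsto_pow_atTop_atTop_of_one_lt one_lt_two
  -- With `ρ = 2^m / 4` and `T.N = 4^m`, the large clusters give `(4r / 2^m)^5 * (2 * 4^m)² = 4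
  -- (4r)^5 / 2^m`. The other term is `(K/m)²` times the logarithmic integral up to radius
  -- `4^(m+1)`, at most `16 (2m + 3) ≤ 80 m`.
  have hlim : Tendsto (fun m : ℕ => c₁ * ENNReal.ofReal (4 * (4 * D.r) ^ 5 / 2 ^ m) +
      c₂ * ENNReal.ofReal (80 * K ^ 2 / m)) atTop (𝓝 0) := by
    have t1 : Tendsto (fun m : ℕ => ENNReal.ofReal (4 * (4 * D.r) ^ 5 / 2 ^ m)) atTop (𝓝 0) := by
      have := ENNReal.tendsto_ofReal (tendsto_const_nhds (x := 4 * (4 * D.r) ^ 5).div_atTop htwo)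
      simpa using this
    have t2 : Tendsto (fun m : ℕ => ENNReal.ofReal (80 * K ^ 2 / m)) atTop (𝓝 0) := by
      have := ENNReal.tendsto_ofReal (tendsto_const_div_atTop_nhds_zero_nat (80 * K ^ 2))
      simpa using this
    have := (ENNReal.Tendsto.const_mul t1 (Or.inr hc₁t)).add
      (ENNReal.Tendsto.const_mul t2 (Or.inr hc₂t))
    simpa using this
  have hrho : ∀ᶠ m : ℕ in atTop, K / m * ‖w‖ < 1 := by
    have := (tendsto_const_div_atTop_nhds_zero_nat K).mul_const ‖w‖
    rw [zero_mul] at this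
    exact this.eventually (gt_mem_nhds one_pos)
  obtain ⟨m, hm1, hm2, hm3, hm4⟩ := ((hlim.eventually (gt_mem_nhds (pos_iff_ne_zero.2 hε))).and
    (hrho.and ((htwo.eventually_ge_atTop (4 * (|M| + ‖w‖))).and (eventually_ge_atTop 1)))).exists
  obtain ⟨T, hTrho, hTR, hTN⟩ := hcut m hm4
  have h2 : (1 : ℝ) ≤ 2 ^ m := one_le_pow₀ one_le_two
  have h4 : (4 : ℝ) ^ m = 2 ^ m * 2 ^ m := by rw [← mul_pow]; norm_num
  have h24 : (2 : ℝ) ^ m ≤ 4 ^ m := by rw [h4]; nlinarith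
  have hM := le_abs_self M
  have hw0 := norm_nonneg w
  refine ⟨T, 2 ^ m / 4, 4 ^ (m + 1), by positivity, by rwa [hTrho], by rw [hTR]; linarith,
    by rw [hTN]; linarith [abs_nonneg M], by rw [hTN, pow_succ]; linarith [abs_nonneg M],
    fun b hbm hb1 hbL => ?_⟩
  refine (lossBound_le hz (by positivity) hb1 hbm hbL).trans (le_trans ?_ hm1.le)
  rw [← hc₂, ← hc₁]
  gcongr
  · rw [volume_closedBall_prod, ← ENNReal.ofReal_pow (by rw [hTN]; positivity),
      ← ENNReal.ofReal_mul (by positivity), hTN, h4]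
    refine ENNReal.ofReal_le_ofReal (le_of_eq ?_)
    field_simp
    ring
  · have hmpos : (0 : ℝ) < m := by exact_mod_cast hm4
    have e1 : (4 : ℝ) ^ (m + 1) = 2 ^ (2 * m + 2) := by
      rw [show 2 * m + 2 = 2 * (m + 1) by ring, pow_mul]; norm_num
    calc _ = ∫⁻ x in Metric.closedBall (0 : ℝ × ℝ) (2 ^ (2 * m + 2)), ENNReal.ofReal ((K / m) ^ 2) *
          ENNReal.ofReal ((1 / (1 + ‖x‖)) ^ 2) := by
          rw [e1, hTrho]
          refine lintegral_congr fun x => ?_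
          rw [← ENNReal.ofReal_mul (by positivity), ← mul_pow, mul_one_div]
      _ ≤ ENNReal.ofReal ((K / m) ^ 2) * ENNReal.ofReal (16 * ((2 * m + 2 : ℕ) + 1)) := by
          rw [lintegral_const_mul _ (by fun_prop)]
          gcongr
          exact lintegral_inv_one_add_norm_sq_le _
      _ ≤ _ := by
          rw [← ENNReal.ofReal_mul (by positivity)]
          refine ENNReal.ofReal_le_ofReal ?_
          have hm1' : (1 : ℝ) ≤ m := by exact_mod_cast hm4
          have : (16 * (((2 * m + 2 : ℕ) : ℝ) + 1)) ≤ 80 * m := by push_cast; linarith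
          calc _ ≤ (K / m) ^ 2 * (80 * m) := by gcongr
            _ = _ := by field_simp

end LossBound

open ProbabilityTheory

/-! ### Configurations as counting measures -/

section PointKernel

variable {S : Type*} [MeasurableSpace S] [MeasurableSingletonClass S]

theorem Config.finite_inter_norm_lt (Y : Config S) (n : ℕ) :
    (Y.1 ∩ cyl S {x | ⌊‖x‖⌋₊ = n}).Finite := by
  refine Y.2 _ (isBounded_iff_forall_norm_le.2 ⟨n + 1, fun x hx => ?_⟩)
  have h : ⌊‖x‖⌋₊ = n := hx
  have := Nat.lt_floor_add_one ‖x‖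
  rw [h] at this
  exact this.le

theorem iUnion_cyl_floor : ⋃ n : ℕ, cyl S {x | ⌊‖x‖⌋₊ = n} = univ := by
  refine eq_univ_of_forall fun y => mem_iUnion.2 ⟨⌊‖y.1‖⌋₊, ?_⟩
  rfl

theorem Config.countable (Y : Config S) : Y.1.Countable := by
  rw [← inter_univ Y.1, ← iUnion_cyl_floor, inter_iUnion]
  exact countable_iUnion fun n => (Y.finite_inter_norm_lt n).countable

theorem measurableSet_cyl_floor (n : ℕ) : MeasurableSet (cyl S {x | ⌊‖x‖⌋₊ = n}) := by
  have h : Measurable fun y : Particle S => ⌊‖y.1‖⌋₊ := by fun_prop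
  exact h (measurableSet_singleton n)

theorem Config.measurableSet (Y : Config S) : MeasurableSet Y.1 := Y.countable.measurableSet

/-- The counting measure of a configuration, as a kernel. -/
def pointKernel (S : Type*) [MeasurableSpace S] [MeasurableSingletonClass S] :
    Kernel (Config S) (Particle S) where
  toFun Y := Measure.count.restrict Y.1
  measurable' := by
    refine Measure.measurable_of_measurable_coe _ fun A hA => ?_
    have : (fun Y : Config S => Measure.count.restrict Y.1 A) =
        (fun n : ℕ∞ => (n : ℝ≥0∞)) ∘ Config.count A := by
      funext Y
      rw [Measure.restrict_apply hA, Measure.count_apply (hA.inter Y.measurableSet), inter_comm]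
      rfl
    rw [this]
    exact Measurable.comp (fun _ _ => trivial) (Config.measurable_count hA)

theorem pointKernel_apply (Y : Config S) : pointKernel S Y = Measure.count.restrict Y.1 := rfl

theorem pointKernel_apply_set (Y : Config S) {A : Set (Particle S)} (hA : MeasurableSet A) :
    pointKernel S Y A = (Config.count A Y : ℝ≥0∞) := by
  rw [pointKernel_apply, Measure.restrict_apply hA, Measure.count_apply (hA.inter Y.measurableSet),
    inter_comm]
  rfl

theorem lintegral_pointKernel (Y : Config S) (f : Particle S → ℝ≥0∞) :
    ∫⁻ y, f y ∂(pointKernel S Y) = ∑' y : Y.1, f y := by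
  rw [pointKernel_apply, ← lintegral_indicator Y.measurableSet, lintegral_count, tsum_subtype]

instance : IsSFiniteKernel (pointKernel S) := by
  classical
  -- On a shell of bounded norm a configuration has finitely many particles, but their number is not
  -- uniformly bounded; cutting also according to this number gives finite kernels.
  have h1 : ∀ n : ℕ, IsSFiniteKernel ((pointKernel S).restrict (measurableSet_cyl_floor n)) := by
    intro n
    set κ := (pointKernel S).restrict (measurableSet_cyl_floor n)
    have hs : ∀ j : ℕ, MeasurableSet {Y : Config S | Config.count (cyl S {x | ⌊‖x‖⌋₊ = n}) Y = j} :=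
      fun j => Config.measurable_count (measurableSet_cyl_floor n) (t := {(j : ℕ∞)}) trivial
    have hfin : ∀ j : ℕ, IsFiniteKernel (Kernel.piecewise (hs j) κ 0) := by
      intro j
      refine ⟨⟨j, by simp, fun Y => ?_⟩⟩
      rw [Kernel.piecewise_apply]
      split_ifs with hY
      · have hY' : Config.count (cyl S {x | ⌊‖x‖⌋₊ = n}) Y = j := hY
        rw [Kernel.restrict_apply, Measure.restrict_apply_univ,
          pointKernel_apply_set Y (measurableSet_cyl_floor n), hY']
        simp
      · simp
    refine ⟨⟨fun j => Kernel.piecewise (hs j) κ 0, hfin, ?_⟩⟩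
    refine Kernel.ext fun Y => ?_
    obtain ⟨j, hj⟩ : ∃ j : ℕ, Config.count (cyl S {x | ⌊‖x‖⌋₊ = n}) Y = j := by
      refine ⟨(Y.1 ∩ cyl S {x | ⌊‖x‖⌋₊ = n}).ncard, ?_⟩
      exact ((Y.finite_inter_norm_lt n).cast_ncard_eq).symm
    refine Measure.ext fun A hA => ?_
    rw [Kernel.sum_apply' _ _ hA, tsum_eq_single j]
    · rw [Kernel.piecewise_apply, if_pos (by exact hj)]
    · intro i hi
      rw [Kernel.piecewise_apply, if_neg]
      · rfl
      · intro h
        have h' : Config.count (cyl S {x | ⌊‖x‖⌋₊ = n}) Y = i := h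
        rw [hj] at h'
        exact hi (by exact_mod_cast h'.symm)
  have h2 : pointKernel S =
      Kernel.sum fun n => (pointKernel S).restrict (measurableSet_cyl_floor n) := by
    refine Kernel.ext fun Y => ?_
    rw [Kernel.sum_apply]
    simp only [Kernel.restrict_apply]
    rw [← Measure.restrict_iUnion _ measurableSet_cyl_floor, iUnion_cyl_floor,
      Measure.restrict_univ]
    intro i j hij
    refine disjoint_left.2 fun y hi hj => hij ?_
    have hi' : ⌊‖y.1‖⌋₊ = i := hi
    have hj' : ⌊‖y.1‖⌋₊ = j := hj
    rw [← hi', hj']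
  rw [h2]
  exact Kernel.isSFiniteKernel_sum

end PointKernel

/-! ### Measurability of the energies -/

section Measurability

variable {S : Type*} [Finite S] [MeasurableSpace S] [MeasurableSingletonClass S]
  {U : Particle S → Particle S → ℝ≥0∞}

theorem measurableSet_particle_eq :
    MeasurableSet {p : Particle S × Particle S | p.2 = p.1} :=
  measurableSet_eq_fun measurable_snd measurable_fst

/-- Sums over the particles of `Y` are integrals against `pointKernel`, so the measurability of
iterated kernel integrals applies. -/
theorem measurable_energy (hU : Measurable (Function.uncurry U)) : Measurable (energy U) := by
  set F : Particle S × Particle S → ℝ≥0∞ := {p | p.2 = p.1}ᶜ.indicator (Function.uncurry U) with hF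
  have hFm : Measurable F := hU.indicator measurableSet_particle_eq.compl
  have h1 : Measurable fun q : Config S × Particle S => ∫⁻ y, F (q.2, y) ∂(pointKernel S q.1) :=
    Measurable.lintegral_kernel_prod_right'
      (κ := (pointKernel S).comap Prod.fst measurable_fst)
      (f := fun q : (Config S × Particle S) × Particle S => F (q.1.2, q.2)) (by fun_prop)
  have h2 : Measurable fun Y : Config S =>
      ∫⁻ y₁, ∫⁻ y₂, F (y₁, y₂) ∂(pointKernel S Y) ∂(pointKernel S Y) :=
    Measurable.lintegral_kernel_prod_right' (κ := pointKernel S) h1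
  have : energy U = fun Y : Config S =>
      2⁻¹ * ∫⁻ y₁, ∫⁻ y₂, F (y₁, y₂) ∂(pointKernel S Y) ∂(pointKernel S Y) := by
    funext Y
    simp only [lintegral_pointKernel]
    rfl
  rw [this]
  exact h2.const_mul _

theorem measurable_interaction (hU : Measurable (Function.uncurry U))
    {Λ Λ' : Set (ℝ × ℝ)} (hΛ : MeasurableSet Λ) (hΛ' : MeasurableSet Λ') :
    Measurable fun Y : Config S => interaction U (Y.restrict Λ) (Y.restrict Λ') := by
  have h1 : Measurable fun q : Config S × Particle S =>
      ∫⁻ y, U q.2 y ∂(pointKernel S (q.1.restrict Λ')) :=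
    Measurable.lintegral_kernel_prod_right'
      (κ := (pointKernel S).comap (fun q : Config S × Particle S => q.1.restrict Λ')
        ((Config.measurable_restrict hΛ').comp measurable_fst))
      (f := fun q : (Config S × Particle S) × Particle S => U q.1.2 q.2)
      (hU.comp (f := fun q : (Config S × Particle S) × Particle S => (q.1.2, q.2)) (by fun_prop))
  have h2 := Measurable.lintegral_kernel_prod_right'
    (κ := (pointKernel S).comap (Config.restrict Λ) (Config.measurable_restrict hΛ)) h1
  simp only [Kernel.comap_apply, lintegral_pointKernel] at h2
  exact h2

theorem measurable_weight (hU : Measurable (Function.uncurry U)) (z : ℝ) {Λ : Set (ℝ × ℝ)}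
    (hΛ : MeasurableSet Λ) : Measurable (weight U z Λ) := by
  have h1 : Measurable (hamiltonian U Λ) :=
    ((measurable_energy hU).comp (Config.measurable_restrict hΛ)).add
      (measurable_interaction hU hΛ hΛ.compl)
  have h2 : Measurable fun Y : Config S => ENNReal.ofReal z ^ (Y.restrict Λ).1.ncard := by
    have : (fun Y : Config S => ENNReal.ofReal z ^ (Y.restrict Λ).1.ncard) =
        (fun n : ℕ∞ => ENNReal.ofReal z ^ n.toNat) ∘ Config.count (cyl S Λ) := rfl
    rw [this]
    exact Measurable.comp (fun _ _ => trivial) (Config.measurable_count (measurable_fst hΛ))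
  exact (measurable_boltz.comp h1).mul h2

/-- The interaction of a particle with a configuration. -/
def field (U : Particle S → Particle S → ℝ≥0∞) (Y : Config S) (y : Particle S) : ℝ≥0∞ :=
  ∑' y' : Y.1, U y y'

theorem measurable_field (hU : Measurable (Function.uncurry U)) (Y : Config S) :
    Measurable (field U Y) := by
  have : Countable Y.1 := Y.countable
  exact Measurable.tsum fun y' => hU.comp (measurable_id.prodMk measurable_const)

end Measurability

/-! ### Finite volume Gibbs distributions as integrals over tuples -/

section FiniteVolumeFormula

variable {S : Type*} {U : Particle S → Particle S → ℝ≥0∞}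

/-- Twice the sum over unordered pairs is the sum over ordered pairs. -/
theorem sum_sum_ne_eq_two_mul (hsymm : ∀ a b, U a b = U b a) {k : ℕ}
    (y : Fin k → Particle S) :
    ∑ i, ∑ j, (if j ≠ i then U (y i) (y j) else 0) = 2 * ∑ p ∈ edges k, pairVal U y p := by
  have hoff : ∀ F : Fin k → Fin k → ℝ≥0∞, ∑ i, ∑ j, (if i < j then F i j else 0) =
      ∑ p ∈ (Finset.univ : Finset (Fin k)).offDiag with p.1 < p.2, F p.1 p.2 := by
    intro F
    rw [Finset.sum_filter, ← Finset.sum_product', Finset.univ_product_univ]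
    symm
    refine Finset.sum_subset (Finset.subset_univ _) fun p _ hp => ?_
    have : p.1 = p.2 := by simpa using hp
    simp [this]
  have h1 : ∑ p ∈ edges k, pairVal U y p = ∑ i, ∑ j, (if i < j then U (y i) (y j) else 0) := by
    rw [hoff, edges, ← Finset.sym2_univ, Finset.sum_sym2_filter_not_isDiag]
    exact Finset.sum_congr rfl fun p _ => pairVal_mk hsymm y p.1 p.2
  have h2 : ∑ i, ∑ j, (if i < j then U (y i) (y j) else 0) =
      ∑ i, ∑ j, (if j < i then U (y i) (y j) else 0) := by
    rw [Finset.sum_comm]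
    refine Finset.sum_congr rfl fun i _ => Finset.sum_congr rfl fun j _ => ?_
    rw [hsymm]
  rw [two_mul]
  nth_rewrite 1 [h1]
  rw [h1, h2]
  nth_rewrite 1 [← h2]
  simp only [← Finset.sum_add_distrib]
  refine Finset.sum_congr rfl fun i _ => Finset.sum_congr rfl fun j _ => ?_
  rcases lt_trichotomy i j with h | rfl | h
  · simp [h, h.ne', h.not_gt]
  · simp
  · simp [h, h.ne, h.not_gt]

theorem energy_eq_sum (hsymm : ∀ a b, U a b = U b a) {k : ℕ} {y : Fin k → Particle S}
    (hy : Function.Injective y) {Y : Config S} (hY : Y.1 = range y) :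
    energy U Y = ∑ p ∈ edges k, pairVal U y p := by
  have h : energy U Y = 2⁻¹ * ∑ i, ∑ j, (if j ≠ i then U (y i) (y j) else 0) := by
    rw [energy, hY]
    congr 1
    rw [tsum_range (fun y₁ => ∑' y₂ : range y,
      ({y | y ≠ y₁} : Set (Particle S)).indicator (U y₁) y₂) hy, tsum_fintype]
    refine Finset.sum_congr rfl fun i _ => ?_
    rw [tsum_range (fun y₂ => ({p | p ≠ y i} : Set (Particle S)).indicator (U (y i)) y₂) hy,
      tsum_fintype]
    refine Finset.sum_congr rfl fun j _ => ?_
    by_cases hij : j = i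
    · simp [hij]
    · rw [indicator_of_mem (by exact fun h => hij (hy h)), if_pos hij]
  rw [h, sum_sum_ne_eq_two_mul hsymm, ← mul_assoc, ENNReal.inv_mul_cancel two_ne_zero
    ENNReal.ofNat_ne_top, one_mul]

theorem interaction_eq_sum {k : ℕ} {y : Fin k → Particle S}
    (hy : Function.Injective y) {Y : Config S} (hY : Y.1 = range y) (Y' : Config S) :
    interaction U Y Y' = ∑ i, field U Y' (y i) := by
  rw [interaction, hY, tsum_range (fun y₁ => ∑' y₂ : Y'.1, U y₁ y₂) hy, tsum_fintype]
  rfl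

/-- The finite configuration of a tuple in `Λ`, with boundary condition. -/
def glue (Λ : Set (ℝ × ℝ)) (Ybar : Config S) {k : ℕ} (y : Fin k → Particle S) : Config S :=
  ((Config.ofTuple y).restrict Λ).union (Ybar.restrict Λᶜ)

theorem restrict_glue {Λ : Set (ℝ × ℝ)} (Ybar : Config S) {k : ℕ} {y : Fin k → Particle S}
    (hy : ∀ i, (y i).1 ∈ Λ) : ((glue Λ Ybar y).restrict Λ).1 = range y := by
  ext p
  constructor
  · rintro ⟨⟨hp, _⟩ | ⟨_, hp⟩, hp'⟩
    · exact hp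
    · exact absurd hp' hp
  · rintro ⟨i, rfl⟩
    exact ⟨Or.inl ⟨mem_range_self i, hy i⟩, hy i⟩

theorem restrict_compl_glue (Λ : Set (ℝ × ℝ)) (Ybar : Config S) {k : ℕ} (y : Fin k → Particle S) :
    (glue Λ Ybar y).restrict Λᶜ = Ybar.restrict Λᶜ := by
  refine Subtype.ext (Set.ext fun p => ?_)
  constructor
  · rintro ⟨⟨_, hp⟩ | hp, hp'⟩
    · exact absurd hp hp'
    · exact hp
  · exact fun hp => ⟨Or.inr hp, hp.2⟩

/-- The one-particle weight in `Λ` with boundary condition. -/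
def boundaryWeight (U : Particle S → Particle S → ℝ≥0∞) (Λ : Set (ℝ × ℝ)) (Ybar : Config S) :
    Particle S → ℝ≥0∞ :=
  (cyl S Λ).indicator fun y => boltz (field U (Ybar.restrict Λᶜ) y)

theorem boundaryWeight_le_one (Λ : Set (ℝ × ℝ)) (Ybar : Config S) (y : Particle S) :
    boundaryWeight U Λ Ybar y ≤ 1 :=
  indicator_le' (fun _ _ => boltz_le_one _) (fun _ _ => zero_le) y

/-- Injectivity matters: a configuration is a set, so repeated entries of the tuple would be lost in
the particle number and in the energy. -/
theorem weight_glue (hsymm : ∀ a b, U a b = U b a) (z : ℝ) {Λ : Set (ℝ × ℝ)} (Ybar : Config S)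
    {k : ℕ} {y : Fin k → Particle S} (hy : Function.Injective y) (hyΛ : ∀ i, (y i).1 ∈ Λ) :
    weight U z Λ (glue Λ Ybar y) = ENNReal.ofReal z ^ k *
      tupleWeight (boundaryWeight U Λ Ybar) (fun a b => boltz (U a b)) y := by
  have hr := restrict_glue Ybar hyΛ
  have hcard : (range y).ncard = k := by
    rw [← image_univ, ncard_image_of_injective _ hy, ncard_univ, Nat.card_eq_fintype_card,
      Fintype.card_fin]
  rw [weight, hr, hcard, mul_comm, tupleWeight, hamiltonian, energy_eq_sum hsymm hy hr,
    interaction_eq_sum hy hr, restrict_compl_glue]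
  congr 1
  rw [← boltz, boltz_add, boltz_sum, boltz_sum, mul_comm]
  congr 1
  refine Finset.prod_congr rfl fun i _ => ?_
  rw [boundaryWeight, indicator_of_mem (by exact hyΛ i)]

variable [Finite S] [MeasurableSpace S] [MeasurableSingletonClass S]

theorem measurable_boundaryWeight
    (hU : Measurable (Function.uncurry U)) {Λ : Set (ℝ × ℝ)} (hΛ : MeasurableSet Λ)
    (Ybar : Config S) : Measurable (boundaryWeight U Λ Ybar) :=
  (measurable_boltz.comp (measurable_field hU _)).indicator (measurable_fst hΛ)

variable [Nonempty S]

theorem measure_pi_eq_eq_zero {k : ℕ} {i j : Fin k} (hij : i ≠ j) :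
    Measure.pi (fun _ : Fin k => refMeasure S) {y | y i = y j} = 0 := by
  obtain ⟨k, rfl⟩ : ∃ n, k = n + 1 := ⟨k - 1, by have := i.pos; omega⟩
  obtain ⟨j, rfl⟩ := Fin.exists_succAbove_eq hij.symm
  have : NullSingletonClass (refMeasure S) := by unfold refMeasure; infer_instance
  have hp := measurePreserving_piFinSuccAbove (fun _ : Fin (k + 1) => refMeasure S) i
  have hm : MeasurableSet {q : Particle S × (Fin k → Particle S) | q.2 j = q.1} :=
    measurableSet_eq_fun (by fun_prop) (by fun_prop)
  have h := hp.measure_preimage hm.nullMeasurableSet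
  have h0 : ((refMeasure S).prod (Measure.pi fun _ : Fin k => refMeasure S))
      {q : Particle S × (Fin k → Particle S) | q.2 j = q.1} = 0 := by
    rw [Measure.measure_prod_null hm]
    exact Eventually.of_forall fun x => Measure.pi_hyperplane (fun _ : Fin k => refMeasure S) j x
  rw [h0] at h
  rw [← h]
  congr 1
  ext y
  exact eq_comm

/-- Positions have a density, so coincidences are null and tuples may stand for sets. -/
theorem ae_injective (k : ℕ) :
    ∀ᵐ y ∂(Measure.pi fun _ : Fin k => refMeasure S), Function.Injective y := by
  have : ∀ p : Fin k × Fin k, ∀ᵐ y ∂(Measure.pi fun _ : Fin k => refMeasure S),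
      y p.1 = y p.2 → p.1 = p.2 := by
    intro p
    by_cases hp : p.1 = p.2
    · simp [hp]
    · refine measure_mono_null ?_ (measure_pi_eq_eq_zero hp)
      intro y hy
      by_contra hne
      exact hy fun h => absurd h hne
  filter_upwards [ae_all_iff.2 this] with y hy i j hij
  exact hy (i, j) hij

theorem lintegral_poissonBC {Λ : Set (ℝ × ℝ)} (hΛ : MeasurableSet Λ) (Ybar : Config S)
    {f : Config S → ℝ≥0∞} (hf : Measurable f) :
    ∫⁻ Y, f Y ∂(poissonBC Λ Ybar) = ENNReal.ofReal (Real.exp (-(volume Λ).toReal)) *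
      ∑' k : ℕ, (Nat.factorial k : ℝ≥0∞)⁻¹ *
        ∫⁻ y, (univ.pi fun _ : Fin k => cyl S Λ).indicator (fun y => f (glue Λ Ybar y)) y
          ∂(Measure.pi fun _ : Fin k => refMeasure S) := by
  have hg := Config.measurable_glue hΛ Ybar
  have hc : MeasurableSet (cyl S Λ) := measurable_fst hΛ
  rw [poissonBC, lintegral_map hf hg, poisson, lintegral_smul_measure, smul_eq_mul,
    lintegral_sum_measure]
  congr 1
  refine tsum_congr fun k => ?_
  rw [lintegral_smul_measure, smul_eq_mul,
    lintegral_map (f := fun Y : Config S => f ((Y.restrict Λ).union (Ybar.restrict Λᶜ)))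
      (hf.comp hg) Config.measurable_ofTuple,
    ← Measure.restrict_pi_pi, lintegral_indicator (MeasurableSet.univ_pi fun _ => hc)]
  rfl

/-- The unnormalized finite volume Gibbs distributions in terms of integrals over tuples. -/
theorem lintegral_indicator_weight (hU : Measurable (Function.uncurry U))
    (hsymm : ∀ a b, U a b = U b a) (z : ℝ) {Λ : Set (ℝ × ℝ)} (hΛ : MeasurableSet Λ)
    (Ybar : Config S) {A : Set (Config S)} (hA : MeasurableSet A) :
    ∫⁻ Y, A.indicator (weight U z Λ) Y ∂(poissonBC Λ Ybar) =
      ENNReal.ofReal (Real.exp (-(volume Λ).toReal)) *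
        grand (refMeasure S) (ENNReal.ofReal z) (fun _ y => {y | glue Λ Ybar y ∈ A}.indicator
          (tupleWeight (boundaryWeight U Λ Ybar) (fun a b => boltz (U a b))) y) := by
  rw [lintegral_poissonBC hΛ Ybar ((measurable_weight hU z hΛ).indicator hA), grand]
  congr 1
  refine tsum_congr fun k => ?_
  rw [mul_comm (ENNReal.ofReal z ^ k), mul_assoc]
  congr 1
  have hgm : Measurable fun y : Fin k → Particle S => glue Λ Ybar y :=
    (Config.measurable_glue hΛ Ybar).comp Config.measurable_ofTuple
  have htm : Measurable fun y : Fin k → Particle S =>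
      tupleWeight (boundaryWeight U Λ Ybar) (fun a b => boltz (U a b)) y :=
    measurable_tupleWeight (e := fun a b => boltz (U a b)) (measurable_boundaryWeight hU hΛ Ybar)
      (measurable_boltz.comp hU)
  have hgA : MeasurableSet {y : Fin k → Particle S | glue Λ Ybar y ∈ A} := hgm hA
  rw [← lintegral_const_mul _ (htm.indicator hgA)]
  refine lintegral_congr_ae ?_
  filter_upwards [ae_injective k] with y hy
  by_cases hyΛ : ∀ i, (y i).1 ∈ Λ
  · rw [indicator_of_mem (by exact fun i _ => hyΛ i)]
    by_cases hyA : glue Λ Ybar y ∈ A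
    · rw [indicator_of_mem hyA, indicator_of_mem (by exact hyA), weight_glue hsymm z Ybar hy hyΛ]
    · rw [indicator_of_notMem hyA, indicator_of_notMem (by exact hyA), mul_zero]
  · rw [indicator_of_notMem (by intro h; exact hyΛ fun i => h i trivial)]
    obtain ⟨i, hi⟩ := not_forall.1 hyΛ
    have h0 : tupleWeight (boundaryWeight U Λ Ybar) (fun a b => boltz (U a b)) y = 0 := by
      rw [tupleWeight, Finset.prod_eq_zero (Finset.mem_univ i), zero_mul]
      exact indicator_of_notMem (by exact hi) _
    by_cases hyA : y ∈ {y : Fin k → Particle S | glue Λ Ybar y ∈ A}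
    · rw [indicator_of_mem hyA, h0, mul_zero]
    · rw [indicator_of_notMem hyA, mul_zero]

end FiniteVolumeFormula

/-! ### The midpoint inequality for conditional Gibbs distributions -/

section KernelInequality

variable {S : Type*}

/-- Goodness puts the representative within `M + ρ` of the origin, where the cutoff equals one. -/
theorem Good.move_eq {T : Cutoff} {ρ M : ℝ} (hR : M + ρ ≤ T.R) (hN : M ≤ T.N) {k : ℕ}
    {B : Finset (Sym2 (Fin k))} {y : Fin k → Particle S} (hg : Good T ρ B y) (w : ℝ × ℝ)
    {i : Fin k} (hi : ‖(y i).1‖ ≤ M) : move T w B y i = ((y i).1 + w, (y i).2) := by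
  have h1 := hg i (rep B i) (reachable_rep B i) (hi.trans hN)
  have h2 : ‖(y (rep B i)).1‖ ≤ T.R := by
    have := norm_sub_norm_le (y (rep B i)).1 (y i).1
    rw [norm_sub_rev] at this
    linarith
  rw [move, T.eq_one _ h2, one_smul]

/-- Inside a window, moving a good tuple amounts to a translation of the configuration. -/
theorem restrict_translate_glue_move {T : Cutoff} {ρ m L : ℝ} {w : ℝ × ℝ}
    (hR : m + 2 * ‖w‖ + ρ ≤ T.R) (hN : m + 2 * ‖w‖ ≤ T.N) (hL : m + ‖w‖ ≤ L) (Ybar : Config S)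
    {k : ℕ} {B : Finset (Sym2 (Fin k))} {y : Fin k → Particle S} (hg : Good T ρ B y) :
    ((glue (Metric.closedBall 0 L) Ybar (move T w B y)).translate (-w)).restrict
        (Metric.closedBall 0 m) =
      (glue (Metric.closedBall 0 L) Ybar y).restrict (Metric.closedBall 0 m) := by
  have hw := norm_nonneg w
  have hmove : ∀ i, ‖(y i).1‖ ≤ m + 2 * ‖w‖ → move T w B y i = ((y i).1 + w, (y i).2) :=
    fun i hi => hg.move_eq hR hN w hi
  have hmem : ∀ {x : ℝ × ℝ} {R : ℝ}, x ∈ Metric.closedBall (0 : ℝ × ℝ) R ↔ ‖x‖ ≤ R :=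
    mem_closedBall_zero_iff
  refine Subtype.ext (Set.ext fun p => ?_)
  constructor
  · rintro ⟨⟨q, hq, rfl⟩, hp⟩
    have hp' : ‖q.1 + -w‖ ≤ m := hmem.1 hp
    have hq1 : ‖q.1‖ ≤ m + ‖w‖ := by
      have := norm_le_norm_add_norm_sub' q.1 (-(-w))
      have h2 := norm_add_le (q.1 + -w) w
      rw [neg_add_cancel_right] at h2
      linarith
    rcases hq with ⟨⟨i, rfl⟩, -⟩ | ⟨-, hq⟩
    · have hi : ‖(y i).1‖ ≤ m + 2 * ‖w‖ := by
        have h1 : (y i).1 = (move T w B y i).1 - T.τ (y (rep B i)).1 • w := by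
          rw [move, add_sub_cancel_right]
        have h2 : ‖T.τ (y (rep B i)).1 • w‖ ≤ ‖w‖ := by
          rw [norm_smul, Real.norm_eq_abs, abs_of_nonneg (T.nonneg _)]
          exact mul_le_of_le_one_left hw (T.le_one _)
        rw [h1]
        have := norm_sub_le (move T w B y i).1 (T.τ (y (rep B i)).1 • w)
        linarith
      simp only [hmove i hi, add_neg_cancel_right] at hp' ⊢
      exact ⟨Or.inl ⟨mem_range_self i, hmem.2 (by linarith)⟩, hmem.2 hp'⟩
    · exact absurd (hmem.2 (hq1.trans hL)) hq
  · rintro ⟨⟨⟨i, rfl⟩, -⟩ | ⟨-, hq⟩, hp⟩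
    · have hp' : ‖(y i).1‖ ≤ m := hmem.1 hp
      have hi := hmove i (by linarith)
      have hn := norm_add_le (y i).1 w
      refine ⟨⟨move T w B y i, Or.inl ⟨mem_range_self i, ?_⟩, ?_⟩, hp⟩
      · rw [hi]
        exact hmem.2 (by simp only; linarith)
      · simp [hi]
    · exact absurd (hmem.2 ((hmem.1 hp).trans (by linarith))) hq

variable [Finite S] [Nonempty S] [MeasurableSpace S] [MeasurableSingletonClass S]
  {U : Particle S → Particle S → ℝ≥0∞}

theorem gibbsKernel_le_one (U : Particle S → Particle S → ℝ≥0∞) (z : ℝ) (Λ : Set (ℝ × ℝ))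
    (Ybar : Config S) (A : Set (Config S)) : gibbsKernel U z Λ Ybar A ≤ 1 := by
  -- `Z⁻¹ * Z ≤ 1` also holds for `Z = 0` and `Z = ⊤`, so nothing has to be known about the
  -- partition function.
  refine le_trans ?_ (ENNReal.inv_mul_le_one (partitionFunction U z Λ Ybar))
  rw [gibbsKernel]
  gcongr
  exact lintegral_mono fun Y => indicator_le_self' (fun _ _ => zero_le) Y

theorem boundaryWeight_eq_one {r L : ℝ} (hr : 0 < r)
    (hU : ∀ y y' : Particle S, r ≤ ‖y.1 - y'.1‖ → U y y' = 0) (Ybar : Config S) {y : Particle S}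
    (hy : ‖y.1‖ ≤ L - r) : boundaryWeight U (Metric.closedBall 0 L) Ybar y = 1 := by
  rw [boundaryWeight, indicator_of_mem]
  · have : field U (Ybar.restrict (Metric.closedBall 0 L)ᶜ) y = 0 := by
      refine ENNReal.tsum_eq_zero.2 fun y' => hU _ _ ?_
      have h1 : L < ‖y'.1.1‖ := by
        have := y'.2.2
        rw [cyl, mem_ofPred_eq, mem_compl_iff, mem_closedBall_zero_iff, not_le] at this
        exact this
      have := norm_sub_norm_le y'.1.1 y.1
      rw [norm_sub_rev] at this
      linarith
    rw [this, boltz_zero]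
  · exact mem_closedBall_zero_iff.2 (by linarith)

/-- The probability of a local event is almost at most the average of the probabilities of its
two translates. -/
theorem exists_gibbsKernel_le (D : Split S) (hU : Measurable (Function.uncurry U))
    (hsymm : ∀ a b, U a b = U b a) (hD : D.full = fun a b => boltz (U a b)) {r : ℝ} (hr : 0 < r)
    (hrange : ∀ y y' : Particle S, r ≤ ‖y.1 - y'.1‖ → U y y' = 0) (z : ℝ)
    (hz : ENNReal.ofReal z * D.eps ≤ 2⁻¹) (w : ℝ × ℝ) {m : ℝ} (hm : 0 ≤ m) {ε : ℝ≥0∞}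
    (hε : ε ≠ 0) : ∃ Λ : Set (ℝ × ℝ), MeasurableSet Λ ∧ Bornology.IsBounded Λ ∧
      ∀ A : Set (Config S), MeasurableSet A → ∀ Ybar : Config S,
      gibbsKernel U z Λ Ybar (Config.restrict (Metric.closedBall 0 m) ⁻¹' A) ≤
        2⁻¹ * gibbsKernel U z Λ Ybar
          (Config.translate (-w) ⁻¹' (Config.restrict (Metric.closedBall 0 m) ⁻¹' A)) +
        2⁻¹ * gibbsKernel U z Λ Ybar
          (Config.translate w ⁻¹' (Config.restrict (Metric.closedBall 0 m) ⁻¹' A)) + ε := by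
  obtain ⟨T, ρ, L, hρ, hw, hR, hN, hL, hloss⟩ :=
    -- Particles that end in the window after the move and the translation back start within `m +
    -- 2‖w‖`; the extra `r` keeps moved particles out of range of the boundary condition.
    exists_lossBound_le D hz ENNReal.ofReal_ne_top w (m + 2 * ‖w‖ + r) hε
  have hw0 := norm_nonneg w
  have hΛ : MeasurableSet (Metric.closedBall (0 : ℝ × ℝ) L) := measurableSet_closedBall
  refine ⟨Metric.closedBall 0 L, hΛ, Metric.isBounded_closedBall, fun A hA Ybar => ?_⟩
  set Λ := Metric.closedBall (0 : ℝ × ℝ) L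
  set Δ := Metric.closedBall (0 : ℝ × ℝ) m
  set A₀ := Config.restrict (S := S) Δ ⁻¹' A with hA₀
  have hA₀m : MeasurableSet A₀ := Config.measurable_restrict measurableSet_closedBall hA
  have hA₁m : MeasurableSet (Config.translate (-w) ⁻¹' A₀) := Config.measurable_translate _ hA₀m
  have hA₂m : MeasurableSet (Config.translate w ⁻¹' A₀) := Config.measurable_translate _ hA₀m
  have hgm : ∀ k, Measurable fun y : Fin k → Particle S => glue Λ Ybar y := fun k =>
    (Config.measurable_glue hΛ Ybar).comp Config.measurable_ofTuple
  set b := boundaryWeight U Λ Ybar with hb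
  have hbm : Measurable b := measurable_boundaryWeight hU hΛ Ybar
  have hb1 : ∀ y, b y ≤ 1 := boundaryWeight_le_one Λ Ybar
  have hbL : ∀ y, L < ‖y.1‖ → b y = 0 := fun y hy =>
    indicator_of_notMem (s := cyl S Λ) (fun h => absurd (mem_closedBall_zero_iff.1
      (show y.1 ∈ Λ from h)) (not_le.2 hy)) _
  have hfar : ∀ y : Particle S, ‖y.1‖ ≤ T.N + ρ + ‖w‖ → b y = 1 := fun y hy =>
    boundaryWeight_eq_one hr hrange Ybar (by linarith)
  have key := grand_indicator_le (D := D) (T := T) (z := ENNReal.ofReal z) (b := b)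
    (A := fun k => {y : Fin k → Particle S | glue Λ Ybar y ∈ A₀})
    (A₁ := fun k => {y : Fin k → Particle S | glue Λ Ybar y ∈ Config.translate (-w) ⁻¹' A₀})
    (A₂ := fun k => {y : Fin k → Particle S | glue Λ Ybar y ∈ Config.translate w ⁻¹' A₀})
    hw hρ hbm hb1 hfar (fun k => hgm k hA₁m) (fun k => hgm k hA₂m)
    (fun k B y hy hg => by
      have h := restrict_translate_glue_move (w := w) (m := m) (L := L) (by linarith) (by linarith)
        (by linarith) Ybar hg
      change ((glue Λ Ybar (move T w B y)).translate (-w)).restrict Δ ∈ A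
      rw [h]
      exact hy)
    (fun k B y hy hg => by
      have h := restrict_translate_glue_move (w := -w) (m := m) (L := L)
        (by rw [norm_neg]; linarith) (by rw [norm_neg]; linarith)
        (by rw [norm_neg]; linarith) Ybar hg
      rw [neg_neg] at h
      change ((glue Λ Ybar (move T (-w) B y)).translate w).restrict Δ ∈ A
      rw [h]
      exact hy)
  have hZ : partitionFunction U z Λ Ybar = ENNReal.ofReal (Real.exp (-(volume Λ).toReal)) *
      grand (refMeasure S) (ENNReal.ofReal z) (fun _ y => tupleWeight b D.full y) := by
    have := lintegral_indicator_weight hU hsymm z hΛ Ybar MeasurableSet.univ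
    simp only [indicator_univ, mem_univ, ofPred_true] at this
    rw [hD]
    exact this
  have hform : ∀ A' : Set (Config S), MeasurableSet A' → gibbsKernel U z Λ Ybar A' =
      (partitionFunction U z Λ Ybar)⁻¹ * (ENNReal.ofReal (Real.exp (-(volume Λ).toReal)) *
        grand (refMeasure S) (ENNReal.ofReal z) (fun _ y => {y | glue Λ Ybar y ∈ A'}.indicator
          (tupleWeight b D.full) y)) := by
    intro A' hA'
    rw [gibbsKernel, lintegral_indicator_weight hU hsymm z hΛ Ybar hA', hD]
  rw [hform _ hA₀m, hform _ hA₁m, hform _ hA₂m]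
  refine (mul_le_mul_right (mul_le_mul_right key _) _).trans ?_
  set Z := partitionFunction U z Λ Ybar
  set c := ENNReal.ofReal (Real.exp (-(volume Λ).toReal))
  have halg : ∀ g₁ g₂ g₃ l : ℝ≥0∞, Z⁻¹ * (c * (2⁻¹ * g₁ + 2⁻¹ * g₂ + l * g₃)) =
      2⁻¹ * (Z⁻¹ * (c * g₁)) + 2⁻¹ * (Z⁻¹ * (c * g₂)) + l * (Z⁻¹ * (c * g₃)) := by
    intros
    ring
  rw [halg, ← hZ]
  refine add_le_add le_rfl ?_
  calc lossBound D T w ρ b (ENNReal.ofReal z) * (Z⁻¹ * Z) ≤ ε * 1 :=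
        mul_le_mul' (hloss b hbm hb1 hbL) (ENNReal.inv_mul_le_one Z)
    _ = ε := mul_one ε

end KernelInequality

/-! ### Local events generate the σ-algebra -/

section LocalEvents

variable {S : Type*}

theorem Config.translate_translate (u v : ℝ × ℝ) (Y : Config S) :
    (Y.translate u).translate v = Y.translate (u + v) := by
  refine Subtype.ext ?_
  simp only [Config.translate, image_image, add_assoc]

theorem Config.translate_zero (Y : Config S) : Y.translate 0 = Y := by
  refine Subtype.ext ?_
  simp [Config.translate]

theorem Config.restrict_translate_restrict {Δ Δ' : Set (ℝ × ℝ)} {v : ℝ × ℝ}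
    (h : ∀ x, x + v ∈ Δ → x ∈ Δ') (Y : Config S) :
    ((Y.restrict Δ').translate v).restrict Δ = (Y.translate v).restrict Δ := by
  refine Subtype.ext (Set.ext fun p => ?_)
  constructor
  · rintro ⟨⟨q, hq, rfl⟩, hp⟩
    exact ⟨⟨q, hq.1, rfl⟩, hp⟩
  · rintro ⟨⟨q, hq, rfl⟩, hp⟩
    exact ⟨⟨q, ⟨hq, h _ hp⟩, rfl⟩, hp⟩

variable [MeasurableSpace S]

/-- The events that only depend on the particles in some ball around the origin. -/
def IsLocal (A : Set (Config S)) : Prop :=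
  ∃ m : ℕ, MeasurableSet[eventsIn S (Metric.closedBall 0 m)] A

theorem eventsIn_closedBall_mono : Monotone fun m : ℕ => eventsIn S (Metric.closedBall 0 m) := by
  rintro m n hmn _ ⟨A, hA, rfl⟩
  refine ⟨Config.restrict (Metric.closedBall 0 m) ⁻¹' A,
    Config.measurable_restrict measurableSet_closedBall hA, ?_⟩
  ext Y
  have : (Y.restrict (Metric.closedBall 0 n)).restrict (Metric.closedBall 0 m) =
      Y.restrict (Metric.closedBall 0 m) := by
    refine Subtype.ext (Set.ext fun p => ?_)
    have hsub : Metric.closedBall (0 : ℝ × ℝ) m ⊆ Metric.closedBall 0 n :=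
      Metric.closedBall_subset_closedBall (by exact_mod_cast hmn)
    exact ⟨fun h => ⟨h.1.1, h.2⟩, fun h => ⟨⟨h.1, hsub h.2⟩, h.2⟩⟩
  change (Y.restrict (Metric.closedBall 0 n)).restrict (Metric.closedBall 0 m) ∈ A ↔ _
  rw [this]
  rfl

theorem IsLocal.measurableSet {A : Set (Config S)} (hA : IsLocal A) : MeasurableSet A := by
  obtain ⟨m, hm⟩ := hA
  exact eventsIn_le measurableSet_closedBall _ hm

theorem IsLocal.translate {A : Set (Config S)} (hA : IsLocal A) (v : ℝ × ℝ) :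
    IsLocal (Config.translate v ⁻¹' A) := by
  obtain ⟨m, A, hA, rfl⟩ := hA
  obtain ⟨n, hn⟩ := exists_nat_ge (m + ‖v‖)
  refine ⟨n, Config.translate v ⁻¹' (Config.restrict (Metric.closedBall 0 m) ⁻¹' A),
    Config.measurable_translate v (Config.measurable_restrict measurableSet_closedBall hA), ?_⟩
  ext Y
  change ((Y.restrict (Metric.closedBall 0 n)).translate v).restrict (Metric.closedBall 0 m) ∈ A ↔ _
  rw [Config.restrict_translate_restrict]
  · rfl
  · intro x hx
    rw [mem_closedBall_zero_iff] at hx ⊢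
    have := norm_sub_le (x + v) v
    rw [add_sub_cancel_right] at this
    linarith

theorem isPiSystem_isLocal : IsPiSystem {A : Set (Config S) | IsLocal A} := by
  rintro A ⟨m, hA⟩ B ⟨n, hB⟩ -
  exact ⟨max m n, (eventsIn_closedBall_mono (le_max_left m n) _ hA).inter
    (eventsIn_closedBall_mono (le_max_right m n) _ hB)⟩

/-- If the count exceeds `a`, some `a + 1` particles witness this, and finitely many particles lie
in a common ball. Upper bounds on counts are thus countable intersections of local events. -/
theorem Config.count_le_iff (B : Set (Particle S)) (a : ℕ∞) (Y : Config S) :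
    Config.count B Y ≤ a ↔
      ∀ m : ℕ, Config.count B (Y.restrict (Metric.closedBall 0 m)) ≤ a := by
  constructor
  · exact fun h m => le_trans (encard_le_encard (inter_subset_inter_left _ inter_subset_left)) h
  · intro h
    by_contra! hlt
    have hle : a + 1 ≤ Config.count B Y := Order.add_one_le_of_lt hlt
    obtain ⟨t, ht, hta⟩ := exists_subset_encard_eq hle
    have hatop : a ≠ ⊤ := hlt.ne_top
    have htfin : t.Finite := by
      rw [← encard_ne_top_iff, hta]
      exact WithTop.add_ne_top.2 ⟨hatop, ENat.one_ne_top⟩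
    obtain ⟨C, hC⟩ := (htfin.image Prod.fst).isBounded.exists_norm_le
    obtain ⟨m, hm⟩ := exists_nat_ge C
    have hsub : t ⊆ (Y.restrict (Metric.closedBall 0 m)).1 ∩ B := fun p hp =>
      ⟨⟨(ht hp).1, mem_closedBall_zero_iff.2 ((hC _ (mem_image_of_mem _ hp)).trans hm)⟩, (ht hp).2⟩
    have h1 := (encard_le_encard hsub).trans (h m)
    rw [hta] at h1
    exact absurd h1 (not_le.2 ((ENat.lt_add_one_iff hatop).2 le_rfl))

theorem generateFrom_isLocal :
    (Config.instMeasurableSpace : MeasurableSpace (Config S)) =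
      MeasurableSpace.generateFrom {A : Set (Config S) | IsLocal A} := by
  refine le_antisymm ?_ (MeasurableSpace.generateFrom_le fun A hA => IsLocal.measurableSet hA)
  refine iSup₂_le fun B hB => ?_
  have hle : ∀ a : ℕ∞, MeasurableSet[MeasurableSpace.generateFrom {A : Set (Config S) | IsLocal A}]
      {Y : Config S | Config.count B Y ≤ a} := by
    intro a
    have : {Y : Config S | Config.count B Y ≤ a} =
        ⋂ m : ℕ, {Y | Config.count B (Y.restrict (Metric.closedBall 0 m)) ≤ a} := by
      ext Y
      simp only [mem_iInter]
      exact Config.count_le_iff B a Y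
    rw [this]
    refine MeasurableSet.iInter fun m => MeasurableSpace.measurableSet_generateFrom ⟨m, ?_⟩
    exact ⟨{Y | Config.count B Y ≤ a}, Config.measurable_count hB (t := Iic a) trivial, rfl⟩
  rintro _ ⟨t, -, rfl⟩
  have hsing : ∀ a : ℕ∞,
      MeasurableSet[MeasurableSpace.generateFrom {A : Set (Config S) | IsLocal A}]
        (Config.count B ⁻¹' {a}) := by
    intro a
    have : Config.count B ⁻¹' {a} = {Y : Config S | Config.count B Y ≤ a} \
        ⋃ c ∈ Iio a, {Y : Config S | Config.count B Y ≤ c} := by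
      ext Y
      simp only [mem_preimage, mem_singleton_iff, Set.mem_sdiff, mem_iUnion, not_exists]
      constructor
      · intro h
        exact ⟨h.le, fun c hc hY => absurd (h ▸ hY : a ≤ c) (not_le.2 hc)⟩
      · rintro ⟨h1, h2⟩
        by_contra hne
        exact h2 _ (lt_of_le_of_ne h1 hne) (le_refl (Config.count B Y))
    rw [this]
    exact (hle a).diff (MeasurableSet.biUnion (to_countable _) fun c _ => hle c)
  rw [← biUnion_preimage_singleton]
  exact MeasurableSet.biUnion (to_countable t) fun a _ => hsing a

end LocalEvents

/-! ### From the midpoint inequality to translation invariance -/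

section TranslationInvariance

variable {S : Type*}

/-- The increments are nondecreasing, so a positive first increment would force linear growth. -/
theorem le_of_midpoint_le_of_bounded {a : ℕ → ℝ} (ha : ∀ k, a (k + 1) ≤ (a k + a (k + 2)) / 2)
    {C : ℝ} (hC : ∀ k, a k ≤ C) : a 1 ≤ a 0 := by
  by_contra! h
  have hstep : ∀ k, a 1 - a 0 ≤ a (k + 1) - a k := by
    intro k
    induction k with
    | zero => exact le_rfl
    | succ k ih => have := ha k; linarith
  have hgrow : ∀ k : ℕ, a 0 + k * (a 1 - a 0) ≤ a k := by
    intro k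
    induction k with
    | zero => simp
    | succ k ih => have := hstep k; push_cast; linarith
  obtain ⟨k, hk⟩ := exists_nat_gt ((C - a 0) / (a 1 - a 0))
  rw [div_lt_iff₀ (sub_pos.2 h)] at hk
  linarith [hgrow k, hC k]

variable [MeasurableSpace S]

/-- A probability measure for which the probability of every local event is at most the average
of the probabilities of its translates is translation invariant. -/
theorem map_translate_eq_of_midpoint_le {μ : Measure (Config S)} [IsProbabilityMeasure μ]
    (h : ∀ A : Set (Config S), IsLocal A → ∀ v : ℝ × ℝ,
      μ.real A ≤ (μ.real (Config.translate (-v) ⁻¹' A) + μ.real (Config.translate v ⁻¹' A)) / 2)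
    (v : ℝ × ℝ) : μ.map (Config.translate v) = μ := by
  have hle : ∀ A : Set (Config S), IsLocal A → ∀ v : ℝ × ℝ,
      μ.real (Config.translate v ⁻¹' A) ≤ μ.real A := by
    intro A hA v
    have hk : ∀ k : ℕ, μ.real (Config.translate (((k + 1 : ℕ) : ℝ) • v) ⁻¹' A) ≤
        (μ.real (Config.translate ((k : ℝ) • v) ⁻¹' A) +
          μ.real (Config.translate (((k + 2 : ℕ) : ℝ) • v) ⁻¹' A)) / 2 := by
      intro k
      have := h _ (hA.translate (((k + 1 : ℕ) : ℝ) • v)) v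
      simp only [← preimage_comp, Function.comp_def, Config.translate_translate] at this
      have e1 : -v + ((k + 1 : ℕ) : ℝ) • v = (k : ℝ) • v := by push_cast; module
      have e2 : v + ((k + 1 : ℕ) : ℝ) • v = ((k + 2 : ℕ) : ℝ) • v := by push_cast; module
      rw [e1, e2] at this
      exact this
    have := le_of_midpoint_le_of_bounded
      (a := fun k : ℕ => μ.real (Config.translate ((k : ℝ) • v) ⁻¹' A)) hk
      (fun _ => measureReal_le_one)
    have h0 : Config.translate (S := S) 0 = id := funext Config.translate_zero
    simpa [h0] using this
  have heq : ∀ A : Set (Config S), IsLocal A → μ (Config.translate v ⁻¹' A) = μ A := by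
    intro A hA
    have h1 := hle A hA v
    -- The reverse inequality: the same bound for the translated event and the opposite vector.
    have h2 := hle _ (hA.translate v) (-v)
    simp only [← preimage_comp, Function.comp_def, Config.translate_translate, neg_add_cancel,
      Config.translate_zero] at h2
    exact (measureReal_eq_measureReal_iff).1 (le_antisymm h1 h2)
  have hm := Config.measurable_translate (S := S) v
  have : IsProbabilityMeasure (μ.map (Config.translate v)) :=
    Measure.isProbabilityMeasure_map hm.aemeasurable
  refine ext_of_generate_finite _ generateFrom_isLocal isPiSystem_isLocal (fun A hA => ?_)
    (by simp)
  rw [Measure.map_apply hm (IsLocal.measurableSet hA), heq A hA]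

variable {U : Particle S → Particle S → ℝ≥0∞} {z : ℝ} {μ : Measure (Config S)}

theorem IsGibbsMeasure.integral_gibbsKernel (hμ : IsGibbsMeasure U z μ) {Λ : Set (ℝ × ℝ)}
    (hΛ : MeasurableSet Λ) (hb : Bornology.IsBounded Λ) {A : Set (Config S)}
    (hA : MeasurableSet A) : Integrable (fun Ybar => (gibbsKernel U z Λ Ybar A).toReal) μ ∧
      ∫ Ybar, (gibbsKernel U z Λ Ybar A).toReal ∂μ = μ.real A := by
  have := hμ.1
  have h := hμ.2 Λ hΛ hb A hA
  refine ⟨integrable_condExp.congr h, ?_⟩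
  rw [← integral_congr_ae h, integral_condExp (eventsIn_le hΛ.compl), integral_indicator_const _ hA]
  simp

variable [Finite S] [Nonempty S] [MeasurableSingletonClass S]

theorem IsGibbsMeasure.measureReal_le (hμ : IsGibbsMeasure U z μ) (D : Split S)
    (hU : Measurable (Function.uncurry U))
    (hsymm : ∀ a b, U a b = U b a) (hD : D.full = fun a b => boltz (U a b)) {r : ℝ} (hr : 0 < r)
    (hrange : ∀ y y' : Particle S, r ≤ ‖y.1 - y'.1‖ → U y y' = 0)
    (hz : ENNReal.ofReal z * D.eps ≤ 2⁻¹) {A : Set (Config S)} (hA : IsLocal A) (v : ℝ × ℝ) :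
    μ.real A ≤ (μ.real (Config.translate (-v) ⁻¹' A) + μ.real (Config.translate v ⁻¹' A)) / 2 := by
  have := hμ.1
  have hA' := hA
  obtain ⟨m, A, hAm, rfl⟩ := hA'
  set A₀ := Config.restrict (S := S) (Metric.closedBall 0 m) ⁻¹' A
  refine le_of_forall_pos_le_add fun ε hε => ?_
  obtain ⟨Λ, hΛ, hb, hle⟩ := exists_gibbsKernel_le D hU hsymm hD hr hrange z hz v
    (Nat.cast_nonneg m) (ε := ENNReal.ofReal ε) (by simpa using hε)
  obtain ⟨i₀, e₀⟩ := hμ.integral_gibbsKernel hΛ hb hA.measurableSet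
  obtain ⟨i₁, e₁⟩ := hμ.integral_gibbsKernel hΛ hb (hA.translate (-v)).measurableSet
  obtain ⟨i₂, e₂⟩ := hμ.integral_gibbsKernel hΛ hb (hA.translate v).measurableSet
  have hpt : ∀ Ybar, (gibbsKernel U z Λ Ybar A₀).toReal ≤
      2⁻¹ * (gibbsKernel U z Λ Ybar (Config.translate (-v) ⁻¹' A₀)).toReal +
        2⁻¹ * (gibbsKernel U z Λ Ybar (Config.translate v ⁻¹' A₀)).toReal + ε := by
    intro Ybar
    have hfin : ∀ A, gibbsKernel U z Λ Ybar A ≠ ⊤ := fun A =>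
      ((gibbsKernel_le_one U z Λ Ybar A).trans_lt ENNReal.one_lt_top).ne
    have h2 : ∀ A, 2⁻¹ * gibbsKernel U z Λ Ybar A ≠ ⊤ := fun A =>
      ENNReal.mul_ne_top (by simp) (hfin A)
    have := ENNReal.toReal_mono (ENNReal.add_ne_top.2 ⟨ENNReal.add_ne_top.2 ⟨h2 _, h2 _⟩,
      ENNReal.ofReal_ne_top⟩) (hle A hAm Ybar)
    rw [ENNReal.toReal_add (ENNReal.add_ne_top.2 ⟨h2 _, h2 _⟩) ENNReal.ofReal_ne_top,
      ENNReal.toReal_add (h2 _) (h2 _), ENNReal.toReal_mul, ENNReal.toReal_mul,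
      ENNReal.toReal_ofReal hε.le, ENNReal.toReal_inv, ENNReal.toReal_ofNat] at this
    exact this
  have hint := integral_mono i₀ (((i₁.const_mul 2⁻¹).add (i₂.const_mul 2⁻¹)).add
    (integrable_const ε)) hpt
  rw [e₀, integral_add' ((i₁.const_mul 2⁻¹).add (i₂.const_mul 2⁻¹)) (integrable_const ε),
    integral_add' (i₁.const_mul 2⁻¹) (i₂.const_mul 2⁻¹), integral_const_mul, integral_const_mul,
    e₁, e₂] at hint
  simp only [integral_const, probReal_univ, smul_eq_mul, one_mul] at hint
  linarith

end TranslationInvariance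

end GibbsParticles

end

theorem theorem1 {S : Type*} [Fintype S] [Nonempty S] [MeasurableSpace S]
    [MeasurableSingletonClass S] (z : ℝ) (hz : 0 < z)
    (h : Seminorm ℝ (ℝ × ℝ)) (hnorm : ∀ x, h x = 0 → x = 0)
    (φ : S → S → ℝ≥0 → ℝ≥0∞) (hmeas : ∀ σ₁ σ₂, Measurable (φ σ₁ σ₂))
    (hsymm : ∀ σ₁ σ₂, φ σ₁ σ₂ = φ σ₂ σ₁)
    (hwell : ∀ σ₁ σ₂, GibbsParticles.WellBehaved (φ σ₁ σ₂))
    (μ : Measure (GibbsParticles.Config S))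
    (hμ : GibbsParticles.IsGibbsMeasure (GibbsParticles.pottsPotential h φ) z μ) :
    ∀ v : ℝ × ℝ, μ.map (GibbsParticles.Config.translate v) = μ := by
  open GibbsParticles in
  obtain ⟨r, hr, hfar⟩ := exists_boltzRoot_eq_one h hnorm hwell
  obtain ⟨D, hDeps, hDe⟩ := exists_split h hnorm φ hmeas hsymm hwell
    -- Chosen so that `z * eps = 1/2`, which makes the sums over paths of bonds converge.
    (ε := 2⁻¹ * (ENNReal.ofReal z)⁻¹) (by simp)
  have hz0 : ENNReal.ofReal z ≠ 0 := by simpa using hz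
  have hzD : ENNReal.ofReal z * D.eps ≤ 2⁻¹ := by
    rw [hDeps, mul_left_comm, ENNReal.mul_inv_cancel hz0 ENNReal.ofReal_ne_top, mul_one]
  have hU : Measurable (Function.uncurry (pottsPotential h φ)) :=
    Split.measurable_pair (F := fun σ₁ σ₂ x => φ σ₁ σ₂ (nnSeminorm h x)) fun σ₁ σ₂ =>
      (hmeas σ₁ σ₂).comp (continuous_nnSeminorm h).measurable
  have hUsymm : ∀ a b : Particle S, pottsPotential h φ a b = pottsPotential h φ b a := by
    intro a b
    have : nnSeminorm h (a.1 - b.1) = nnSeminorm h (b.1 - a.1) :=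
      Subtype.ext (map_sub_rev h a.1 b.1)
    change φ a.2 b.2 (nnSeminorm h (a.1 - b.1)) = φ b.2 a.2 (nnSeminorm h (b.1 - a.1))
    rw [this, hsymm]
  have hD : D.full = fun a b => boltz (pottsPotential h φ a b) :=
    funext₂ fun a b => hDe a.2 b.2 (a.1 - b.1)
  have hrange : ∀ y y' : Particle S, r ≤ ‖y.1 - y'.1‖ → pottsPotential h φ y y' = 0 :=
    fun y y' hy => hfar _ hy _ _
  have := hμ.1
  exact map_translate_eq_of_midpoint_le fun A hA v =>
    hμ.measureReal_le D hU hUsymm hD hr hrange hzD hA v
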